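/- **Setting.** Let $P,\Xi\subset\mathbb C$ be finite sets and let $\mathcal M$ be a meromorphic bundle with connection $\nabla$ on $\mathbb{CP}^1$, with poles in $P\cup\{\infty\}$. Let $M$ be its module of global sections, a module over the Weyl algebra $\mathbb C[x]\langle\partial_x\rangle$. We suppose that: * near each $p\in P$, in a suitable trivialization, $\nabla=d+A^p\frac{dx}{x-p}+\text{holomorphic terms}$ with $A^p$ diagonal, each eigenvalue of $A^p$ being $0$ or having non-integral real part, and no two eigenvalues differing by a non-zero integer; * near $\infty$, in a suitable trivialization, $\nabla=d+\left(A+\frac Cx+O(x^{-2})\right)dx$ with $A,C$ diagonal, the eigenvalues of $A$ lying in $\Xi$, no eigenvalue of $C$ having integral real part, and no two eigenvalues of $C$ on the same eigenspace of $A$ differing by a non-zero integer; * $\mathcal M$ carries an admissible parabolic structure. Let $\psi_p^\alpha$ be the generalized $\alpha$-eigenspace of the residue of $\nabla$ at $p\in P$, realized as the generalized $\alpha$-eigenspace of $(x-p)\partial_x$ on the formal completion of $\mathcal M$ at $p$; for $\xi\in\Xi$ let $\widehat\psi_{\infty,\xi}^\alpha$ be the generalized $\alpha$-eigenspace of $-x(\partial_x-\xi)$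 (the residue of $\nabla-\xi\,dx$ in the coordinate $x^{-1}$) on the formal completion at $\infty$. A parabolic structure is a decreasing left-continuous filtration $\psi_p^{\alpha,\beta}$, $\widehat\psi_{\infty,\xi}^{\alpha,\beta}$ ($\beta\in\mathbb R$) of each of these spaces, with weights in some interval $[k,k+1[$, $k\in\mathbb Z$, such that multiplication by the local coordinate maps the part of index $(\alpha,\beta)$ isomorphically onto that of index $(\alpha+1,\beta+1)$. It is admissible if the only weight on $\psi_p^{0}$ is $0$, for every $p\in P$. Write $\mathrm{DMP}(P,\Xi)$ for the class of such $\mathcal M$. An *extension* of $\mathcal M$ is a $\mathbb C[x]\langle\partial_x\rangle$-module $N$ with a homomorphism $N\to M$ that becomes an isomorphism $\mathcal O(*P)\otimes N\cong M$; it is *minimal* if it has no non-zero submodule or quotient module supported in a point, and is then denoted $M_{\min}$. A module is minimal *at* a point if it has no non-zero submodule or quotient module supported at that point. The Laplace transform $\widehat N$ of $N$ is $N$ with $\xi$ acting as $\partial_x$ and $\partial_\xi$ as $-x$; the inverse Laplace transform is the inverse operation. The *parabolic minimal Laplace transform* of $\mathcal M\in\mathrm{DMP}(P,\Xi)$ is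 the meromorphic bundle $\widehat{\mathcal M}$ with poles in $\Xi\cup\{\infty\}$ induced by $\widehat{M_{\min}}$, with the filtrations transported, for $\alpha\notin\mathbb Z$, by the formal stationary phase isomorphisms $$\psi_\xi^\alpha\widehat{\mathcal M}\cong\widehat\psi_{\infty,\xi}^\alpha\mathcal M\quad(\xi\in\Xi),\qquad \widehat\psi_{\infty,-p}^\alpha\widehat{\mathcal M}\cong\psi_p^\alpha\mathcal M\quad(p\in P),$$ and with only weight $n$ on $\psi_\xi^n\widehat{\mathcal M}$ for $n\in\mathbb Z$. Here these isomorphisms are the ones dual to the formal Laplace transform of expansions: horizontal functionals on the completions, with values in $(y-p)^\alpha\mathbb C((y-p))$ and $e^{\xi z}z^{-\alpha}\mathbb C((z^{-1}))$, where $y,z$ are the dual variables with $\partial_y=\varepsilon z$, $\partial_z=-\varepsilon y$, $\xi=-\varepsilon p$, $\varepsilon=\pm1$, are identified by $(y-p)^{\alpha+k}\mapsto\varepsilon^k\,\Gamma(\alpha+k+1)\,z^{-(\alpha+k+1)}e^{\xi z}$ ($k\in\mathbb Z$). The *inverse parabolic minimal Laplace transform* of $\mathcal N\in\mathrm{DMP}(\Xi,-P)$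 is defined in the same way from the inverse Laplace transform of a minimal extension of $\mathcal N$, and has poles in $P\cup\{\infty\}$. **Proposition 4.2.** Let $P,\Xi\subset\mathbb C$ be finite. 1. Let $\mathcal M\in\mathrm{DMP}(P,\Xi)$. For every minimal extension $M_{\min}$ of $\mathcal M$, the Laplace transform $\widehat{M_{\min}}$ is minimal at every $\xi\in\Xi$. The parabolic minimal Laplace transform of $\mathcal M$ exists, every such transform $\widehat{\mathcal M}$ is in $\mathrm{DMP}(\Xi,-P)$, and $\widehat{M_{\min}}$ is a minimal extension of $\widehat{\mathcal M}$. Every inverse parabolic minimal Laplace transform of $\widehat{\mathcal M}$ is isomorphic to $\mathcal M$ with its parabolic structure, by an isomorphism induced by an isomorphism from $\widehat{M_{\min}}$ to the minimal extension of $\widehat{\mathcal M}$ that is used, compatible with the maps to $\widehat{\mathcal M}$. 2. Symmetrically, let $\mathcal N\in\mathrm{DMP}(\Xi,-P)$. For every minimal extension $N_{\min}$ of $\mathcal N$, the inverse Laplace transform of $N_{\min}$ is minimal at every $p\in P$. The inverse parabolic minimal Laplace transform of $\mathcal N$ exists, every such transform is in $\mathrm{DMP}(P,\Xi)$ and has the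 inverse Laplace transform of $N_{\min}$ as a minimal extension, and each of its parabolic minimal Laplace transforms is isomorphic to $\mathcal N$ with its parabolic structure, by an isomorphism induced in the same way. Thus the parabolic minimal Laplace transform and its inverse are inverse to each other. -/

import Mathlib

open scoped Polynomial TensorProduct LaurentSeries

universe u

noncomputable section

/-! ### Modules over the Weyl algebra and the Laplace transform -/

/-- A left module over the Weyl algebra `ℂ[x]⟨∂⟩`: a complex vector space with an action of
`x` and of `∂` (written `d`) satisfying `[x, ∂] = -1`. -/
structure WeylModule where
  carrier : Type u
  [addCommGroup : AddCommGroup carrier]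
  [module : Module ℂ carrier]
  x : Module.End ℂ carrier
  d : Module.End ℂ carrier
  comm : x * d - d * x = -1

attribute [instance] WeylModule.addCommGroup WeylModule.module

namespace WeylModule

/-- The Laplace transform: `ξ` acts as `∂_x` and `∂_ξ` acts as `-x`. -/
def laplace (M : WeylModule.{u}) : WeylModule.{u} where
  carrier := M.carrier
  x := M.d
  d := -M.x
  comm := by rw [← M.comm]; noncomm_ring

/-- The inverse Laplace transform: `x` acts as `-∂_ξ` and `∂_x` acts as `ξ`. -/
def invLaplace (N : WeylModule.{u}) : WeylModule.{u} where
  carrier := N.carrier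
  x := -N.d
  d := N.x
  comm := by rw [← N.comm]; noncomm_ring

theorem invLaplace_laplace (M : WeylModule.{u}) : M.laplace.invLaplace = M := by
  obtain ⟨V, x, d, h⟩ := M
  simp only [laplace, invLaplace]
  congr
  exact neg_neg x

theorem laplace_invLaplace (M : WeylModule.{u}) : M.invLaplace.laplace = M := by
  obtain ⟨V, x, d, h⟩ := M
  simp only [laplace, invLaplace]
  congr
  exact neg_neg d

theorem d_x_apply (M : WeylModule.{u}) (m : M.carrier) : M.d (M.x m) = m + M.x (M.d m) := by
  have h := congrArg (fun f : Module.End ℂ M.carrier => f m) M.comm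
  simp only [LinearMap.sub_apply, Module.End.mul_apply, LinearMap.neg_apply,
    Module.End.one_apply] at h
  rw [sub_eq_iff_eq_add] at h
  rw [h]; abel

/-- `M` as a module over the polynomial ring `ℂ[x]`, the variable acting through `x`. -/
abbrev poly (M : WeylModule.{u}) : Type u := Module.AEval' M.x

/-- An element of `M`, seen in the `ℂ[x]`-module `M.poly`. -/
abbrev toPoly (M : WeylModule.{u}) : M.carrier ≃ₗ[ℂ] M.poly := Module.AEval'.of M.x

/-- The operator `∂` on `M.poly`. -/
def dPoly (M : WeylModule.{u}) : M.poly →ₗ[ℂ] M.poly :=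
  M.toPoly.toLinearMap ∘ₗ M.d ∘ₗ M.toPoly.symm.toLinearMap

theorem dPoly_X_smul (M : WeylModule.{u}) (m : M.poly) :
    M.dPoly ((Polynomial.X : ℂ[X]) • m) = m + (Polynomial.X : ℂ[X]) • M.dPoly m := by
  obtain ⟨m, rfl⟩ := M.toPoly.surjective m
  rw [Module.AEval'.X_smul_of]
  simp only [dPoly, LinearMap.comp_apply, LinearEquiv.coe_coe, LinearEquiv.symm_apply_apply]
  rw [M.d_x_apply, map_add, Module.AEval'.X_smul_of]

/-- Homomorphisms of modules over the Weyl algebra. -/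
structure Hom (M N : WeylModule.{u}) where
  toLin : M.carrier →ₗ[ℂ] N.carrier
  map_x : ∀ m, toLin (M.x m) = N.x (toLin m)
  map_d : ∀ m, toLin (M.d m) = N.d (toLin m)

/-- The `ℂ[x]`-linear map underlying a homomorphism. -/
def Hom.polyMap {M N : WeylModule.{u}} (f : Hom M N) : M.poly →ₗ[ℂ[X]] N.poly :=
  LinearMap.ofAEval M.x (N.toPoly.toLinearMap ∘ₗ f.toLin) (fun m => by
    change N.toPoly (f.toLin (M.x m)) = _
    rw [f.map_x]
    exact (Module.AEval'.X_smul_of N.x (f.toLin m)).symm)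

/-- `S` is a submodule over the Weyl algebra. -/
def IsSub (M : WeylModule.{u}) (S : Submodule ℂ M.carrier) : Prop :=
  ∀ s ∈ S, M.x s ∈ S ∧ M.d s ∈ S

/-- `M` has no non-zero submodule and no non-zero quotient module supported at the point `p`
(a module is supported at `p` when each of its elements is killed by a power of `x - p`). -/
structure IsMinimalAt (M : WeylModule.{u}) (p : ℂ) : Prop where
  no_sub : ∀ S : Submodule ℂ M.carrier, M.IsSub S →
    (∀ s ∈ S, ∃ k : ℕ, ((M.x - p • 1) ^ k) s = 0) → S = ⊥
  no_quot : ∀ S : Submodule ℂ M.carrier, M.IsSub S →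
    (∀ m, ∃ k : ℕ, ((M.x - p • 1) ^ k) m ∈ S) → S = ⊤

end WeylModule

open WeylModule

/-- The polynomial `∏_{p ∈ P} (x - p)`. -/
def polePoly (P : Finset ℂ) : ℂ[X] := ∏ p ∈ P, (Polynomial.X - Polynomial.C p)

/-- `j : N ⟶ M` exhibits `M` as `𝒪(*P) ⊗ N`, the meromorphic bundle induced by `N` with poles
in `P` (and at infinity); in other words, `N` is an extension of `M`. -/
def IsExtension (P : Finset ℂ) {N M : WeylModule.{u}} (j : Hom N M) : Prop :=
  IsLocalizedModule (Submonoid.powers (polePoly P)) j.polyMap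

/-- `j : N ⟶ M` makes `N` a minimal extension of `M`: it is an extension without non-zero
submodule or quotient module supported in a point. -/
structure IsMinimalExtension (P : Finset ℂ) {N M : WeylModule.{u}} (j : Hom N M) : Prop where
  isExtension : IsExtension P j
  isMinimalAt : ∀ p : ℂ, N.IsMinimalAt p

/-! ### Formal completions -/

/-- The punctured formal disc at a point of the Riemann sphere: the field `ℂ((t))` of Laurent
series in a local coordinate `t`, with the expansion `z` of the global coordinate `x` and with
the derivation `δ = d/dx`. -/
structure FormalDisc where
  z : ℂ⸨X⸩
  δ : ℂ⸨X⸩ →ₗ[ℂ] ℂ⸨X⸩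
  leibniz : ∀ a, δ (z * a) = a + z * δ a

/-- The local coordinate `t`. -/
def localParam : ℂ⸨X⸩ := HahnSeries.single 1 1

theorem derivative_single_mul (n : ℤ) (c : ℂ) (a : ℂ⸨X⸩) :
    LaurentSeries.derivative ℂ (HahnSeries.single n c * a) =
      HahnSeries.single (n - 1) ((n : ℂ) * c) * a +
        HahnSeries.single n c * LaurentSeries.derivative ℂ a := by
  ext k
  have h (m i : ℤ) (r : ℂ) (b : ℂ⸨X⸩) :
      (HahnSeries.single m r * b).coeff i = r * b.coeff (i - m) := by
    have := HahnSeries.coeff_single_mul_add (r := r) (x := b) (a := i - m) (b := m)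
    rwa [sub_add_cancel] at this
  simp only [LaurentSeries.derivative_apply, HahnSeries.coeff_add, h,
    LaurentSeries.hasseDeriv_coeff, Ring.choose_one_right, zsmul_eq_mul, Nat.cast_one]
  rw [show k - (n - 1) = k + 1 - n by ring, show k - n + 1 = k + 1 - n by ring]
  push_cast
  ring

/-- The punctured formal disc at a point `p` of the complex line: `x = p + t`, `d/dx = d/dt`. -/
def discAt (p : ℂ) : FormalDisc where
  z := HahnSeries.single 0 p + localParam
  δ := LaurentSeries.derivative ℂ
  leibniz a := by
    rw [localParam, add_mul, map_add, derivative_single_mul, derivative_single_mul]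
    have h : (HahnSeries.single (1 - 1 : ℤ) ((1 : ℤ) * (1 : ℂ)) : ℂ⸨X⸩) = 1 := by simp
    have h0 : (HahnSeries.single (0 - 1 : ℤ) (((0 : ℤ) : ℂ) * p) : ℂ⸨X⸩) = 0 := by simp
    rw [h, h0]
    ring

/-- The punctured formal disc at infinity: `x = 1/t`, `d/dx = -t² d/dt`. -/
def discInfty : FormalDisc where
  z := HahnSeries.single (-1) 1
  δ :=
    { toFun := fun a => HahnSeries.single 2 (-1) * LaurentSeries.derivative ℂ a
      map_add' := fun a b => by rw [map_add, mul_add]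
      map_smul' := fun c a => by
        rw [map_smul, RingHom.id_apply, ← HahnSeries.C_mul_eq_smul, ← HahnSeries.C_mul_eq_smul]
        ring }
  leibniz a := by
    change HahnSeries.single 2 (-1) * LaurentSeries.derivative ℂ _ =
      a + _ * (HahnSeries.single 2 (-1) * LaurentSeries.derivative ℂ a)
    rw [derivative_single_mul, mul_add, ← mul_assoc, HahnSeries.single_mul_single]
    have h : (HahnSeries.single (2 + (-1 - 1) : ℤ) (-1 * (((-1 : ℤ) : ℂ) * 1)) : ℂ⸨X⸩) = 1 := by
      norm_num
    rw [h]
    ring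

namespace FormalDisc

/-- The field `ℂ((t))`, as an algebra over `ℂ[x]` through the expansion of `x`. -/
def K (_Δ : FormalDisc) : Type := ℂ⸨X⸩

instance (Δ : FormalDisc) : Field Δ.K := inferInstanceAs (Field ℂ⸨X⸩)

instance (Δ : FormalDisc) : Algebra ℂ Δ.K := HahnSeries.instAlgebra (Γ := ℤ) (R := ℂ) (A := ℂ)

/-- The expansion of the global coordinate, as an element of `Δ.K`. -/
def zK (Δ : FormalDisc) : Δ.K := Δ.z

instance (Δ : FormalDisc) : Algebra ℂ[X] Δ.K :=
  (Polynomial.aeval (R := ℂ) Δ.zK).toRingHom.toAlgebra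

instance (Δ : FormalDisc) : IsScalarTower ℂ ℂ[X] Δ.K :=
  IsScalarTower.of_algebraMap_eq fun c => by
    change _ = Polynomial.aeval (R := ℂ) Δ.zK (Polynomial.C c)
    rw [Polynomial.aeval_C]

/-- The derivation `d/dx` of `ℂ((t))`. -/
def deriv (Δ : FormalDisc) : Δ.K →ₗ[ℂ] Δ.K := Δ.δ

/-- The local coordinate `t`. -/
def t (Δ : FormalDisc) : Δ.K := localParam

/-- The coefficient of `t ^ n`. -/
def coeff (Δ : FormalDisc) (a : Δ.K) (n : ℤ) : ℂ := HahnSeries.coeff (Γ := ℤ) (R := ℂ) a n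

theorem deriv_X_smul (Δ : FormalDisc) (a : Δ.K) :
    Δ.deriv ((Polynomial.X : ℂ[X]) • a) = a + (Polynomial.X : ℂ[X]) • Δ.deriv a := by
  have h : ∀ b : Δ.K, (Polynomial.X : ℂ[X]) • b = Δ.zK * b := fun b => by
    rw [Algebra.smul_def]
    change Polynomial.aeval (R := ℂ) Δ.zK Polynomial.X * b = _
    rw [Polynomial.aeval_X]
  rw [h, h]
  exact Δ.leibniz a

end FormalDisc

namespace WeylModule

/-- The formal completion `ℂ((t)) ⊗_{ℂ[x]} M` of (the meromorphic bundle induced by) `M` at a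
point of the Riemann sphere. -/
abbrev Completion (M : WeylModule.{u}) (Δ : FormalDisc) : Type u := Δ.K ⊗[ℂ[X]] M.poly

/-- The class `1 ⊗ m` in the formal completion. -/
def toCompletion (M : WeylModule.{u}) (Δ : FormalDisc) (m : M.carrier) : M.Completion Δ :=
  (1 : Δ.K) ⊗ₜ[ℂ[X]] M.toPoly m

theorem nabla_balanced (M : WeylModule.{u}) (Δ : FormalDisc) (r : ℂ[X]) (a : Δ.K) (m : M.poly) :
    (Δ.deriv (r • a)) ⊗ₜ[ℂ[X]] m + (r • a) ⊗ₜ[ℂ[X]] M.dPoly m =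
      (Δ.deriv a) ⊗ₜ[ℂ[X]] (r • m) + a ⊗ₜ[ℂ[X]] M.dPoly (r • m) := by
  induction r using Polynomial.induction_on' generalizing a m with
  | add p q hp hq =>
    simp only [add_smul, map_add, TensorProduct.add_tmul, TensorProduct.tmul_add]
    have h1 := hp a m
    have h2 := hq a m
    rw [add_add_add_comm, h1, h2, add_add_add_comm]
  | monomial n c =>
    induction n generalizing a m with
    | zero =>
      rw [Polynomial.monomial_zero_left]
      have h1 (b : Δ.K) : (Polynomial.C c : ℂ[X]) • b = c • b := by
        rw [Polynomial.C_eq_algebraMap, algebraMap_smul]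
      have h2 (b : M.poly) : (Polynomial.C c : ℂ[X]) • b = c • b := by
        rw [Polynomial.C_eq_algebraMap, algebraMap_smul]
      rw [h1, h2, map_smul, map_smul, ← h1, ← h1, ← h2, ← h2]
      rw [TensorProduct.smul_tmul, TensorProduct.smul_tmul]
    | succ n ih =>
      have hX : (Polynomial.monomial (n + 1) c : ℂ[X]) =
          Polynomial.monomial n c * Polynomial.X := by
        rw [Polynomial.monomial_mul_X]
      have e1 := ih ((Polynomial.X : ℂ[X]) • a) m
      have e2 : (Polynomial.monomial (n + 1) c : ℂ[X]) • a =
          (Polynomial.monomial n c : ℂ[X]) • ((Polynomial.X : ℂ[X]) • a) := by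
        rw [hX, mul_smul]
      have e3 : (Polynomial.monomial (n + 1) c : ℂ[X]) • m =
          (Polynomial.X : ℂ[X]) • ((Polynomial.monomial n c : ℂ[X]) • m) := by
        rw [hX, mul_comm, mul_smul]
      rw [e2, e1, e3, Δ.deriv_X_smul, M.dPoly_X_smul, TensorProduct.add_tmul,
        TensorProduct.tmul_add, TensorProduct.smul_tmul, TensorProduct.smul_tmul]
      abel

/-- The biadditive map `(a, m) ↦ a' ⊗ m + a ⊗ ∂m`. -/
def nablaAux (M : WeylModule.{u}) (Δ : FormalDisc) : Δ.K →+ M.poly →+ M.Completion Δ where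
  toFun a :=
    { toFun := fun m => (Δ.deriv a) ⊗ₜ[ℂ[X]] m + a ⊗ₜ[ℂ[X]] M.dPoly m
      map_zero' := by rw [map_zero, TensorProduct.tmul_zero, TensorProduct.tmul_zero, add_zero]
      map_add' := fun m m' => by
        rw [map_add, TensorProduct.tmul_add, TensorProduct.tmul_add, add_add_add_comm] }
  map_zero' := AddMonoidHom.ext fun m => by
    change (Δ.deriv 0) ⊗ₜ[ℂ[X]] m + (0 : Δ.K) ⊗ₜ[ℂ[X]] M.dPoly m = 0
    rw [map_zero, TensorProduct.zero_tmul, TensorProduct.zero_tmul, add_zero]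
  map_add' a a' := AddMonoidHom.ext fun m => by
    change (Δ.deriv (a + a')) ⊗ₜ[ℂ[X]] m + (a + a') ⊗ₜ[ℂ[X]] M.dPoly m =
      ((Δ.deriv a) ⊗ₜ[ℂ[X]] m + a ⊗ₜ[ℂ[X]] M.dPoly m) +
        ((Δ.deriv a') ⊗ₜ[ℂ[X]] m + a' ⊗ₜ[ℂ[X]] M.dPoly m)
    rw [map_add, TensorProduct.add_tmul, TensorProduct.add_tmul, add_add_add_comm]

/-- The connection on the formal completion, as an additive map. -/
def nablaAdd (M : WeylModule.{u}) (Δ : FormalDisc) : M.Completion Δ →+ M.Completion Δ :=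
  TensorProduct.liftAddHom (M.nablaAux Δ) (M.nabla_balanced Δ)

theorem nablaAdd_tmul (M : WeylModule.{u}) (Δ : FormalDisc) (a : Δ.K) (m : M.poly) :
    M.nablaAdd Δ (a ⊗ₜ[ℂ[X]] m) = (Δ.deriv a) ⊗ₜ[ℂ[X]] m + a ⊗ₜ[ℂ[X]] M.dPoly m := rfl

/-- The connection `∇_{∂/∂x}` on the formal completion, `a ⊗ m ↦ a' ⊗ m + a ⊗ ∂m`. -/
def nabla (M : WeylModule.{u}) (Δ : FormalDisc) : M.Completion Δ →ₗ[ℂ] M.Completion Δ where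
  toFun := M.nablaAdd Δ
  map_add' := map_add _
  map_smul' c w := by
    rw [RingHom.id_apply]
    induction w using TensorProduct.induction_on with
    | zero => rw [smul_zero, map_zero, smul_zero]
    | add a b ha hb => rw [smul_add, map_add, ha, hb, map_add, smul_add]
    | tmul a m =>
      rw [TensorProduct.smul_tmul', nablaAdd_tmul, nablaAdd_tmul, map_smul, smul_add,
        TensorProduct.smul_tmul', TensorProduct.smul_tmul']

theorem nabla_tmul (M : WeylModule.{u}) (Δ : FormalDisc) (a : Δ.K) (m : M.poly) :
    M.nabla Δ (a ⊗ₜ[ℂ[X]] m) = (Δ.deriv a) ⊗ₜ[ℂ[X]] m + a ⊗ₜ[ℂ[X]] M.dPoly m := rfl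

/-- Multiplication by an element of `ℂ((t))` on the formal completion. -/
def mulBy (M : WeylModule.{u}) {Δ : FormalDisc} (a : Δ.K) :
    M.Completion Δ →ₗ[ℂ] M.Completion Δ :=
  (LinearMap.lsmul Δ.K (M.Completion Δ) a).restrictScalars ℂ

/-- The map of formal completions induced by a homomorphism. -/
def Hom.completionMap {M N : WeylModule.{u}} (f : Hom M N) (Δ : FormalDisc) :
    M.Completion Δ →ₗ[ℂ] N.Completion Δ :=
  (TensorProduct.AlgebraTensorModule.lTensor Δ.K Δ.K f.polyMap).restrictScalars ℂ

/-- `ψ_p^α`: the generalized `α`-eigenspace of the residue at `p`. On a logarithmic lattice the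
residue is induced by `(x - p) ∂_x`; its generalized `α`-eigenspace is realized, independently
of the lattice, as the generalized `α`-eigenspace of `(x - p) ∂_x` on the formal completion. -/
def psi (M : WeylModule.{u}) (p α : ℂ) : Submodule ℂ (M.Completion (discAt p)) :=
  Module.End.maxGenEigenspace (M.mulBy (discAt p).t * M.nabla (discAt p)) α

/-- The component of `ψ̂_∞^α` belonging to the eigenvalue `ξ` of the leading term `A`. In the
local coordinate `t = 1/x` the residue at infinity of the regular singular connection
`∇ - ξ dx` is `-x (∂_x - ξ)`, and `ψ̂_∞^{α}` is its generalized `α`-eigenspace on the formal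
completion at infinity. -/
def psiInfty (M : WeylModule.{u}) (ξ α : ℂ) : Submodule ℂ (M.Completion discInfty) :=
  Module.End.maxGenEigenspace
    (-(M.mulBy (discInfty.t)⁻¹ * (M.nabla discInfty - ξ • 1))) α

end WeylModule

/-! ### Meromorphic bundles of the type considered -/

/-- The connection at `p` is `d + A dx/(x - p) + holomorphic terms` in a suitable
trivialization, with `A` diagonal and resonance-free: each eigenvalue is `0` or has
non-integral real part, and two eigenvalues never differ by a non-zero integer.

It amounts to the same to ask this of a lattice in the meromorphic bundle or in its formal
completion (lattices of both correspond to each other, and a formal trivialization may be replaced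
by one of the original lattice which agrees with it to high order); it is expressed here on the
formal completion: `e` is the trivialization, and the coefficients of negative order of the matrix
of `∇_{∂/∂x}` are prescribed. -/
def HasLogLattice (M : WeylModule.{u}) (p : ℂ) : Prop :=
  ∃ (r : ℕ) (e : Module.Basis (Fin r) (discAt p).K (M.Completion (discAt p))) (μ : Fin r → ℂ),
    (∀ i k : Fin r, ∀ n : ℤ, n < 0 →
      (discAt p).coeff (e.repr (M.nabla (discAt p) (e i)) k) n =
        if k = i ∧ n = -1 then μ i else 0) ∧
    (∀ i, μ i = 0 ∨ ∀ n : ℤ, (μ i).re ≠ n) ∧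
    (∀ i k, ∀ n : ℤ, n ≠ 0 → μ i - μ k ≠ n)

/-- The connection at infinity is `d + (A + C/x + O(x⁻²)) dx` in a suitable trivialization, with
`A` and `C` diagonal, the eigenvalues of `A` lying in `Ξ`, and `C` resonance-free: no eigenvalue
of `C` has integral real part, and two eigenvalues of `C` on the same eigenspace of `A` never
differ by a non-zero integer. -/
def HasRankOneLattice (M : WeylModule.{u}) (Ξ : Finset ℂ) : Prop :=
  ∃ (r : ℕ) (e : Module.Basis (Fin r) discInfty.K (M.Completion discInfty)) (A C : Fin r → ℂ),
    (∀ i k : Fin r, ∀ n : ℤ, n < 2 →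
      discInfty.coeff (e.repr (M.nabla discInfty (e i)) k) n =
        if k = i ∧ n = 0 then A i else if k = i ∧ n = 1 then C i else 0) ∧
    (∀ i, A i ∈ Ξ) ∧
    (∀ i, ∀ n : ℤ, (C i).re ≠ n) ∧
    (∀ i k, A i = A k → ∀ n : ℤ, n ≠ 0 → C i - C k ≠ n)

/-- `M` is the module of global sections of a meromorphic bundle with connection on the Riemann
sphere, with poles in `P ∪ {∞}`: it is a finitely generated module over the ring
`ℂ[x][1/∏(x - p)]` of functions on the complement of `P ∪ {∞}`. The singularities are logarithmic
with semisimple resonance-free residue in `P`, and at infinity resonance-free of Poincaré rank one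
with diagonalizable polar part and leading eigenvalues in `Ξ`. -/
structure IsMeromorphicBundle (P Ξ : Finset ℂ) (M : WeylModule.{u}) : Prop where
  invertible : ∀ p ∈ P, IsUnit (M.x - p • 1)
  finite : ∃ L : Submodule ℂ[X] M.poly, L.FG ∧
    ∀ m : M.poly, ∃ k : ℕ, (polePoly P ^ k) • m ∈ L
  logarithmic : ∀ p ∈ P, HasLogLattice M p
  infinity : HasRankOneLattice M Ξ

/-! ### Parabolic structures -/

/-- A module over the Weyl algebra together with filtrations, indexed by real numbers, of the
spaces `ψ_p^α` and of the components of the spaces `ψ̂_∞^α`. -/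
structure FilteredModule where
  toModule : WeylModule.{u}
  fin : ∀ p : ℂ, ℂ → ℝ → Submodule ℂ (toModule.Completion (discAt p))
  inf : ℂ → ℂ → ℝ → Submodule ℂ (toModule.Completion discInfty)
  fin_le : ∀ p α β, fin p α β ≤ toModule.psi p α
  inf_le : ∀ ξ α β, inf ξ α β ≤ toModule.psiInfty ξ α

/-- `F` is a parabolic structure of a regular singular connection on `H`, where `V α` are the
generalized eigenspaces of the residue and `T` is the multiplication by the local coordinate:
each `F α` is a decreasing filtration of `V α` with weights in an interval `[k, k + 1[`, equal to
`V α` at `k`, and the powers of `T` are filtered isomorphisms which shift both the eigenvalue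
and the weight. A filtration is extended from `[k, k + 1[` to all real numbers by `V α` below `k`
and by `0` from `k + 1` on, and as usual `F α β` is the part of weight at least `β`, i.e. the
filtration is continuous from the left. -/
structure IsParabolic {H : Type u} [AddCommGroup H] [Module ℂ H] (V : ℂ → Submodule ℂ H)
    (T : H →ₗ[ℂ] H) (F : ℂ → ℝ → Submodule ℂ H) : Prop where
  antitone : ∀ α, Antitone (F α)
  left_cont : ∀ α β, (⨅ γ : {γ : ℝ // γ < β}, F α γ) ≤ F α β
  interval : ∀ α, ∃ k : ℤ, F α k = V α ∧ F α (k + 1) = ⊥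
  shift : ∀ α β u, u ∈ F α β ↔ T u ∈ F (α + 1) (β + 1)

/-- A meromorphic bundle with connection, of the type considered, with an admissible parabolic
structure in all singular points. The structure is admissible at `p` when `ψ_p^0` has only the
weight `0`. -/
structure FilteredModule.IsParabolicBundle (P Ξ : Finset ℂ) (M : FilteredModule.{u}) : Prop where
  isMeromorphicBundle : IsMeromorphicBundle P Ξ M.toModule
  parabolic : ∀ p ∈ P,
    IsParabolic (M.toModule.psi p) (M.toModule.mulBy (discAt p).t) (M.fin p)
  admissible : ∀ p ∈ P, M.fin p 0 0 = M.toModule.psi p 0 ∧ ∀ β : ℝ, 0 < β → M.fin p 0 β = ⊥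
  parabolic_infinity : ∀ ξ ∈ Ξ,
    IsParabolic (M.toModule.psiInfty ξ) (M.toModule.mulBy discInfty.t) (M.inf ξ)

/-- A homomorphism is an isomorphism of parabolic bundles. -/
structure IsParabolicIso (P Ξ : Finset ℂ) {M M' : FilteredModule.{u}}
    (e : Hom M.toModule M'.toModule) : Prop where
  bijective : Function.Bijective e.toLin
  map_fin : ∀ p ∈ P, ∀ α β,
    (M.fin p α β).map (e.completionMap (discAt p)) = M'.fin p α β
  map_inf : ∀ ξ ∈ Ξ, ∀ α β,
    (M.inf ξ α β).map (e.completionMap discInfty) = M'.inf ξ α β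

/-! ### Formal stationary phase -/

/-- A horizontal functional at `p` with exponent `α`: a `ℂ((t))`-linear functional `h` on the
formal completion such that `u ↦ h(u) (x - p)^α` commutes with the derivations. On an element
`u` with `(x - p) ∇u = α u` it takes a constant value. -/
def IsHorizontalAt (M : WeylModule.{u}) (p α : ℂ)
    (h : M.Completion (discAt p) →ₗ[(discAt p).K] (discAt p).K) : Prop :=
  ∀ u, h (M.nabla (discAt p) u) = (discAt p).deriv (h u) + (α • (discAt p).t⁻¹) * h u

/-- A horizontal functional at infinity with exponents `ξ`, `α`: a `ℂ((1/x))`-linear functional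
`g` on the formal completion such that `v ↦ g(v) x^{-α} e^{ξ x}` commutes with the derivations.
On an element `v` with `-x (∇ - ξ) v = α v` it takes a constant value. -/
def IsHorizontalInfty (M : WeylModule.{u}) (ξ α : ℂ)
    (g : M.Completion discInfty →ₗ[discInfty.K] discInfty.K) : Prop :=
  ∀ v, g (M.nabla discInfty v) =
    discInfty.deriv (g v) + (algebraMap ℂ discInfty.K ξ - α • discInfty.t) * g v

/-- The formal stationary phase isomorphism `ψ_p^α(A) ≅ ψ̂_∞^α(B)` (for `α` not an integer; on
the right the component belonging to the leading eigenvalue `ξ`), as a relation between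
`u ∈ ψ_p^α(A)` and `v ∈ ψ̂_∞^α(B)`.

Here `A`, `B` are modules in dual variables `y`, `z`, and both receive a localization map, `a`
respectively `b`, from one space `N` on which `∂_y = ε z` and `∂_z = -ε y`, where `ε = 1` or
`ε = -1`; moreover `ξ = -ε p`, so that `y - p = -ε (∂_z - ξ)` on `N`.
The formal Laplace transform
`(y - p)^{α + k} ↦ ε^k Γ(α + k + 1) z^{-(α + k + 1)} e^{ξ z}`, `k ∈ ℤ`,
(the formal expansion of Laplace integrals) extends to an isomorphism of modules over the Weyl
algebra from `(y - p)^α ℂ((y - p))` to `z^{-α} ℂ((1/z)) e^{ξ z}`. A horizontal functional of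
`A` at `p` and one of `B` at infinity match if this transform exchanges them on `N`, and `u`
corresponds to `v` if all pairs of matching functionals take the same value on `u` and on `v`. -/
def StationaryPhase (ε : ℤ) {N : Type u} (A B : WeylModule.{u})
    (a : N → A.carrier) (b : N → B.carrier) (p ξ α : ℂ)
    (u : A.Completion (discAt p)) (v : B.Completion discInfty) : Prop :=
  u ∈ A.psi p α ∧ v ∈ B.psiInfty ξ α ∧
  ∀ (h : A.Completion (discAt p) →ₗ[(discAt p).K] (discAt p).K)
    (g : B.Completion discInfty →ₗ[discInfty.K] discInfty.K),
    IsHorizontalAt A p α h → IsHorizontalInfty B ξ α g →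
    (∀ (n : N) (k : ℤ),
      discInfty.coeff (g (B.toCompletion discInfty (b n))) (k + 1) =
        ((ε : ℂ) ^ k * Complex.Gamma (α + k + 1)) *
          (discAt p).coeff (h (A.toCompletion (discAt p) (a n))) k) →
    (discAt p).coeff (h u) 0 = discInfty.coeff (g v) 0

/-! ### The parabolic minimal Laplace transform -/

/-- The finite set `-P`. -/
def negPoints (P : Finset ℂ) : Finset ℂ := P.map (Equiv.neg ℂ).toEmbedding

/-- The parabolic structure of `A` at the regular singular point `p` is the one transported from
infinity on `B`: for non-integral `α` through formal stationary phase, while on the `0`-eigenspace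
(hence on all integral ones, by the shift) it is the trivial one, of weight `0`. -/
structure FinFromInfty (ε : ℤ) {N : Type u} (A B : FilteredModule.{u})
    (a : N → A.toModule.carrier) (b : N → B.toModule.carrier) (p ξ : ℂ) : Prop where
  nonintegral : ∀ α : ℂ, (∀ n : ℤ, α ≠ n) → ∀ (β : ℝ) (u), u ∈ A.fin p α β ↔
    ∃ v ∈ B.inf ξ α β, StationaryPhase ε A.toModule B.toModule a b p ξ α u v
  integral_le : ∀ (n : ℤ) (β : ℝ), β ≤ n → A.fin p n β = A.toModule.psi p n
  integral_gt : ∀ (n : ℤ) (β : ℝ), n < β → A.fin p n β = ⊥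

/-- The parabolic structure of `B` at infinity, on the component belonging to `ξ`, is the one
transported from the regular singular point `p` of `A` through formal stationary phase. -/
def InftyFromFin (ε : ℤ) {N : Type u} (A B : FilteredModule.{u})
    (a : N → A.toModule.carrier) (b : N → B.toModule.carrier) (p ξ : ℂ) : Prop :=
  ∀ α : ℂ, (∀ n : ℤ, α ≠ n) → ∀ (β : ℝ) (v), v ∈ B.inf ξ α β ↔
    ∃ u ∈ A.fin p α β, StationaryPhase ε A.toModule B.toModule a b p ξ α u v

/-- `M'` is the parabolic minimal Laplace transform of `M`: it is the meromorphic bundle, with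
poles in `Ξ` and at infinity, associated to the Laplace transform of a minimal extension `N`
of `M`, with the parabolic structure transported by formal stationary phase. -/
structure MinimalLaplace (P Ξ : Finset ℂ) (M M' : FilteredModule.{u}) where
  N : WeylModule.{u}
  ext : Hom N M.toModule
  isMinimalExtension : IsMinimalExtension P ext
  loc : Hom N.laplace M'.toModule
  isExtension : IsExtension Ξ loc
  fin : ∀ ξ ∈ Ξ, FinFromInfty (N := N.carrier) (-1) M' M loc.toLin ext.toLin ξ ξ
  inf : ∀ p ∈ P, InftyFromFin (N := N.carrier) 1 M M' ext.toLin loc.toLin p (-p)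

/-- `M` is the inverse parabolic minimal Laplace transform of `M'`: it is the meromorphic bundle,
with poles in `P` and at infinity, associated to the inverse Laplace transform of a minimal
extension `N` of `M'`, with the parabolic structure transported by formal stationary phase. -/
structure InverseMinimalLaplace (P Ξ : Finset ℂ) (M' M : FilteredModule.{u}) where
  N : WeylModule.{u}
  ext : Hom N M'.toModule
  isMinimalExtension : IsMinimalExtension Ξ ext
  loc : Hom N.invLaplace M.toModule
  isExtension : IsExtension P loc
  fin : ∀ p ∈ P, FinFromInfty (N := N.carrier) 1 M M' loc.toLin ext.toLin p (-p)
  inf : ∀ ξ ∈ Ξ, InftyFromFin (N := N.carrier) (-1) M' M ext.toLin loc.toLin ξ ξ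

end

set_option linter.unusedSectionVars false

/-! Both directions are treated at once: a sign ε = ±1 distinguishes the transform from its inverse,
`IsDualPair` expresses that `N` and `N'` are one space in dual variables, and `DualTransform`
collects the data of either transform.

Local theory. Everything is phrased through horizontal functionals, that is, homomorphisms from a
completion to a rank one connection on ℂ((t)). Without resonance the completions can be diagonalized
(`exists_isNormalBasis`), so the horizontal functionals of exponent α pair perfectly with the
α-eigenspace. They are the same as homomorphisms from an extension `N` to ℂ((t))
(`IsSolution.exists_lift`). For non-integral α the formal Laplace transform with its Gamma factors
is an isomorphism of Weyl modules, so composition with it matches horizontal functionals at p with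
those at infinity (`exists_matching_equiv`), and stationary phase is the dual bijection.

Minimality (`isMinimalAt_of_dual`). A submodule of the transform supported at a point gives a
section of `N` with ∂n = ξn; a quotient supported at a point gives a homomorphism from `N` to
ℂ[x]e^{ξx}. Each would produce an integral exponent at infinity, and there is none.

Type of the transform (`isMeromorphicBundle_of_dual`). The sections of `N` lying in a lattice at
infinity are stable under ∂, so they form a module L over the polynomials in the dual variable. They
are filtered by the pole order j at the points of P. Components of exponent zero have no poles on a
minimal extension, so the leading polar coefficients live in a space of dimension ν, the number of
non-zero exponents, on which ∂ acts by the non-zero factors μ − j. Hence L is finitely generated, of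
rank t ≤ ν. Stationary phase supplies ν independent horizontal functionals of the transform at
infinity, so t = ν and they diagonalize it. At ξ, the functionals coming from the m components at
infinity with eigenvalue ξ are completed by t − m Taylor series of functionals on the fibre of `N'`,
which have exponent zero.

Existence. The elements regular for all functionals of exponent zero form an extension. Its
transform is of the right type before minimality is known, and the minimality argument read
backwards shows that the extension is minimal.

Inversion (`DualTransform.exists_iso`). Minimal extensions are unique, so two transforms lead back
to the original `N` and, by localization, to the original bundle. Both transforms use the same
stationary phase relation, so no inversion formula is needed for the filtrations. Integral exponents
are settled by admissibility at finite points and do not occur at infinity. -/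

namespace FormalDisc

variable (Δ : FormalDisc)

/-! ### Laurent series in the local coordinate -/

variable {Δ} in
theorem coeff_ext {a b : Δ.K} (h : ∀ n, Δ.coeff a n = Δ.coeff b n) : a = b :=
  HahnSeries.ext (funext h)

@[simp] theorem coeff_zero (n : ℤ) : Δ.coeff 0 n = 0 := rfl

@[simp] theorem coeff_add (a b : Δ.K) (n : ℤ) :
    Δ.coeff (a + b) n = Δ.coeff a n + Δ.coeff b n := rfl

@[simp] theorem coeff_sub (a b : Δ.K) (n : ℤ) :
    Δ.coeff (a - b) n = Δ.coeff a n - Δ.coeff b n := rfl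

@[simp] theorem coeff_neg (a : Δ.K) (n : ℤ) : Δ.coeff (-a) n = -Δ.coeff a n := rfl

@[simp] theorem coeff_smul (c : ℂ) (a : Δ.K) (n : ℤ) : Δ.coeff (c • a) n = c * Δ.coeff a n := rfl

/-- The coefficient of `t ^ n`, as a linear map. -/
noncomputable def coeffₗ (n : ℤ) : Δ.K →ₗ[ℂ] ℂ where
  toFun a := Δ.coeff a n
  map_add' _ _ := rfl
  map_smul' _ _ := rfl

theorem coeff_sum {ι : Type*} (s : Finset ι) (f : ι → Δ.K) (n : ℤ) :
    Δ.coeff (∑ i ∈ s, f i) n = ∑ i ∈ s, Δ.coeff (f i) n :=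
  map_sum (Δ.coeffₗ n) f s

theorem algebraMap_mul (c : ℂ) (a : Δ.K) : algebraMap ℂ Δ.K c * a = c • a :=
  (Algebra.smul_def c a).symm

theorem coeff_one (n : ℤ) : Δ.coeff 1 n = if n = 0 then 1 else 0 := by
  refine (HahnSeries.coeff_one (Γ := ℤ) (R := ℂ)).trans ?_
  split_ifs <;> rfl

@[simp] theorem coeff_algebraMap (c : ℂ) (n : ℤ) :
    Δ.coeff (algebraMap ℂ Δ.K c) n = if n = 0 then c else 0 := by
  rw [Algebra.algebraMap_eq_smul_one, coeff_smul, coeff_one]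
  split_ifs <;> simp

theorem t_zpow (n : ℤ) : Δ.t ^ n = (HahnSeries.single n (1 : ℂ) : ℂ⸨X⸩) :=
  (RatFunc.single_zpow (F := ℂ) n).symm ▸ rfl

theorem t_ne_zero : Δ.t ≠ 0 := by
  change (HahnSeries.single (1 : ℤ) (1 : ℂ) : ℂ⸨X⸩) ≠ 0
  simp

@[simp] theorem coeff_t_zpow_mul (m : ℤ) (a : Δ.K) (n : ℤ) :
    Δ.coeff (Δ.t ^ m * a) n = Δ.coeff a (n - m) := by
  rw [t_zpow]
  have := HahnSeries.coeff_single_mul (r := (1 : ℂ)) (x := (a : HahnSeries ℤ ℂ)) (a := n) (b := m)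
  rw [one_mul] at this
  exact this

@[simp] theorem coeff_t_mul (a : Δ.K) (n : ℤ) : Δ.coeff (Δ.t * a) n = Δ.coeff a (n - 1) := by
  simpa using Δ.coeff_t_zpow_mul 1 a n

@[simp] theorem coeff_t_inv_mul (a : Δ.K) (n : ℤ) :
    Δ.coeff (Δ.t⁻¹ * a) n = Δ.coeff a (n + 1) := by
  simpa using Δ.coeff_t_zpow_mul (-1) a n

theorem coeff_t_zpow (m n : ℤ) : Δ.coeff (Δ.t ^ m) n = if n = m then 1 else 0 := by
  rw [← mul_one (Δ.t ^ m), coeff_t_zpow_mul, coeff_one]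
  simp only [sub_eq_zero]

/-- The Laurent series with the coefficients `f n`, `N ≤ n`. -/
noncomputable def ofFun (f : ℤ → ℂ) (N : ℤ) : Δ.K :=
  (HahnSeries.ofSuppBddBelow (fun n => if n < N then 0 else f n)
    ⟨N, fun _ hn => not_lt.1 fun h => hn (if_pos h)⟩ : HahnSeries ℤ ℂ)

@[simp] theorem coeff_ofFun (f : ℤ → ℂ) (N n : ℤ) :
    Δ.coeff (Δ.ofFun f N) n = if n < N then 0 else f n := rfl

/-- The Laurent series of order at least `n`. -/
noncomputable def fil (n : ℤ) : Submodule ℂ Δ.K where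
  carrier := {a | ∀ k < n, Δ.coeff a k = 0}
  add_mem' ha hb k hk := by rw [coeff_add, ha k hk, hb k hk, add_zero]
  zero_mem' k _ := rfl
  smul_mem' c a ha k hk := by rw [coeff_smul, ha k hk, mul_zero]

variable {Δ}

theorem fil_antitone {m n : ℤ} (h : m ≤ n) : Δ.fil n ≤ Δ.fil m :=
  fun _ ha k hk => ha k (hk.trans_le h)

theorem exists_mem_fil (a : Δ.K) : ∃ n, a ∈ Δ.fil n :=
  ⟨HahnSeries.order (Γ := ℤ) (R := ℂ) a, fun _ hk => HahnSeries.coeff_eq_zero_of_lt_order hk⟩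

theorem mem_fil_of_succ {n : ℤ} {a : Δ.K} (h : a ∈ Δ.fil n) (h0 : Δ.coeff a n = 0) :
    a ∈ Δ.fil (n + 1) := by
  intro k hk
  rcases (Int.lt_add_one_iff.1 hk).lt_or_eq with h1 | rfl
  · exact h k h1
  · exact h0

theorem t_zpow_mul_mem_fil {m n : ℤ} {a : Δ.K} (h : a ∈ Δ.fil n) : Δ.t ^ m * a ∈ Δ.fil (m + n) := by
  intro k hk
  rw [coeff_t_zpow_mul]
  exact h _ (by omega)

theorem algebraMap_mem_fil (c : ℂ) : algebraMap ℂ Δ.K c ∈ Δ.fil 0 := by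
  intro k hk
  rw [coeff_algebraMap, if_neg hk.ne]

/-- Lets multiplicativity of leading coefficients be read off power series; `mul_mem_fil'` reaches
arbitrary orders by shifting with powers of `t`. -/
theorem mem_fil_zero_iff {a : Δ.K} :
    a ∈ Δ.fil 0 ↔ ∃ f : PowerSeries ℂ, (HahnSeries.ofPowerSeries ℤ ℂ f : ℂ⸨X⸩) = a := by
  constructor
  · intro h
    refine ⟨PowerSeries.mk fun n => Δ.coeff a n, coeff_ext (Δ := Δ) fun n => ?_⟩
    rcases lt_or_ge n 0 with hn | hn
    · rw [h n hn]
      change (HahnSeries.ofPowerSeries ℤ ℂ _).coeff n = 0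
      exact (PowerSeries.coeff_coe (PowerSeries.mk fun n => Δ.coeff a n) n).trans (if_pos hn)
    · lift n to ℕ using hn
      change (HahnSeries.ofPowerSeries ℤ ℂ _).coeff n = _
      rw [HahnSeries.ofPowerSeries_apply_coeff, PowerSeries.coeff_mk]
  · rintro ⟨f, rfl⟩ k hk
    exact (PowerSeries.coeff_coe f k).trans (if_pos hk)

theorem mul_mem_fil_zero {a b : Δ.K} (ha : a ∈ Δ.fil 0) (hb : b ∈ Δ.fil 0) :
    a * b ∈ Δ.fil 0 ∧ Δ.coeff (a * b) 0 = Δ.coeff a 0 * Δ.coeff b 0 := by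
  obtain ⟨f, rfl⟩ := mem_fil_zero_iff.1 ha
  obtain ⟨g, rfl⟩ := mem_fil_zero_iff.1 hb
  have e : ((HahnSeries.ofPowerSeries ℤ ℂ f : ℂ⸨X⸩) * (HahnSeries.ofPowerSeries ℤ ℂ g : ℂ⸨X⸩) : ℂ⸨X⸩)
      = HahnSeries.ofPowerSeries ℤ ℂ (f * g) := (map_mul _ _ _).symm
  refine ⟨mem_fil_zero_iff.2 ⟨f * g, e.symm⟩, ?_⟩
  change HahnSeries.coeff (_ * _ : ℂ⸨X⸩) 0 = HahnSeries.coeff _ 0 * HahnSeries.coeff _ 0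
  have h0 (k : PowerSeries ℂ) : (HahnSeries.ofPowerSeries ℤ ℂ k).coeff 0 = PowerSeries.coeff 0 k := by
    exact_mod_cast HahnSeries.ofPowerSeries_apply_coeff (Γ := ℤ) k 0
  rw [e, h0, h0, h0]
  simp [PowerSeries.coeff_zero_eq_constantCoeff]

theorem mul_mem_fil' {m n : ℤ} {a b : Δ.K} (ha : a ∈ Δ.fil m) (hb : b ∈ Δ.fil n) :
    a * b ∈ Δ.fil (m + n) ∧ Δ.coeff (a * b) (m + n) = Δ.coeff a m * Δ.coeff b n := by
  have ha' : Δ.t ^ (-m) * a ∈ Δ.fil 0 := by simpa using t_zpow_mul_mem_fil (m := -m) ha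
  have hb' : Δ.t ^ (-n) * b ∈ Δ.fil 0 := by simpa using t_zpow_mul_mem_fil (m := -n) hb
  obtain ⟨h1, h2⟩ := mul_mem_fil_zero ha' hb'
  have e : Δ.t ^ (m + n) * (Δ.t ^ (-m) * a * (Δ.t ^ (-n) * b)) = a * b := by
    rw [zpow_add₀ Δ.t_ne_zero, zpow_neg, zpow_neg]
    have := zpow_ne_zero m Δ.t_ne_zero
    have := zpow_ne_zero n Δ.t_ne_zero
    field_simp
  rw [← e]
  refine ⟨by simpa using t_zpow_mul_mem_fil (m := m + n) h1, ?_⟩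
  rw [coeff_t_zpow_mul, sub_self, h2, coeff_t_zpow_mul, coeff_t_zpow_mul, zero_sub, zero_sub,
    neg_neg, neg_neg]

theorem mul_mem_fil {m n : ℤ} {a b : Δ.K} (ha : a ∈ Δ.fil m) (hb : b ∈ Δ.fil n) :
    a * b ∈ Δ.fil (m + n) := (mul_mem_fil' ha hb).1

theorem coeff_mul_of_mem_fil {m n : ℤ} {a b : Δ.K} (ha : a ∈ Δ.fil m) (hb : b ∈ Δ.fil n) :
    Δ.coeff (a * b) (m + n) = Δ.coeff a m * Δ.coeff b n := (mul_mem_fil' ha hb).2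

/-- A series with only one coefficient. -/
theorem eq_smul_t_zpow {a : Δ.K} {m : ℤ} (h : ∀ n, n ≠ m → Δ.coeff a n = 0) :
    a = Δ.coeff a m • Δ.t ^ m := by
  refine coeff_ext fun n => ?_
  rw [coeff_smul, coeff_t_zpow]
  split_ifs with hn
  · rw [hn, mul_one]
  · rw [h n hn, mul_zero]

/-! ### The Euler derivation -/

variable (Δ) in
/-- The derivation `d/dt`. -/
noncomputable def ddt : Δ.K →ₗ[ℂ] Δ.K := LaurentSeries.derivative ℂ (V := ℂ)

variable (Δ) in
/-- The derivation `θ = t d/dt`. -/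
noncomputable def theta : Δ.K →ₗ[ℂ] Δ.K := LinearMap.mulLeft ℂ Δ.t ∘ₗ Δ.ddt

theorem coeff_derivative (a : ℂ⸨X⸩) (n : ℤ) :
    (LaurentSeries.derivative ℂ a).coeff n = (n + 1) * a.coeff (n + 1) := by
  simp only [LaurentSeries.derivative_apply, LaurentSeries.hasseDeriv_coeff, Ring.choose_one_right,
    zsmul_eq_mul, Nat.cast_one]
  push_cast
  ring

@[simp] theorem coeff_theta (a : Δ.K) (n : ℤ) : Δ.coeff (Δ.theta a) n = n * Δ.coeff a n := by
  have h : Δ.theta a = Δ.t * Δ.ddt a := rfl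
  rw [h]
  refine (Δ.coeff_t_mul _ n).trans ?_
  refine (coeff_derivative a (n - 1)).trans ?_
  rw [sub_add_cancel]
  push_cast
  rw [sub_add_cancel]
  rfl

theorem theta_mul (a b : Δ.K) : Δ.theta (a * b) = Δ.theta a * b + a * Δ.theta b := by
  refine coeff_ext fun n => ?_
  rw [coeff_theta, coeff_add]
  -- θ does not enlarge supports, so the three products can be summed over the same pairs (i, j)
  -- with i + j = n.
  have hA : (Δ.theta a : HahnSeries ℤ ℂ).support ⊆ HahnSeries.support (Γ := ℤ) (R := ℂ) a := by
    intro k hk h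
    exact hk ((coeff_theta a k).trans (by rw [show Δ.coeff a k = 0 from h, mul_zero]))
  have hB : (Δ.theta b : HahnSeries ℤ ℂ).support ⊆ HahnSeries.support (Γ := ℤ) (R := ℂ) b := by
    intro k hk h
    exact hk ((coeff_theta b k).trans (by rw [show Δ.coeff b k = 0 from h, mul_zero]))
  have e1 : Δ.coeff (a * b) n = _ := HahnSeries.coeff_mul (x := (a : HahnSeries ℤ ℂ)) (y := b)
  have e2 : Δ.coeff (Δ.theta a * b) n = _ :=
    HahnSeries.coeff_mul_left' (x := (Δ.theta a : HahnSeries ℤ ℂ)) (y := b)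
      (HahnSeries.isPWO_support (Γ := ℤ) (R := ℂ) a) hA
  have e3 : Δ.coeff (a * Δ.theta b) n = _ :=
    HahnSeries.coeff_mul_right' (x := (a : HahnSeries ℤ ℂ)) (y := Δ.theta b)
      (HahnSeries.isPWO_support (Γ := ℤ) (R := ℂ) b) hB
  rw [e1, e2, e3, Finset.mul_sum, ← Finset.sum_add_distrib]
  refine Finset.sum_congr rfl fun ij hij => ?_
  have hn : ij.1 + ij.2 = n := (Finset.mem_antidiagonal.1 hij).2.2
  have h1 := coeff_theta a ij.1
  have h2 := coeff_theta b ij.2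
  change HahnSeries.coeff (Γ := ℤ) (R := ℂ) (Δ.theta a) ij.1 = _ at h1
  change HahnSeries.coeff (Γ := ℤ) (R := ℂ) (Δ.theta b) ij.2 = _ at h2
  rw [h1, h2, ← hn]
  simp only [coeff]
  push_cast
  ring

theorem theta_one : Δ.theta 1 = 0 := by
  refine coeff_ext fun n => ?_
  rw [coeff_theta, coeff_one]
  split_ifs with h <;> simp [h]

theorem theta_t_zpow (n : ℤ) : Δ.theta (Δ.t ^ n) = (n : ℂ) • Δ.t ^ n := by
  refine coeff_ext fun k => ?_
  rw [coeff_theta, coeff_smul, coeff_t_zpow]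
  split_ifs with h
  · rw [h]
  · simp

variable (Δ) in
/-- The character `α + γ / t`. -/
noncomputable def chr (α γ : ℂ) : Δ.K := algebraMap ℂ Δ.K α + γ • Δ.t⁻¹

theorem coeff_chr_mul (α γ : ℂ) (a : Δ.K) (n : ℤ) :
    Δ.coeff (Δ.chr α γ * a) n = α * Δ.coeff a n + γ * Δ.coeff a (n + 1) := by
  rw [chr, add_mul, coeff_add, algebraMap_mul, coeff_smul, smul_mul_assoc, coeff_smul,
    coeff_t_inv_mul]

theorem chr_sub (α γ α' γ' : ℂ) : Δ.chr (α - α') (γ - γ') = Δ.chr α γ - Δ.chr α' γ' := by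
  simp only [chr, map_sub, sub_smul]
  ring

/-- A series killed by all coefficients of `θ + α + γ / t`, `γ ≠ 0`, vanishes. -/
theorem eq_zero_of_theta_add_chr {α γ : ℂ} (hγ : γ ≠ 0) {a : Δ.K}
    (h : Δ.theta a + Δ.chr α γ * a = 0) : a = 0 := by
  obtain ⟨N, hN⟩ := exists_mem_fil a
  have key : ∀ k : ℕ, a ∈ Δ.fil (N + k) := by
    intro k
    induction k with
    | zero => simpa using hN
    | succ k ih =>
      -- In this order only γ/t reaches the coefficient N + k; all other terms already vanish.
      have h1 := congrArg (fun b => Δ.coeff b (N + k - 1)) h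
      simp only [coeff_add, coeff_theta, coeff_chr_mul, coeff_zero, sub_add_cancel] at h1
      rw [ih _ (by omega), mul_zero, mul_zero, zero_add, zero_add] at h1
      have := mem_fil_of_succ ih ((mul_eq_zero.1 h1).resolve_left hγ)
      rwa [Nat.cast_succ, ← add_assoc]
  refine coeff_ext fun n => ?_
  exact key (n - N + 1).toNat n (by omega)

/-- The solutions of `θ a + α a = 0`. -/
theorem coeff_eq_zero_of_theta_add {α : ℂ} {a : Δ.K} (h : Δ.theta a + Δ.chr α 0 * a = 0) {n : ℤ}
    (hn : (n : ℂ) + α ≠ 0) : Δ.coeff a n = 0 := by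
  have h1 := congrArg (fun b => Δ.coeff b n) h
  simp only [coeff_add, coeff_theta, coeff_chr_mul, coeff_zero, zero_mul, add_zero, ← add_mul] at h1
  exact (mul_eq_zero.1 h1).resolve_left hn

end FormalDisc

namespace FormalDisc

variable {Δ : FormalDisc} {V : Type*} [AddCommGroup V] [Module Δ.K V] [Module ℂ V]
  [IsScalarTower ℂ Δ.K V] {ι : Type*}

/-! ### Connections on vector spaces over the field of Laurent series -/

/-- `D` is a connection, in the direction of `θ = t d/dt`. -/
def IsConnection (D : V →ₗ[ℂ] V) : Prop :=
  ∀ (a : Δ.K) (v : V), D (a • v) = Δ.theta a • v + a • D v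

/-- The functionals `h` with `h (D u) = θ (h u) + c h(u)`. -/
noncomputable def horizontal (D : V →ₗ[ℂ] V) (c : Δ.K) : Submodule ℂ (V →ₗ[Δ.K] Δ.K) where
  carrier := {h | ∀ u, h (D u) = Δ.theta (h u) + c * h u}
  add_mem' {h g} hh hg u := by
    rw [LinearMap.add_apply, LinearMap.add_apply, hh u, hg u, map_add]
    ring
  zero_mem' u := by simp
  smul_mem' r h hh u := by
    rw [LinearMap.smul_apply, LinearMap.smul_apply, hh u, map_smul, smul_add, mul_smul_comm]

/-- The basis `e` diagonalizes the connection `D`. -/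
def IsNormalBasis (D : V →ₗ[ℂ] V) (e : Module.Basis ι Δ.K V) (μ γ : ι → ℂ) : Prop :=
  ∀ i, D (e i) = Δ.chr (μ i) (γ i) • e i

theorem repr_connection [Fintype ι] {D : V →ₗ[ℂ] V} (hD : IsConnection (Δ := Δ) D)
    (e : Module.Basis ι Δ.K V) (u : V) (k : ι) :
    e.repr (D u) k = Δ.theta (e.repr u k) + ∑ i, e.repr u i * e.repr (D (e i)) k := by
  classical
  conv_lhs => rw [← e.sum_repr u]
  simp only [map_sum, hD _ _, map_add, map_smul, Finsupp.coe_add, Finsupp.coe_smul,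
    Finset.sum_add_distrib, Pi.add_apply, Finsupp.coe_finsetSum, Finset.sum_apply, Pi.smul_apply,
    smul_eq_mul]
  congr 1
  rw [Finset.sum_eq_single k]
  · simp
  · intro b _ hb
    rw [e.repr_self, Finsupp.single_eq_of_ne hb.symm, mul_zero]
  · simp

namespace IsNormalBasis

variable [Fintype ι] {D : V →ₗ[ℂ] V} {e : Module.Basis ι Δ.K V} {μ γ : ι → ℂ}

theorem repr_apply (he : IsNormalBasis D e μ γ) (hD : IsConnection (Δ := Δ) D) (u : V) (k : ι) :
    e.repr (D u) k = Δ.theta (e.repr u k) + Δ.chr (μ k) (γ k) * e.repr u k := by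
  classical
  rw [repr_connection hD]
  congr 1
  rw [Finset.sum_eq_single k]
  · rw [he k]
    simp [mul_comm]
  · intro b _ hb
    rw [he b, map_smul, e.repr_self, Finsupp.smul_apply, Finsupp.single_eq_of_ne hb.symm,
      smul_zero, mul_zero]
  · simp

theorem coord_mem (he : IsNormalBasis D e μ γ) (hD : IsConnection (Δ := Δ) D) (k : ι) :
    e.coord k ∈ horizontal D (Δ.chr (μ k) (γ k)) := fun u => he.repr_apply hD u k

omit [Fintype ι] in
-- Turns a diagonalization of `connInfty 0` into one of `connInfty ξ`, where the components with γ =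
-- −ξ become regular singular.
theorem twist (he : IsNormalBasis D e μ γ) (ξ : ℂ) {D' : V →ₗ[ℂ] V}
    (h : ∀ v, D' v = D v + (ξ • Δ.t⁻¹) • v) :
    IsNormalBasis D' e μ (fun i => γ i + ξ) := by
  intro i
  rw [h, he i, ← add_smul]
  congr 1
  simp only [chr, add_smul]
  ring

/-- In the coordinates, D − α multiplies the n-th coefficient by n + μ − α where γ = 0 and is
injective where γ ≠ 0. Hence generalized eigenvectors are already eigenvectors. -/
theorem mem_maxGenEigenspace (he : IsNormalBasis D e μ γ) (hD : IsConnection (Δ := Δ) D) {α : ℂ}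
    {u : V} : u ∈ Module.End.maxGenEigenspace D α ↔
      ∀ i n, Δ.coeff (e.repr u i) n ≠ 0 → γ i = 0 ∧ μ i + n = α := by
  have key (u : V) (i : ι) : e.repr ((D - α • (1 : Module.End ℂ V)) u) i =
      Δ.theta (e.repr u i) + Δ.chr (μ i - α) (γ i) * e.repr u i := by
    rw [LinearMap.sub_apply, map_sub, Finsupp.sub_apply, he.repr_apply hD, LinearMap.smul_apply,
      Module.End.one_apply, ← algebraMap_smul Δ.K α u, map_smul, Finsupp.smul_apply, smul_eq_mul,
      ← sub_zero (γ i), chr_sub, sub_zero]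
    simp only [chr, zero_smul, add_zero]
    ring
  constructor
  · rw [Module.End.mem_maxGenEigenspace]
    rintro ⟨k, hk⟩
    induction k generalizing u with
    | zero =>
      rw [pow_zero, Module.End.one_apply] at hk
      intro i n h
      simp [hk] at h
    | succ k ih =>
      rw [pow_succ, Module.End.mul_apply] at hk
      have h := ih hk
      intro i n hn
      have hi := key u i
      by_cases hγ : γ i = 0
      · refine ⟨hγ, ?_⟩
        by_contra hne
        rw [hγ] at hi
        have h1 := congrArg (fun a => Δ.coeff a n) hi
        simp only [coeff_add, coeff_theta, coeff_chr_mul, zero_mul, add_zero, ← add_mul] at h1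
        have h2 : (n : ℂ) + (μ i - α) ≠ 0 := fun h0 => hne (by linear_combination h0)
        exact hne (h i n (by rw [h1]; exact mul_ne_zero h2 hn)).2
      · exfalso
        have h0 : e.repr ((D - α • (1 : Module.End ℂ V)) u) i = 0 := by
          refine coeff_ext fun m => ?_
          by_contra hm
          exact hγ (h i m hm).1
        rw [h0] at hi
        rw [eq_zero_of_theta_add_chr hγ hi.symm] at hn
        exact hn rfl
  · intro h
    rw [Module.End.mem_maxGenEigenspace]
    refine ⟨1, ?_⟩
    rw [pow_one]
    refine e.repr.injective (Finsupp.ext fun i => ?_)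
    rw [map_zero, Finsupp.zero_apply, key]
    refine coeff_ext fun n => ?_
    simp only [coeff_add, coeff_theta, coeff_chr_mul, coeff_zero]
    by_cases hγ : γ i = 0
    · rw [hγ, zero_mul, add_zero, ← add_mul]
      by_cases hn : Δ.coeff (e.repr u i) n = 0
      · rw [hn, mul_zero]
      · rw [← (h i n hn).2]
        ring
    · have h0 (m : ℤ) : Δ.coeff (e.repr u i) m = 0 := by
        by_contra hm
        exact hγ (h i m hm).1
      simp [h0]

/-- Multiplication by the local coordinate shifts the eigenspaces. -/
theorem t_smul_mem_iff (he : IsNormalBasis D e μ γ) (hD : IsConnection (Δ := Δ) D) {α : ℂ}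
    {u : V} : Δ.t • u ∈ Module.End.maxGenEigenspace D (α + 1) ↔
      u ∈ Module.End.maxGenEigenspace D α := by
  rw [he.mem_maxGenEigenspace hD, he.mem_maxGenEigenspace hD]
  simp only [map_smul, Finsupp.smul_apply, smul_eq_mul, coeff_t_mul]
  constructor
  · intro h i n hn
    obtain ⟨h1, h2⟩ := h i (n + 1) (by rwa [add_sub_cancel_right])
    refine ⟨h1, ?_⟩
    push_cast at h2
    linear_combination h2
  · intro h i n hn
    obtain ⟨h1, h2⟩ := h i (n - 1) hn
    refine ⟨h1, ?_⟩
    push_cast at h2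
    linear_combination h2

theorem maxGenEigenspace_eq_bot (he : IsNormalBasis D e μ γ) (hD : IsConnection (Δ := Δ) D) {α : ℂ}
    (h : ∀ i, γ i = 0 → ∀ n : ℤ, μ i + n ≠ α) : Module.End.maxGenEigenspace D α = ⊥ := by
  rw [Submodule.eq_bot_iff]
  intro u hu
  rw [he.mem_maxGenEigenspace hD] at hu
  refine e.repr.injective (Finsupp.ext fun i => coeff_ext fun n => ?_)
  rw [map_zero, Finsupp.zero_apply, coeff_zero]
  by_contra hn
  exact h i (hu i n hn).1 n (hu i n hn).2

omit [Fintype ι] [IsScalarTower ℂ Δ.K V] in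
-- The value f = h(e i) solves the rank one equation θf + (α − μ − γ/t)f = 0: it is zero if γ ≠ 0,
-- and otherwise has at most the coefficient of order μ − α.
theorem coeff_apply_of_mem (he : IsNormalBasis D e μ γ) {α : ℂ} {h : V →ₗ[Δ.K] Δ.K}
    (hh : h ∈ horizontal D (Δ.chr α 0)) (i : ι) (n : ℤ) (hn : Δ.coeff (h (e i)) n ≠ 0) :
    γ i = 0 ∧ μ i = n + α := by
  have h1 := hh (e i)
  rw [he i, map_smul, smul_eq_mul] at h1
  have h2 : Δ.theta (h (e i)) + Δ.chr (α - μ i) (0 - γ i) * h (e i) = 0 := by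
    rw [chr_sub]
    linear_combination -h1
  by_cases hγ : γ i = 0
  · refine ⟨hγ, ?_⟩
    by_contra hne
    rw [hγ, sub_zero] at h2
    exact hn (coeff_eq_zero_of_theta_add h2 fun h0 => hne (by linear_combination -h0))
  · rw [eq_zero_of_theta_add_chr (by simpa using hγ) h2] at hn
    exact absurd rfl hn

omit [Fintype ι] [IsScalarTower ℂ Δ.K V] in
theorem horizontal_eq_bot (he : IsNormalBasis D e μ γ) {α : ℂ}
    (h : ∀ i, γ i = 0 → ∀ n : ℤ, μ i ≠ n + α) : horizontal D (Δ.chr α 0) = ⊥ := by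
  rw [Submodule.eq_bot_iff]
  intro g hg
  refine e.ext fun i => coeff_ext fun n => ?_
  by_contra hn
  obtain ⟨h1, h2⟩ := he.coeff_apply_of_mem hg i n hn
  exact h i h1 n h2

theorem t_zpow_smul_coord_mem (he : IsNormalBasis D e μ γ) (hD : IsConnection (Δ := Δ) D) {α : ℂ}
    {i : ι} {n : ℤ} (hγ : γ i = 0) (hn : μ i + n = α) :
    Δ.t ^ (-n) • e.coord i ∈ horizontal D (Δ.chr α 0) := by
  intro u
  have h := he.coord_mem hD i u
  rw [LinearMap.smul_apply, LinearMap.smul_apply, h, smul_eq_mul, smul_eq_mul, theta_mul,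
    theta_t_zpow, hγ, ← hn, Algebra.smul_def]
  simp only [chr, zero_smul, add_zero, map_add, map_intCast]
  push_cast
  ring

/-- Horizontal functionals separate the elements of an eigenspace. -/
theorem eq_zero_of_pairing (he : IsNormalBasis D e μ γ) (hD : IsConnection (Δ := Δ) D) {α : ℂ}
    {u : V} (hu : u ∈ Module.End.maxGenEigenspace D α)
    (h : ∀ g ∈ horizontal D (Δ.chr α 0), Δ.coeff (g u) 0 = 0) : u = 0 := by
  rw [he.mem_maxGenEigenspace hD] at hu
  refine e.repr.injective (Finsupp.ext fun i => coeff_ext fun n => ?_)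
  rw [map_zero, Finsupp.zero_apply, coeff_zero]
  by_contra hn
  obtain ⟨h1, h2⟩ := hu i n hn
  have h3 := h _ (he.t_zpow_smul_coord_mem hD h1 h2)
  rw [LinearMap.smul_apply, smul_eq_mul, coeff_t_zpow_mul, zero_sub, neg_neg] at h3
  exact hn h3

/-- Every functional on the space of horizontal functionals is the evaluation on an element of the
eigenspace. -/
theorem exists_pairing_eq (he : IsNormalBasis D e μ γ) (hD : IsConnection (Δ := Δ) D) {α : ℂ}
    (l : horizontal (V := V) D (Δ.chr α 0) →ₗ[ℂ] ℂ) :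
    ∃ u ∈ Module.End.maxGenEigenspace D α, ∀ g : horizontal (V := V) D (Δ.chr α 0),
      Δ.coeff (g.1 u) 0 = l g := by
  classical
  -- For i in `I` with μ i + n = α, the vectors t^n e i and the functionals t^(−n) e i* are dual
  -- bases of the eigenspace and of the horizontal functionals.
  let I := {i : ι // γ i = 0 ∧ ∃ n : ℤ, μ i + n = α}
  choose n hn using fun i : I => i.2.2
  let H : I → horizontal (V := V) D (Δ.chr α 0) := fun i =>
    ⟨Δ.t ^ (-n i) • e.coord i, he.t_zpow_smul_coord_mem hD i.2.1 (hn i)⟩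
  refine ⟨∑ i : I, (l (H i) • Δ.t ^ (n i)) • e i, ?_, ?_⟩
  · refine Submodule.sum_mem _ fun i _ => ?_
    rw [he.mem_maxGenEigenspace hD]
    intro k m hm
    rw [map_smul, e.repr_self, Finsupp.smul_apply, smul_eq_mul] at hm
    by_cases hk : i.1 = k
    · subst hk
      rw [Finsupp.single_eq_same, mul_one, coeff_smul, coeff_t_zpow] at hm
      split_ifs at hm with h
      · exact ⟨i.2.1, by rw [h, hn]⟩
      · simp at hm
    · rw [Finsupp.single_eq_of_ne (Ne.symm hk)] at hm
      simp at hm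
  · intro g
    have hg : g = ∑ i : I, Δ.coeff (g.1 (e i)) (-n i) • H i := by
      refine Subtype.ext (e.ext fun k => ?_)
      rw [Submodule.coe_sum, LinearMap.sum_apply]
      simp only [Submodule.coe_smul, LinearMap.smul_apply, H, Module.Basis.coord_apply,
        e.repr_self, smul_eq_mul]
      by_cases hk : γ k = 0 ∧ ∃ n : ℤ, μ k + n = α
      · rw [Finset.sum_eq_single (⟨k, hk⟩ : I)]
        · rw [Finsupp.single_eq_same, mul_one]
          refine eq_smul_t_zpow fun m hm => ?_
          by_contra h0
          have h1 := (he.coeff_apply_of_mem g.2 k m h0).2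
          have h2 := hn ⟨k, hk⟩
          apply hm
          have : ((m : ℤ) : ℂ) = ((-n ⟨k, hk⟩ : ℤ) : ℂ) := by
            push_cast
            linear_combination h2 - h1
          exact_mod_cast this
        · intro b _ hb
          rw [Finsupp.single_eq_of_ne fun h => hb (Subtype.ext h), mul_zero, smul_zero]
        · simp
      · rw [Finset.sum_eq_zero]
        · refine coeff_ext fun m => ?_
          by_contra h0
          obtain ⟨h1, h2⟩ := he.coeff_apply_of_mem g.2 k m h0
          exact hk ⟨h1, -m, by push_cast; linear_combination h2⟩
        · intro b _
          rw [Finsupp.single_eq_of_ne fun h : b.1 = k => hk (h ▸ b.2), mul_zero, smul_zero]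
    conv_rhs => rw [hg, map_sum]
    rw [map_sum, coeff_sum]
    refine Finset.sum_congr rfl fun i _ => ?_
    rw [map_smul, map_smul, smul_eq_mul, smul_mul_assoc, coeff_smul, coeff_t_zpow_mul, zero_sub,
      smul_eq_mul, mul_comm]

end IsNormalBasis

/-! ### Independence of horizontal functionals -/

/-- If h i₀ = ∑ a i • h i with the h i independent, evaluating on D u in two ways gives a rank one
differential equation for each a i. Without resonance a i is constant, and it is zero unless i and
i₀ have the same character. So only ℂ-linear relations within one character remain, which is what
`hind` excludes. -/
theorem linearIndependent_of_mem_horizontal [Finite ι] {D : V →ₗ[ℂ] V}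
    {h : ι → V →ₗ[Δ.K] Δ.K} {α γ : ι → ℂ} (hh : ∀ i, h i ∈ horizontal D (Δ.chr (α i) (γ i)))
    (hres : ∀ i k, γ i = γ k → ∀ n : ℤ, n ≠ 0 → α i - α k ≠ n)
    (hind : ∀ (s : Finset ι) (c : ι → ℂ) (i₀ : ι), i₀ ∈ s →
      (∀ i ∈ s, γ i = γ i₀ ∧ α i = α i₀) → ∑ i ∈ s, c i • h i = 0 → c i₀ = 0) :
    LinearIndependent Δ.K h := by
  classical
  cases nonempty_fintype ι
  suffices H : ∀ s : Finset ι, LinearIndepOn Δ.K h (s : Set ι) by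
    have := H Finset.univ
    rwa [Finset.coe_univ, linearIndepOn_univ_iff] at this
  intro s
  induction s using Finset.induction_on with
  | empty => simp
  | insert i₀ s hi₀ ih =>
    rw [Finset.coe_insert, linearIndepOn_insert (by simpa using hi₀)]
    refine ⟨ih, fun hmem => ?_⟩
    obtain ⟨a₀, ha₀⟩ := (Submodule.mem_span_image_finset_iff_exists_fun Δ.K).1 hmem
    obtain ⟨a, ha⟩ : ∃ a : ι → Δ.K, ∑ i ∈ s, a i • h i = h i₀ := by
      refine ⟨fun i => if hi : i ∈ s then a₀ ⟨i, hi⟩ else 0, ?_⟩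
      rw [← ha₀, ← Finset.sum_coe_sort]
      exact Finset.sum_congr rfl fun i _ => by simp only [dif_pos i.2]
    have hev (u : V) : ∑ i ∈ s, a i * h i u = h i₀ u := by
      rw [← ha, LinearMap.sum_apply]
      rfl
    have hz : ∑ i ∈ s, (Δ.theta (a i) + Δ.chr (α i₀ - α i) (γ i₀ - γ i) * a i) • h i = 0 := by
      ext1 u
      rw [LinearMap.sum_apply, LinearMap.zero_apply]
      have h1 := hh i₀ u
      rw [← hev, ← hev, map_sum, Finset.mul_sum, ← Finset.sum_add_distrib, ← sub_eq_zero,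
        ← Finset.sum_sub_distrib] at h1
      rw [← neg_eq_zero, ← h1, ← Finset.sum_neg_distrib]
      refine Finset.sum_congr rfl fun i _ => ?_
      rw [theta_mul, hh i u, LinearMap.smul_apply, smul_eq_mul, chr_sub]
      ring
    have hcoef : ∀ i ∈ s, Δ.theta (a i) + Δ.chr (α i₀ - α i) (γ i₀ - γ i) * a i = 0 :=
      linearIndepOn_finset_iff.1 ih _ hz
    have hconst : ∀ i ∈ s, a i = Δ.coeff (a i) 0 • (1 : Δ.K) ∧
        (Δ.coeff (a i) 0 ≠ 0 → γ i = γ i₀ ∧ α i = α i₀) := by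
      intro i hi
      have h1 := hcoef i hi
      by_cases hγ : γ i = γ i₀
      · rw [hγ, sub_self] at h1
        have h2 (n : ℤ) (hn : n ≠ 0) : Δ.coeff (a i) n = 0 := by
          refine coeff_eq_zero_of_theta_add h1 fun h0 => hres i i₀ hγ n hn ?_
          linear_combination -h0
        refine ⟨by simpa using eq_smul_t_zpow (m := 0) h2, fun h0 => ⟨hγ, ?_⟩⟩
        by_contra hne
        refine h0 (coeff_eq_zero_of_theta_add h1 fun h3 => hne ?_)
        push_cast at h3
        linear_combination -h3
      · rw [eq_zero_of_theta_add_chr (sub_ne_zero.2 (Ne.symm hγ)) h1]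
        simp
    -- The relation is handed to `hind` with coefficient −1 at i₀, which cannot vanish.
    let s' := insert i₀ (s.filter fun i => Δ.coeff (a i) 0 ≠ 0)
    have hnot : i₀ ∉ s.filter fun i => Δ.coeff (a i) 0 ≠ 0 := fun h =>
      hi₀ (Finset.mem_filter.1 h).1
    have := hind s' (fun i => if i = i₀ then -1 else Δ.coeff (a i) 0) i₀
      (Finset.mem_insert_self _ _) ?_ ?_
    · simp at this
    · intro i hi
      rcases Finset.mem_insert.1 hi with rfl | hi
      · exact ⟨rfl, rfl⟩
      · exact (hconst i (Finset.mem_filter.1 hi).1).2 (Finset.mem_filter.1 hi).2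
    · rw [Finset.sum_insert hnot, if_pos rfl, neg_one_smul ℂ (h i₀), neg_add_eq_zero, ← ha]
      rw [Finset.sum_filter]
      refine Finset.sum_congr rfl fun i hi => ?_
      rw [if_neg fun h : i = i₀ => hi₀ (h ▸ hi)]
      by_cases h0 : Δ.coeff (a i) 0 = 0
      · rw [(hconst i hi).1, h0]
        simp
      · rw [if_pos h0]
        conv_lhs => rw [(hconst i hi).1]
        rw [smul_assoc, one_smul]

/-- A linearly independent family of horizontal functionals of the right cardinality is dual to
a normal basis. -/
theorem exists_isNormalBasis_of_horizontal [Fintype ι] [FiniteDimensional Δ.K V] {D : V →ₗ[ℂ] V}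
    {h : ι → V →ₗ[Δ.K] Δ.K} {α γ : ι → ℂ}
    (hh : ∀ i, h i ∈ horizontal D (Δ.chr (α i) (γ i))) (hli : LinearIndependent Δ.K h)
    (hcard : Fintype.card ι = Module.finrank Δ.K V) :
    ∃ e : Module.Basis ι Δ.K V, IsNormalBasis D e α γ ∧ ∀ i, e.coord i = h i := by
  classical
  have hspan : Submodule.span Δ.K (Set.range h) = ⊤ :=
    hli.span_eq_top_of_card_eq_finrank' (by rw [hcard]; exact (Subspace.dual_finrank_eq).symm)
  have hinj : Function.Injective (LinearMap.pi h) := by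
    rw [injective_iff_map_eq_zero]
    intro v hv
    rw [← Module.forall_dual_apply_eq_zero_iff Δ.K]
    intro f
    have hf : f ∈ Submodule.span Δ.K (Set.range h) := hspan ▸ Submodule.mem_top
    induction hf using Submodule.span_induction with
    | mem x hx =>
      obtain ⟨i, rfl⟩ := hx
      exact congrFun hv i
    | zero => rfl
    | add x y _ _ hx hy => rw [LinearMap.add_apply, hx, hy, add_zero]
    | smul a x _ hx => rw [LinearMap.smul_apply, hx, smul_zero]
  let E := LinearEquiv.ofInjectiveOfFinrankEq (LinearMap.pi h) hinj
    (by rw [Module.finrank_fintype_fun_eq_card, hcard])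
  have hE (v : V) (i : ι) : E v i = h i v := rfl
  let e := Module.Basis.ofEquivFun E
  have hco (v : V) (i : ι) : e.repr v i = h i v := by
    rw [← hE]
    rfl
  refine ⟨e, fun i => e.repr.injective (Finsupp.ext fun k => ?_), fun i => LinearMap.ext fun v =>
    hco v i⟩
  rw [hco, hh k, ← hco, map_smul, Finsupp.smul_apply, e.repr_self, smul_eq_mul]
  by_cases hk : i = k
  · subst hk
    rw [Finsupp.single_eq_same, theta_one, zero_add]
  · rw [Finsupp.single_eq_of_ne (Ne.symm hk), map_zero, mul_zero, mul_zero, add_zero]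

end FormalDisc

namespace FormalDisc

variable {Δ : FormalDisc} {V : Type*} [AddCommGroup V] [Module Δ.K V] [Module ℂ V]
  [IsScalarTower ℂ Δ.K V] {ι : Type*}

/-! ### Diagonalization of formal connections -/

/-- Course-of-values recursion in which the values not yet defined are replaced by 0, so that a step
sees a full sequence and can form a series from it. -/
theorem exists_eq_step {X : Type*} [Zero X] (step : ℕ → (ℕ → X) → X) :
    ∃ F : ℕ → X, ∀ n, F n = step n fun m => if m < n then F m else 0 := by
  classical
  refine ⟨WellFounded.fix (C := fun _ => X) Nat.lt_wfRel.wf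
    (fun n ih => step n fun m => if h : m < n then ih m h else 0), fun n => ?_⟩
  rw [WellFounded.fix_eq]
  congr 1

/-- The formal solution of `θ F + (c + b / t) F + R F = 0`, when `R` has positive order, with
given constant term. -/
theorem exists_formal_solution [Fintype ι] (R : ι → ι → Δ.K) (hR : ∀ k l, R k l ∈ Δ.fil 1)
    (c b : ι → ℂ) (hc : ∀ k, b k = 0 → ∀ n : ℤ, n ≠ 0 → c k ≠ n) (v : ι → ℂ)
    (hv : ∀ k, v k ≠ 0 → c k = 0 ∧ b k = 0) :
    ∃ F : ι → Δ.K, (∀ k, F k ∈ Δ.fil 0) ∧ (∀ k, Δ.coeff (F k) 0 = v k) ∧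
      ∀ k, Δ.theta (F k) + Δ.chr (c k) (b k) * F k + ∑ l, R k l * F l = 0 := by
  classical
  let ser : (ℕ → ι → ℂ) → ι → Δ.K := fun x l => Δ.ofFun (fun m => x m.toNat l) 0
  have hser (y : ℕ → ι → ℂ) (l : ι) : ser y l ∈ Δ.fil 0 := fun k hk => by
    simp only [ser, coeff_ofFun, if_pos hk]
  have hcoef (y : ℕ → ι → ℂ) (l : ι) (n : ℕ) : Δ.coeff (ser y l) n = y n l := by
    simp [ser]
  clear_value ser
  let w : (ℕ → ι → ℂ) → ι → ℤ → ℂ := fun x k n => Δ.coeff (∑ l, R k l * ser x l) n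
  -- If b k = 0, the coefficient of order n of the equation determines x n through the factor n + c
  -- k, non-zero by non-resonance. If b k ≠ 0, the term b/t lowers the order and the coefficient of
  -- order n − 1 determines x n.
  obtain ⟨x, hx⟩ := exists_eq_step (X := ι → ℂ) fun n y k =>
    if n = 0 then v k else if b k = 0 then -(w y k n) / (n + c k) else
      -((((n : ℤ) - 1 : ℤ) + c k) * y (n - 1) k + w y k (n - 1)) / b k
  have hw0 (y : ℕ → ι → ℂ) (k : ι) : ∑ l, R k l * ser y l ∈ Δ.fil 1 :=
    Submodule.sum_mem _ fun l _ => by simpa using mul_mem_fil (hR k l) (hser y l)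
  -- Since R has order at least 1, the coefficients of R F up to order n involve only terms of F
  -- before n.
  have htr (n : ℕ) (k : ι) (m : ℤ) (hm : m ≤ n) :
      w (fun m => if m < n then x m else 0) k m = w x k m := by
    rw [← sub_eq_zero]
    simp only [w]
    rw [← coeff_sub, ← Finset.sum_sub_distrib, coeff_sum]
    refine Finset.sum_eq_zero fun l _ => ?_
    rw [← mul_sub]
    have h1 : ser (fun m => if m < n then x m else 0) l - ser x l ∈ Δ.fil n := by
      intro j hj
      rw [coeff_sub, sub_eq_zero]
      rcases lt_or_ge j 0 with h | h
      · rw [hser _ _ j h, hser _ _ j h]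
      · lift j to ℕ using h
        rw [hcoef, hcoef]
        simp only [if_pos (show j < n by exact_mod_cast hj)]
    exact mul_mem_fil (hR k l) h1 m (by omega)
  have hx0 (k : ι) : x 0 k = v k := by rw [hx 0]; simp
  have hF0 (k : ι) : Δ.coeff (ser x k) 0 = v k := by
    have := hcoef x k 0
    rw [Nat.cast_zero] at this
    rw [this, hx0]
  refine ⟨ser x, hser x, hF0, fun k => coeff_ext fun n => ?_⟩
  have hwn : Δ.coeff (∑ l, R k l * ser x l) n = w x k n := rfl
  rw [coeff_add, coeff_add, coeff_theta, coeff_chr_mul, hwn, coeff_zero]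
  rcases lt_or_ge n 0 with hn | hn
  · rw [hser x k n hn, show w x k n = 0 from hw0 x k n (by omega)]
    rcases (show n + 1 ≤ 0 by omega).lt_or_eq with h | h
    · rw [hser x k _ h]; ring
    · rw [h, hF0]
      by_cases hvk : v k = 0
      · rw [hvk]; ring
      · rw [(hv k hvk).2]; ring
  · lift n to ℕ using hn
    rw [hcoef]
    by_cases hb : b k = 0
    · rw [hb, zero_mul, add_zero]
      by_cases h0 : n = 0
      · subst h0
        rw [show w x k ((0 : ℕ) : ℤ) = 0 from hw0 x k _ (by norm_num), hx0]
        by_cases hvk : v k = 0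
        · rw [hvk]; ring
        · rw [(hv k hvk).1]; push_cast; ring
      · have e := congrFun (hx n) k
        rw [if_neg h0, if_pos hb, htr n k n le_rfl] at e
        have hne : (n : ℂ) + c k ≠ 0 := fun h => hc k hb (-n) (by omega)
          (by push_cast; linear_combination h)
        rw [eq_div_iff hne] at e
        push_cast
        linear_combination e
    · have e := congrFun (hx (n + 1)) k
      rw [if_neg (Nat.succ_ne_zero n), if_neg hb, htr (n + 1) k _ (by push_cast; omega),
        Nat.add_sub_cancel, eq_div_iff hb] at e
      simp only [if_pos (Nat.lt_succ_self n)] at e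
      have e2 := hcoef x k (n + 1)
      push_cast at e e2 ⊢
      simp only [add_sub_cancel_right] at e
      rw [e2]
      linear_combination e

/-- The matrix of the f i is the identity modulo t, so the lowest coefficients of any relation
vanish, order after order. -/
theorem linearIndependent_of_coeff [Fintype ι] [DecidableEq ι] (e : Module.Basis ι Δ.K V) (f : ι → V)
    (h0 : ∀ i k, e.repr (f i) k ∈ Δ.fil 0)
    (h1 : ∀ i k, Δ.coeff (e.repr (f i) k) 0 = if k = i then 1 else 0) :
    LinearIndependent Δ.K f := by
  classical
  rw [Fintype.linearIndependent_iff]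
  intro a ha
  have hk (k : ι) : ∑ i, a i * e.repr (f i) k = 0 := by
    have := DFunLike.congr_fun (congrArg e.repr ha) k
    simpa using this
  obtain ⟨N, hN⟩ : ∃ N, ∀ i, a i ∈ Δ.fil N := by
    choose N hN using fun i => exists_mem_fil (a i)
    rcases isEmpty_or_nonempty ι with hι | hι
    · exact ⟨0, fun i => (hι.false i).elim⟩
    · exact ⟨Finset.univ.inf' Finset.univ_nonempty N, fun i =>
        fil_antitone (Finset.inf'_le _ (Finset.mem_univ i)) (hN i)⟩
  have key (m : ℕ) : ∀ i, a i ∈ Δ.fil (N + m) := by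
    induction m with
    | zero => simpa using hN
    | succ m ih =>
      intro k
      have h2 := congrArg (fun b => Δ.coeff b (N + m + 0)) (hk k)
      simp only [coeff_sum, coeff_zero] at h2
      simp only [fun i => coeff_mul_of_mem_fil (ih i) (h0 i k), h1, mul_ite, mul_one, mul_zero,
        Finset.sum_ite_eq, Finset.mem_univ, if_true] at h2
      have := mem_fil_of_succ (ih k) h2
      rwa [Nat.cast_succ, ← add_assoc]
  intro i
  refine coeff_ext fun n => ?_
  exact key (n - N + 1).toNat i n (by omega)

/-- A connection which is diagonal and resonance-free up to terms of positive order can be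
diagonalized. -/
theorem exists_isNormalBasis [Fintype ι] {D : V →ₗ[ℂ] V} (hD : IsConnection (Δ := Δ) D)
    (e : Module.Basis ι Δ.K V) (μ γ : ι → ℂ)
    (he : ∀ i k, e.repr (D (e i) - Δ.chr (μ i) (γ i) • e i) k ∈ Δ.fil 1)
    (hres : ∀ i k, γ i = γ k → ∀ n : ℤ, n ≠ 0 → μ i - μ k ≠ n) :
    ∃ f : Module.Basis ι Δ.K V, IsNormalBasis D f μ γ := by
  classical
  -- The i-th new basis vector must satisfy D f = (μ i + γ i/t) f with leading term e i. Subtracting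
  -- this character leaves the differences μ k − μ i and γ k − γ i on the coordinates.
  have hsol (i : ι) := exists_formal_solution
    (fun k l => e.repr (D (e l) - Δ.chr (μ l) (γ l) • e l) k) (fun k l => he l k)
    (fun k => μ k - μ i) (fun k => γ k - γ i) (fun k hk => hres k i (sub_eq_zero.1 hk))
    (fun k => if k = i then 1 else 0) (fun k hk => by
      by_cases h : k = i
      · simp [h]
      · simp [h] at hk)
  choose F hF0 hF1 hF2 using hsol
  let f : ι → V := fun i => e.equivFun.symm (F i)
  have hf (i k : ι) : e.repr (f i) k = F i k := by
    rw [← e.equivFun_apply, LinearEquiv.apply_symm_apply]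
  have hli := linearIndependent_of_coeff e f (fun i k => by rw [hf]; exact hF0 i k)
    (fun i k => by rw [hf]; exact hF1 i k)
  have hfin : FiniteDimensional Δ.K V := Module.Finite.of_basis e
  have hcard := Module.finrank_eq_card_basis e
  refine ⟨basisOfLinearIndependentOfCardEqFinrank' f hli hcard.symm, fun i => ?_⟩
  rw [coe_basisOfLinearIndependentOfCardEqFinrank']
  refine e.repr.injective (Finsupp.ext fun k => ?_)
  rw [repr_connection hD, map_smul, Finsupp.smul_apply, smul_eq_mul, hf]
  have h := hF2 i k
  simp only [map_sub, Finsupp.sub_apply, map_smul, Finsupp.smul_apply, sub_mul, e.repr_self,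
    Finset.sum_sub_distrib, smul_eq_mul, chr_sub, Finsupp.single_apply, mul_ite, mul_one, mul_zero,
    ite_mul, zero_mul, Finset.sum_ite_eq', Finset.mem_univ, if_true] at h
  simp only [hf, mul_comm (F i _)]
  linear_combination h

end FormalDisc

/-! ### Expansions of polynomials at finite points and at infinity -/

namespace FormalDisc

/-- The derivation of the formal disc is `κ⁻¹ θ`, and the global coordinate is not constant. -/
structure IsRegular (Δ : FormalDisc) (κ : Δ.K) : Prop where
  theta_eq : ∀ a, Δ.theta a = κ * Δ.deriv a
  ne_zero : κ ≠ 0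
  injective : Function.Injective (algebraMap ℂ[X] Δ.K)

variable {Δ : FormalDisc}

theorem X_smul_eq (a : Δ.K) : (Polynomial.X : ℂ[X]) • a = Δ.zK * a := by
  rw [Algebra.smul_def]
  change Polynomial.aeval (R := ℂ) Δ.zK Polynomial.X * a = _
  rw [Polynomial.aeval_X]

theorem algebraMap_polynomial (q : ℂ[X]) :
    algebraMap ℂ[X] Δ.K q = Polynomial.aeval Δ.zK q := rfl

theorem algebraMap_X : algebraMap ℂ[X] Δ.K Polynomial.X = Δ.zK := Polynomial.aeval_X Δ.zK

theorem algebraMap_C (c : ℂ) : algebraMap ℂ[X] Δ.K (Polynomial.C c) = algebraMap ℂ Δ.K c :=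
  Polynomial.aeval_C Δ.zK c

/-- Serves the finite points with m = 1 and infinity with m = −1. -/
theorem coeff_aeval_zpow {m : ℤ} (hm : m ≠ 0) (q : ℂ[X]) (n : ℕ) :
    Δ.coeff (Polynomial.aeval (Δ.t ^ m) q) (m * n) = q.coeff n := by
  rw [Polynomial.aeval_eq_sum_range, coeff_sum]
  simp only [← zpow_natCast, ← zpow_mul, coeff_smul, coeff_t_zpow, mul_eq_mul_left_iff, hm, or_false,
    Nat.cast_inj, mul_ite, mul_one, mul_zero]
  rw [Finset.sum_ite_eq]
  split_ifs with h
  · rfl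
  · rw [Finset.mem_range, not_lt] at h
    exact (Polynomial.coeff_eq_zero_of_natDegree_lt (by omega)).symm

theorem coeff_aeval_t {q : ℂ[X]} {n : ℤ} (hn : n < 0) :
    Δ.coeff (Polynomial.aeval Δ.t q) n = 0 := by
  rw [Polynomial.aeval_eq_sum_range, coeff_sum]
  refine Finset.sum_eq_zero fun i _ => ?_
  rw [coeff_smul, ← zpow_natCast, coeff_t_zpow, if_neg (by omega), mul_zero]

theorem discAt_zK (p : ℂ) : (discAt p).zK = algebraMap ℂ (discAt p).K p + (discAt p).t := by
  refine coeff_ext fun n => ?_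
  rw [coeff_add, coeff_algebraMap]
  have h : (discAt p).coeff (discAt p).zK n =
      (HahnSeries.single (0 : ℤ) p : HahnSeries ℤ ℂ).coeff n + (discAt p).coeff (discAt p).t n := rfl
  rw [h, HahnSeries.coeff_single]
  congr 1
  split_ifs <;> rfl

theorem discInfty_zK : discInfty.zK = (discInfty.t)⁻¹ := by
  rw [← zpow_neg_one, t_zpow]
  rfl

theorem coeff_discAt_deriv (p : ℂ) (a : (discAt p).K) (n : ℤ) :
    (discAt p).coeff ((discAt p).deriv a) n = (n + 1) * (discAt p).coeff a (n + 1) :=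
  coeff_derivative a n

theorem coeff_discInfty_deriv (a : discInfty.K) (n : ℤ) :
    discInfty.coeff (discInfty.deriv a) n = -((n - 1) * discInfty.coeff a (n - 1)) := by
  have h : discInfty.deriv a = (HahnSeries.single (2 : ℤ) (-1 : ℂ) : ℂ⸨X⸩) *
    (LaurentSeries.derivative ℂ (a : HahnSeries ℤ ℂ) : ℂ⸨X⸩) := rfl
  rw [h]
  refine (HahnSeries.coeff_single_mul (r := (-1 : ℂ))
    (x := (LaurentSeries.derivative ℂ (a : HahnSeries ℤ ℂ) : HahnSeries ℤ ℂ)) (a := n)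
    (b := 2)).trans ?_
  have h2 := coeff_derivative (a : HahnSeries ℤ ℂ) (n - 2)
  rw [show n - 2 + 1 = n - 1 by ring] at h2
  refine (congrArg (fun b : ℂ => -1 * b) h2).trans ?_
  push_cast
  change -1 * ((n - 2 + 1) * discInfty.coeff a (n - 1)) = _
  ring

theorem algebraMap_discAt (p : ℂ) (q : ℂ[X]) : algebraMap ℂ[X] (discAt p).K q =
    Polynomial.aeval (discAt p).t (Polynomial.taylor p q) := by
  rw [algebraMap_polynomial, discAt_zK, Polynomial.taylor_apply, Polynomial.aeval_comp]
  simp [add_comm]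

theorem coeff_algebraMap_discAt (p : ℂ) (q : ℂ[X]) (n : ℕ) :
    (discAt p).coeff (algebraMap ℂ[X] (discAt p).K q) n = (Polynomial.taylor p q).coeff n := by
  rw [algebraMap_discAt]
  simpa using coeff_aeval_zpow (Δ := discAt p) one_ne_zero (Polynomial.taylor p q) n

theorem algebraMap_discAt_mem (p : ℂ) (q : ℂ[X]) :
    algebraMap ℂ[X] (discAt p).K q ∈ (discAt p).fil 0 := by
  intro k hk
  rw [algebraMap_discAt, coeff_aeval_t hk]

theorem coeff_algebraMap_discInfty (q : ℂ[X]) (n : ℕ) :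
    discInfty.coeff (algebraMap ℂ[X] discInfty.K q) (-n) = q.coeff n := by
  rw [algebraMap_polynomial, discInfty_zK, ← zpow_neg_one]
  simpa using coeff_aeval_zpow (Δ := discInfty) (m := -1) (by norm_num) q n

theorem isRegular_discAt (p : ℂ) : (discAt p).IsRegular (discAt p).t where
  theta_eq a := by
    refine coeff_ext fun n => ?_
    rw [coeff_theta, coeff_t_mul, coeff_discAt_deriv, sub_add_cancel]
    push_cast
    ring
  ne_zero := t_ne_zero _
  injective := by
    rw [injective_iff_map_eq_zero]
    intro q hq
    have : Polynomial.taylor p q = 0 := by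
      ext n
      rw [← coeff_algebraMap_discAt, hq, coeff_zero, Polynomial.coeff_zero]
    exact (Polynomial.taylor_injective p) (by rw [this, map_zero])

theorem isRegular_discInfty : discInfty.IsRegular (-(discInfty.t)⁻¹) where
  theta_eq a := by
    refine coeff_ext fun n => ?_
    rw [coeff_theta, neg_mul, coeff_neg, coeff_t_inv_mul, coeff_discInfty_deriv,
      add_sub_cancel_right]
    push_cast
    ring
  ne_zero := neg_ne_zero.2 (inv_ne_zero (t_ne_zero _))
  injective := by
    rw [injective_iff_map_eq_zero]
    intro q hq
    ext n
    rw [← coeff_algebraMap_discInfty, hq, coeff_zero, Polynomial.coeff_zero]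

namespace IsRegular

variable {κ : Δ.K} (hΔ : Δ.IsRegular κ)
include hΔ

theorem deriv_eq (a : Δ.K) : Δ.deriv a = κ⁻¹ * Δ.theta a := by
  rw [hΔ.theta_eq, inv_mul_cancel_left₀ hΔ.ne_zero]

theorem deriv_mul (a b : Δ.K) : Δ.deriv (a * b) = Δ.deriv a * b + a * Δ.deriv b := by
  rw [hΔ.deriv_eq, hΔ.deriv_eq, hΔ.deriv_eq, theta_mul]
  ring

theorem deriv_one : Δ.deriv 1 = 0 := by rw [hΔ.deriv_eq, theta_one, mul_zero]

end IsRegular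

end FormalDisc

/-! ### Localization and base change to Laurent series -/

theorem polePoly_ne_zero (P : Finset ℂ) : polePoly P ≠ 0 :=
  Finset.prod_ne_zero_iff.2 fun p _ => Polynomial.X_sub_C_ne_zero p

/-- Base change along `R → K` does not see the localization in elements that become units. -/
theorem baseChange_bijective_of_isLocalizedModule {R K : Type*} {M M' : Type u} [CommRing R] [CommRing K]
    [Algebra R K] [AddCommGroup M] [Module R M] [AddCommGroup M'] [Module R M'] (S : Submonoid R)
    (f : M →ₗ[R] M') [IsLocalizedModule S f] (hS : ∀ s ∈ S, IsUnit (algebraMap R K s)) :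
    Function.Bijective (f.baseChange K) := by
  have hU (W : Type u) [AddCommGroup W] [Module R W] (s : S) :
      IsUnit (algebraMap R (Module.End R (K ⊗[R] W)) s) := by
    have h := (hS s s.2).map (algebraMap K (Module.End K (K ⊗[R] W)))
    rw [Module.End.isUnit_iff] at h ⊢
    convert h using 1
    ext w
    simp [Module.algebraMap_end_apply]
  let g : M' →ₗ[R] K ⊗[R] M := IsLocalizedModule.lift S f (TensorProduct.mk R K M 1) (hU M)
  have hg (m : M) : g (f m) = 1 ⊗ₜ m :=
    IsLocalizedModule.lift_apply S f (TensorProduct.mk R K M 1) (hU M) m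
  let G : K ⊗[R] M' →ₗ[K] K ⊗[R] M := g.liftBaseChange K
  have hG (m : M') : G (1 ⊗ₜ m) = g m := by simp [G]
  refine Function.bijective_iff_has_inverse.2 ⟨G, fun w => ?_, fun w => ?_⟩
  · have h : G ∘ₗ f.baseChange K = LinearMap.id := by
      ext m
      simp [hG, hg]
    exact LinearMap.congr_fun h w
  · have h : f.baseChange K ∘ₗ G = LinearMap.id := by
      refine TensorProduct.AlgebraTensorModule.ext fun a m => ?_
      have h2 : (f.baseChange K ∘ₗ G).restrictScalars R ∘ₗ TensorProduct.mk R K M' 1 =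
          TensorProduct.mk R K M' 1 := by
        refine IsLocalizedModule.ext S f (hU M') (LinearMap.ext fun m => ?_)
        simp [hG, hg]
      have h3 := LinearMap.congr_fun h2 m
      simp only [LinearMap.comp_apply, TensorProduct.mk_apply, LinearMap.restrictScalars_apply] at h3
      rw [← mul_one a, ← smul_eq_mul, ← TensorProduct.smul_tmul', map_smul, LinearMap.comp_apply, h3]
      rfl
    exact LinearMap.congr_fun h w

/-! ### The connection on the completions -/

namespace WeylModule

open FormalDisc

variable {M N : WeylModule.{u}} {Δ : FormalDisc} {κ : Δ.K}

theorem X_smul_toPoly (m : M.carrier) :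
    (Polynomial.X : ℂ[X]) • M.toPoly m = M.toPoly (M.x m) := Module.AEval'.X_smul_of M.x m

theorem smul_toPoly (q : ℂ[X]) (m : M.carrier) :
    q • M.toPoly m = M.toPoly (Polynomial.aeval M.x q m) :=
  (Module.AEval.of_aeval_smul (R := ℂ) (A := Module.End ℂ M.carrier) (M := M.carrier) M.x q m).symm

theorem Hom.polyMap_toPoly (f : Hom N M) (n : N.carrier) :
    f.polyMap (N.toPoly n) = M.toPoly (f.toLin n) := rfl

theorem dPoly_toPoly (m : M.carrier) : M.dPoly (M.toPoly m) = M.toPoly (M.d m) := rfl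

/-- `toCompletion` as a linear map over the polynomial ring. -/
noncomputable def toCompletionₗ (M : WeylModule.{u}) (Δ : FormalDisc) :
    M.poly →ₗ[ℂ[X]] M.Completion Δ := TensorProduct.mk ℂ[X] Δ.K M.poly 1

theorem toCompletionₗ_toPoly (m : M.carrier) :
    M.toCompletionₗ Δ (M.toPoly m) = M.toCompletion Δ m := rfl

theorem toCompletion_add (m m' : M.carrier) :
    M.toCompletion Δ (m + m') = M.toCompletion Δ m + M.toCompletion Δ m' := by
  rw [← toCompletionₗ_toPoly, map_add, map_add]
  rfl

theorem algebraMap_smul_completion (q : ℂ[X]) (w : M.Completion Δ) :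
    algebraMap ℂ[X] Δ.K q • w = q • w := algebraMap_smul Δ.K q w

theorem toCompletion_smul (c : ℂ) (m : M.carrier) :
    M.toCompletion Δ (c • m) = c • M.toCompletion Δ m := by
  rw [← toCompletionₗ_toPoly, ← toCompletionₗ_toPoly, map_smul, LinearMap.map_smul_of_tower]

/-- `toCompletion` as a complex linear map. -/
noncomputable def toCompletionC (M : WeylModule.{u}) (Δ : FormalDisc) :
    M.carrier →ₗ[ℂ] M.Completion Δ where
  toFun := M.toCompletion Δ
  map_add' := toCompletion_add
  map_smul' := toCompletion_smul

theorem toCompletion_poly (q : ℂ[X]) (m : M.carrier) :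
    M.toCompletion Δ (Polynomial.aeval M.x q m) = algebraMap ℂ[X] Δ.K q • M.toCompletion Δ m := by
  rw [← toCompletionₗ_toPoly, ← smul_toPoly, map_smul, algebraMap_smul_completion]
  rfl

theorem toCompletion_x (m : M.carrier) :
    M.toCompletion Δ (M.x m) = Δ.zK • M.toCompletion Δ m := by
  have := toCompletion_poly (Δ := Δ) Polynomial.X m
  rwa [Polynomial.aeval_X, algebraMap_X] at this

theorem mulBy_apply (a : Δ.K) (w : M.Completion Δ) : M.mulBy a w = a • w := rfl

section Regular

variable (hΔ : Δ.IsRegular κ)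
include hΔ

theorem toCompletion_d (m : M.carrier) :
    M.toCompletion Δ (M.d m) = M.nabla Δ (M.toCompletion Δ m) := by
  rw [toCompletion, toCompletion, nabla_tmul, hΔ.deriv_one, TensorProduct.zero_tmul, zero_add,
    dPoly_toPoly]

theorem nabla_smul (a : Δ.K) (w : M.Completion Δ) :
    M.nabla Δ (a • w) = Δ.deriv a • w + a • M.nabla Δ w := by
  induction w using TensorProduct.induction_on with
  | zero => simp
  | add x y hx hy =>
    rw [smul_add, map_add, hx, hy, smul_add, map_add, smul_add]
    abel
  | tmul b m =>
    rw [TensorProduct.smul_tmul', nabla_tmul, nabla_tmul, smul_eq_mul, hΔ.deriv_mul, smul_add,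
      TensorProduct.add_tmul]
    simp only [TensorProduct.smul_tmul', smul_eq_mul]
    abel

theorem isConnection_mulBy_nabla : IsConnection (Δ := Δ) (M.mulBy κ * M.nabla Δ) := by
  intro a v
  rw [Module.End.mul_apply, Module.End.mul_apply, mulBy_apply, mulBy_apply, nabla_smul hΔ, smul_add,
    smul_smul, smul_smul, smul_smul, hΔ.theta_eq, mul_comm κ a]

end Regular

/-! ### Extension of functionals -/

section Extension

variable {P : Finset ℂ} {j : Hom N M}

theorem isUnit_of_mem_powers (hΔ : Δ.IsRegular κ) (s : ℂ[X])
    (hs : s ∈ Submonoid.powers (polePoly P)) : IsUnit (algebraMap ℂ[X] Δ.K s) := by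
  obtain ⟨k, rfl⟩ := hs
  rw [isUnit_iff_ne_zero, Ne, map_eq_zero_iff _ hΔ.injective]
  exact pow_ne_zero _ (polePoly_ne_zero P)

theorem IsExtension.exists_eq (hj : IsExtension P j) (m : M.carrier) :
    ∃ (k : ℕ) (n : N.carrier), Polynomial.aeval M.x (polePoly P ^ k) m = j.toLin n := by
  have : IsLocalizedModule (Submonoid.powers (polePoly P)) j.polyMap := hj
  obtain ⟨⟨n, ⟨_, k, rfl⟩⟩, hn⟩ := IsLocalizedModule.surj (Submonoid.powers (polePoly P)) j.polyMap
    (M.toPoly m)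
  refine ⟨k, N.toPoly.symm n, M.toPoly.injective ?_⟩
  rw [← smul_toPoly]
  exact hn

theorem IsExtension.exists_ker (hj : IsExtension P j) {n : N.carrier} (hn : j.toLin n = 0) :
    ∃ k : ℕ, Polynomial.aeval N.x (polePoly P ^ k) n = 0 := by
  have : IsLocalizedModule (Submonoid.powers (polePoly P)) j.polyMap := hj
  obtain ⟨⟨_, k, rfl⟩, hk⟩ := IsLocalizedModule.exists_of_eq (S := Submonoid.powers (polePoly P))
    (f := j.polyMap) (x₁ := N.toPoly n) (x₂ := 0) (by
      rw [map_zero, Hom.polyMap_toPoly, hn, map_zero])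
  refine ⟨k, N.toPoly.injective ?_⟩
  rw [← smul_toPoly, map_zero]
  exact hk.trans (smul_zero _)

theorem IsExtension.isUnit (hj : IsExtension P j) (k : ℕ) :
    IsUnit (Polynomial.aeval M.x (polePoly P ^ k)) := by
  have : IsLocalizedModule (Submonoid.powers (polePoly P)) j.polyMap := hj
  have h := IsLocalizedModule.map_units (S := Submonoid.powers (polePoly P)) j.polyMap
    ⟨_, k, rfl⟩
  rw [Module.End.isUnit_iff] at h ⊢
  have e (m : M.carrier) : M.toPoly (Polynomial.aeval M.x (polePoly P ^ k) m) =
      polePoly P ^ k • M.toPoly m := (smul_toPoly _ _).symm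
  refine ⟨fun m m' hm => M.toPoly.injective (h.1 ?_), fun m => ?_⟩
  · exact (e m).symm.trans ((congrArg M.toPoly hm).trans (e m'))
  · obtain ⟨w, hw⟩ := h.2 (M.toPoly m)
    refine ⟨M.toPoly.symm w, M.toPoly.injective ?_⟩
    rw [e, LinearEquiv.apply_symm_apply]
    exact hw

/-- A criterion for being an extension. -/
theorem isExtension_of (hu : IsUnit (Polynomial.aeval M.x (polePoly P)))
    (hs : ∀ m, ∃ (k : ℕ) (n : N.carrier), Polynomial.aeval M.x (polePoly P ^ k) m = j.toLin n)
    (hk : Function.Injective j.toLin) : IsExtension P j where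
  map_units := by
    rintro ⟨_, k, rfl⟩
    have h := hu.pow k
    rw [← map_pow, Module.End.isUnit_iff] at h
    rw [Module.End.isUnit_iff]
    have e (m : M.poly) : algebraMap ℂ[X] (Module.End ℂ[X] M.poly) (polePoly P ^ k) m =
        M.toPoly (Polynomial.aeval M.x (polePoly P ^ k) (M.toPoly.symm m)) := by
      rw [← smul_toPoly, LinearEquiv.apply_symm_apply]
      rfl
    have := (M.toPoly.bijective.comp h).comp M.toPoly.symm.bijective
    convert this using 1
    exact funext e
  surj m := by
    obtain ⟨k, n, h⟩ := hs (M.toPoly.symm m)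
    refine ⟨⟨N.toPoly n, ⟨_, k, rfl⟩⟩, ?_⟩
    change polePoly P ^ k • m = _
    rw [Hom.polyMap_toPoly, ← h, ← smul_toPoly, LinearEquiv.apply_symm_apply]
  exists_of_eq {n n'} h := by
    refine ⟨1, ?_⟩
    rw [one_smul, one_smul]
    exact N.toPoly.symm.injective (hk (M.toPoly.injective h))

/-- The pole polynomial is invertible in ℂ((t)), so the image of `N` spans the completion over that
field. In particular functionals are determined by their restriction to `N`. -/
theorem completion_induction (hΔ : Δ.IsRegular κ) (hj : IsExtension P j)
    {p : M.Completion Δ → Prop} (hadd : ∀ v w, p v → p w → p (v + w))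
    (hsmul : ∀ (a : Δ.K) v, p v → p (a • v)) (hmem : ∀ n, p (M.toCompletion Δ (j.toLin n)))
    (v : M.Completion Δ) : p v := by
  induction v using TensorProduct.induction_on with
  | zero => simpa using hsmul 0 _ (hmem 0)
  | add x y hx hy => exact hadd x y hx hy
  | tmul a m =>
    obtain ⟨k, n, h⟩ := IsExtension.exists_eq hj (M.toPoly.symm m)
    have hq := isUnit_of_mem_powers hΔ (polePoly P ^ k) ⟨k, rfl⟩
    have h2 := toCompletion_poly (Δ := Δ) (polePoly P ^ k) (M.toPoly.symm m)
    have e : a ⊗ₜ[ℂ[X]] m = (a * (algebraMap ℂ[X] Δ.K (polePoly P ^ k))⁻¹) •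
        M.toCompletion Δ (j.toLin n) := by
      rw [← h, h2, smul_smul, mul_assoc, inv_mul_cancel₀ hq.ne_zero, mul_one, toCompletion,
        TensorProduct.smul_tmul', smul_eq_mul, mul_one, LinearEquiv.apply_symm_apply]
    rw [e]
    exact hsmul _ _ (hmem n)

theorem completion_functional_ext (hΔ : Δ.IsRegular κ) (hj : IsExtension P j)
    {g h : M.Completion Δ →ₗ[Δ.K] Δ.K}
    (hgh : ∀ n, g (M.toCompletion Δ (j.toLin n)) = h (M.toCompletion Δ (j.toLin n))) : g = h := by
  refine LinearMap.ext fun v => ?_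
  refine completion_induction hΔ hj (p := fun v => g v = h v) (fun v w hv hw => ?_)
    (fun a v hv => ?_) hgh v
  · rw [map_add, map_add, hv, hw]
  · rw [map_smul, map_smul, hv]

/-- A homomorphism from `N` to `ℂ((t))` with the connection `d + c`. -/
structure IsSolution (N : WeylModule.{u}) (Δ : FormalDisc) (c : Δ.K)
    (φ : N.carrier →ₗ[ℂ] Δ.K) : Prop where
  map_x : ∀ n, φ (N.x n) = Δ.zK * φ n
  map_d : ∀ n, φ (N.d n) = Δ.deriv (φ n) + c * φ n

/-- The universal properties of localization and base change extend φ, and horizontality needs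
checking only on the image of `N`. Together with `isSolution_of_functional` this identifies
horizontal functionals with solutions on `N`, which make sense in either of two dual variables. -/
theorem IsSolution.exists_lift (hΔ : Δ.IsRegular κ) (hj : IsExtension P j) {c : Δ.K}
    {φ : N.carrier →ₗ[ℂ] Δ.K} (hφ : IsSolution N Δ c φ) :
    ∃ h : M.Completion Δ →ₗ[Δ.K] Δ.K, (∀ n, h (M.toCompletion Δ (j.toLin n)) = φ n) ∧
      ∀ v, h (M.nabla Δ v) = Δ.deriv (h v) + c * h v := by
  have : IsLocalizedModule (Submonoid.powers (polePoly P)) j.polyMap := hj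
  let φ' : N.poly →ₗ[ℂ[X]] Δ.K := LinearMap.ofAEval N.x φ fun m => by
    rw [X_smul_eq]
    exact hφ.map_x m
  have hu (s : Submonoid.powers (polePoly P)) :
      IsUnit (algebraMap ℂ[X] (Module.End ℂ[X] Δ.K) s) := by
    have h1 := isUnit_of_mem_powers hΔ s.1 s.2
    have h2 := h1.map (algebraMap Δ.K (Module.End Δ.K Δ.K))
    rw [Module.End.isUnit_iff] at h2 ⊢
    convert h2 using 1
    ext a
    change (s : ℂ[X]) • a = algebraMap ℂ[X] Δ.K s * a
    rw [Algebra.smul_def]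
  let ψ : M.poly →ₗ[ℂ[X]] Δ.K :=
    IsLocalizedModule.lift (Submonoid.powers (polePoly P)) j.polyMap φ' hu
  have hψ (n : N.carrier) : ψ (M.toPoly (j.toLin n)) = φ n :=
    IsLocalizedModule.lift_apply (Submonoid.powers (polePoly P)) j.polyMap φ' hu (N.toPoly n)
  let h : M.Completion Δ →ₗ[Δ.K] Δ.K := ψ.liftBaseChange Δ.K
  have hh (m : M.carrier) : h (M.toCompletion Δ m) = ψ (M.toPoly m) := by
    simp [h, toCompletion]
  refine ⟨h, fun n => by rw [hh, hψ], fun v => ?_⟩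
  refine completion_induction hΔ hj
    (p := fun v => h (M.nabla Δ v) = Δ.deriv (h v) + c * h v) (fun v w hv hw => ?_)
    (fun a v hv => ?_) (fun n => ?_) v
  · simp only [map_add, hv, hw]
    ring
  · rw [nabla_smul hΔ, map_add, map_smul, map_smul, map_smul, hv, smul_eq_mul, smul_eq_mul,
      smul_eq_mul, hΔ.deriv_mul]
    ring
  · rw [← toCompletion_d hΔ, ← j.map_d, hh, hψ, hh, hψ, hφ.map_d]

theorem isSolution_of_functional (hΔ : Δ.IsRegular κ) (j : Hom N M) {c : Δ.K}
    {h : M.Completion Δ →ₗ[Δ.K] Δ.K} (hh : ∀ v, h (M.nabla Δ v) = Δ.deriv (h v) + c * h v) :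
    IsSolution N Δ c (h.restrictScalars ℂ ∘ₗ M.toCompletionC Δ ∘ₗ j.toLin) where
  map_x n := by
    change h (M.toCompletion Δ (j.toLin (N.x n))) = Δ.zK * h (M.toCompletion Δ (j.toLin n))
    rw [j.map_x, toCompletion_x, map_smul, smul_eq_mul]
  map_d n := by
    change h (M.toCompletion Δ (j.toLin (N.d n))) = Δ.deriv (h (M.toCompletion Δ (j.toLin n))) +
      c * h (M.toCompletion Δ (j.toLin n))
    rw [j.map_d, toCompletion_d hΔ, hh]

end Extension

/-- In a torsion-free module the map to the completion is injective. -/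
theorem toCompletion_injective (hΔ : Δ.IsRegular κ) [Module.IsTorsionFree ℂ[X] M.poly] :
    Function.Injective (M.toCompletion Δ) := by
  have h := Module.Flat.rTensor_preserves_injective_linearMap (M := M.poly)
    (Algebra.linearMap ℂ[X] Δ.K) hΔ.injective
  intro m m' hm
  refine M.toPoly.injective ((TensorProduct.lid ℂ[X] M.poly).symm.injective (h ?_))
  simpa [toCompletion] using hm

end WeylModule

open FormalDisc

namespace WeylModule

/-! ### The connections defining the residues -/

/-- The operator `(x - p) ∂` on the formal completion at `p`. -/
noncomputable abbrev connAt (M : WeylModule.{u}) (p : ℂ) :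
    M.Completion (discAt p) →ₗ[ℂ] M.Completion (discAt p) :=
  M.mulBy (discAt p).t * M.nabla (discAt p)

/-- The operator `-x (∂ - ξ)` on the formal completion at infinity. -/
noncomputable abbrev connInfty (M : WeylModule.{u}) (ξ : ℂ) :
    M.Completion discInfty →ₗ[ℂ] M.Completion discInfty :=
  -(M.mulBy (discInfty.t)⁻¹ * (M.nabla discInfty - ξ • 1))

variable {M : WeylModule.{u}}

theorem connAt_apply (p : ℂ) (v : M.Completion (discAt p)) :
    M.connAt p v = (discAt p).t • M.nabla (discAt p) v := rfl

theorem connInfty_apply (ξ : ℂ) (v : M.Completion discInfty) :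
    M.connInfty ξ v = -((discInfty.t)⁻¹ • (M.nabla discInfty v - ξ • v)) := rfl

theorem connInfty_eq (ξ : ℂ) (v : M.Completion discInfty) :
    M.connInfty ξ v = M.connInfty 0 v + (ξ • (discInfty.t)⁻¹) • v := by
  rw [connInfty_apply, connInfty_apply, zero_smul, sub_zero, smul_sub, smul_assoc,
    smul_comm ((discInfty.t)⁻¹) ξ v]
  abel

theorem isConnection_connAt (p : ℂ) : IsConnection (Δ := discAt p) (M.connAt p) :=
  isConnection_mulBy_nabla (isRegular_discAt p)

theorem isConnection_connInfty (ξ : ℂ) : IsConnection (Δ := discInfty) (M.connInfty ξ) := by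
  intro a v
  rw [connInfty_apply, nabla_smul isRegular_discInfty, isRegular_discInfty.theta_eq,
    connInfty_apply, smul_comm ξ a v]
  simp only [smul_sub, smul_add, smul_neg, smul_smul, neg_mul, neg_smul, mul_comm a]
  abel

theorem isHorizontalAt_iff {p α : ℂ} {h : M.Completion (discAt p) →ₗ[(discAt p).K] (discAt p).K} :
    IsHorizontalAt M p α h ↔ h ∈ horizontal (M.connAt p) ((discAt p).chr α 0) := by
  refine forall_congr' fun u => ?_
  have ht := (discAt p).t_ne_zero
  rw [connAt_apply, map_smul, smul_eq_mul, (isRegular_discAt p).theta_eq, chr, zero_smul, add_zero,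
    ← mul_right_inj' ht]
  have e : (discAt p).t * ((discAt p).deriv (h u) + α • ((discAt p).t)⁻¹ * h u) =
      (discAt p).t * (discAt p).deriv (h u) + algebraMap ℂ (discAt p).K α * h u := by
    rw [Algebra.smul_def]
    field_simp
  rw [e]

theorem isHorizontalInfty_iff {ξ α : ℂ} {g : M.Completion discInfty →ₗ[discInfty.K] discInfty.K} :
    IsHorizontalInfty M ξ α g ↔ g ∈ horizontal (M.connInfty ξ) (discInfty.chr α 0) := by
  refine forall_congr' fun u => ?_
  have ht := discInfty.t_ne_zero
  rw [connInfty_apply, map_neg, map_smul, smul_eq_mul, isRegular_discInfty.theta_eq, chr, zero_smul,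
    add_zero, map_sub, LinearMap.map_smul_of_tower, Algebra.smul_def, Algebra.smul_def]
  constructor
  · intro h
    rw [h]
    field_simp
    ring
  · intro h
    field_simp at h
    linear_combination -h

/-- Brings the components at infinity for all ξ under the single connection `connInfty 0`, where
they are told apart by the term −ξ/t of the character. -/
theorem mem_horizontal_connInfty {ξ : ℂ} {α : ℂ}
    {g : M.Completion discInfty →ₗ[discInfty.K] discInfty.K} :
    g ∈ horizontal (M.connInfty ξ) (discInfty.chr α 0) ↔
      g ∈ horizontal (M.connInfty 0) (discInfty.chr α (-ξ)) := by
  refine forall_congr' fun u => ?_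
  rw [connInfty_eq, map_add, map_smul, smul_eq_mul]
  simp only [chr, zero_smul, add_zero, neg_smul]
  constructor
  · intro h
    linear_combination h
  · intro h
    linear_combination h

/-! ### Dual modules and the formal Laplace transform -/

/-- The two modules are the same space, in dual variables: `∂ = ε x'` and `x = -ε ∂'`. -/
structure IsDualPair (ε : ℤ) (N N' : WeylModule.{u}) (c : N.carrier ≃ₗ[ℂ] N'.carrier) : Prop where
  sign : ε = 1 ∨ ε = -1
  map_d : ∀ n, c (N.d n) = (ε : ℂ) • N'.x (c n)
  map_x : ∀ n, c (N.x n) = -(ε : ℂ) • N'.d (c n)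

theorem IsDualPair.sq {ε : ℤ} {N N' : WeylModule.{u}} {c : N.carrier ≃ₗ[ℂ] N'.carrier}
    (h : IsDualPair ε N N' c) : (ε : ℂ) * ε = 1 := by
  rcases h.sign with h | h <;> simp [h]

theorem IsDualPair.symm {ε : ℤ} {N N' : WeylModule.{u}} {c : N.carrier ≃ₗ[ℂ] N'.carrier}
    (h : IsDualPair ε N N' c) : IsDualPair (-ε) N' N c.symm where
  sign := by rcases h.sign with h | h <;> simp [h]
  map_d n := by
    have h1 := h.map_x (c.symm n)
    rw [LinearEquiv.apply_symm_apply] at h1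
    rw [LinearEquiv.symm_apply_eq, map_smul, h1, smul_smul]
    push_cast
    rw [show -(ε : ℂ) * -ε = 1 by linear_combination h.sq, one_smul]
  map_x n := by
    have h1 := h.map_d (c.symm n)
    rw [LinearEquiv.apply_symm_apply] at h1
    rw [LinearEquiv.symm_apply_eq, map_smul, h1, smul_smul]
    push_cast
    rw [neg_neg, h.sq, one_smul]

end WeylModule

/-! ### The formal Laplace transform of Laurent series -/

namespace FormalDisc

/-- The map multiplying the coefficients by `f` and shifting them by `s`. -/
noncomputable def scale (Δ Δ' : FormalDisc) (f : ℤ → ℂ) (s : ℤ) : Δ.K →ₗ[ℂ] Δ'.K where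
  toFun a := Δ'.ofFun (fun m => f m * Δ.coeff a (m - s)) ((exists_mem_fil a).choose + s)
  map_add' a b := coeff_ext fun n => by
    have h (a : Δ.K) (h : n < (exists_mem_fil a).choose + s) : Δ.coeff a (n - s) = 0 :=
      (exists_mem_fil a).choose_spec _ (by omega)
    rw [coeff_add, coeff_ofFun, coeff_ofFun, coeff_ofFun]
    have ha := h a
    have hb := h b
    have hab := h (a + b)
    rw [coeff_add] at hab ⊢
    split_ifs <;> simp_all [mul_add]
    linear_combination -(f n) * hab
  map_smul' r a := coeff_ext fun n => by
    have h (a : Δ.K) (h : n < (exists_mem_fil a).choose + s) : Δ.coeff a (n - s) = 0 :=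
      (exists_mem_fil a).choose_spec _ (by omega)
    rw [RingHom.id_apply, coeff_smul, coeff_ofFun, coeff_ofFun]
    have ha := h a
    have hra := h (r • a)
    rw [coeff_smul] at hra ⊢
    split_ifs with h1 h2 h2
    · simp
    · linear_combination -(f n) * hra h1
    · rw [ha h2]; simp
    · ring

variable {Δ Δ' : FormalDisc}

@[simp] theorem coeff_scale (f : ℤ → ℂ) (s : ℤ) (a : Δ.K) (n : ℤ) :
    Δ'.coeff (scale Δ Δ' f s a) n = f n * Δ.coeff a (n - s) := by
  change Δ'.coeff (Δ'.ofFun _ _) n = _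
  rw [coeff_ofFun]
  split_ifs with h
  · rw [(exists_mem_fil a).choose_spec _ (show n - s < _ by omega), mul_zero]
  · rfl

/-- The formal Laplace transform
`(y - p) ^ (α + k) ↦ ε ^ k Γ(α + k + 1) z ^ (-(α + k + 1)) e ^ (ξ z)`. -/
noncomputable def formalLaplace (ε : ℤ) (p α : ℂ) : (discAt p).K →ₗ[ℂ] discInfty.K :=
  scale _ _ (fun m => (ε : ℂ) ^ (m - 1) * Complex.Gamma (α + (m - 1 : ℤ) + 1)) 1

theorem coeff_formalLaplace (ε : ℤ) (p α : ℂ) (a : (discAt p).K) (k : ℤ) :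
    discInfty.coeff (formalLaplace ε p α a) (k + 1) =
      ((ε : ℂ) ^ k * Complex.Gamma (α + k + 1)) * (discAt p).coeff a k := by
  rw [formalLaplace, coeff_scale, add_sub_cancel_right]

section

variable {ε : ℤ} (hε : ε = 1 ∨ ε = -1) {p α : ℂ} (hα : ∀ n : ℤ, α ≠ n)
include hα

theorem add_intCast_ne_zero (k : ℤ) : α + k ≠ 0 := fun h => hα (-k) (by
  push_cast
  linear_combination h)

/-- Non-integrality of α keeps the arguments away from the poles of Γ; this is why stationary phase
is restricted to such α. -/
theorem gamma_ne_zero (k : ℤ) : Complex.Gamma (α + k + 1) ≠ 0 :=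
  Complex.Gamma_ne_zero fun m h => hα (-m - k - 1) (by push_cast; linear_combination h)

theorem gamma_succ (k : ℤ) :
    Complex.Gamma (α + (k + 1 : ℤ) + 1) = (α + k + 1) * Complex.Gamma (α + k + 1) := by
  rw [← Complex.Gamma_add_one _ (by
    have := add_intCast_ne_zero hα (k + 1)
    push_cast at this
    rwa [← add_assoc] at this)]
  push_cast
  ring_nf

include hε

theorem sign_ne_zero : (ε : ℂ) ≠ 0 := by rcases hε with h | h <;> simp [h]

theorem formalLaplace_injective : Function.Injective (formalLaplace ε p α) := by
  rw [injective_iff_map_eq_zero]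
  intro a ha
  refine coeff_ext fun k => ?_
  have h := coeff_formalLaplace ε p α a k
  rw [ha, coeff_zero, eq_comm] at h
  rw [coeff_zero]
  exact (mul_eq_zero.1 h).resolve_left
    (mul_ne_zero (zpow_ne_zero _ (sign_ne_zero hε hα)) (gamma_ne_zero hα k))

theorem formalLaplace_surjective : Function.Surjective (formalLaplace ε p α) := by
  intro b
  refine ⟨scale _ _ (fun k => ((ε : ℂ) ^ k * Complex.Gamma (α + k + 1))⁻¹) (-1) b,
    coeff_ext fun n => ?_⟩
  obtain ⟨k, rfl⟩ : ∃ k, n = k + 1 := ⟨n - 1, by ring⟩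
  rw [coeff_formalLaplace, coeff_scale, sub_neg_eq_add, mul_inv_cancel_left₀]
  exact mul_ne_zero (zpow_ne_zero _ (sign_ne_zero hε hα)) (gamma_ne_zero hα k)

/-- Coefficientwise this is Γ(s + 1) = sΓ(s), the factor ε^k accounting for the sign. The same
computation gives `formalLaplace_z_mul`, so both generators of the Weyl algebra are intertwined. -/
theorem formalLaplace_deriv (a : (discAt p).K) :
    formalLaplace ε p α ((discAt p).deriv a + (α • ((discAt p).t)⁻¹) * a) =
      (ε : ℂ) • (discInfty.zK * formalLaplace ε p α a) := by
  refine coeff_ext fun n => ?_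
  obtain ⟨k, rfl⟩ : ∃ k, n = k + 1 := ⟨n - 1, by ring⟩
  rw [coeff_formalLaplace, coeff_smul, discInfty_zK, coeff_t_inv_mul, coeff_formalLaplace, coeff_add,
    coeff_discAt_deriv, smul_mul_assoc, coeff_smul, coeff_t_inv_mul, gamma_succ hα,
    zpow_add_one₀ (sign_ne_zero hε hα)]
  have hs : (ε : ℂ) * ε = 1 := by rcases hε with h | h <;> simp [h]
  linear_combination (-(ε : ℂ) ^ k * Complex.Gamma (α + k + 1) * (k + 1 + α) *
    (discAt p).coeff a (k + 1)) * hs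

theorem formalLaplace_z_mul (a : (discAt p).K) {ξ : ℂ} (hξ : ξ = -ε * p) :
    formalLaplace ε p α ((discAt p).zK * a) =
      -(ε : ℂ) • (discInfty.deriv (formalLaplace ε p α a) +
        (algebraMap ℂ discInfty.K ξ - α • discInfty.t) * formalLaplace ε p α a) := by
  refine coeff_ext fun n => ?_
  obtain ⟨k, rfl⟩ : ∃ k, n = k + 1 + 1 := ⟨n - 1 - 1, by ring⟩
  have hs : (ε : ℂ) * ε = 1 := by rcases hε with h | h <;> simp [h]
  rw [coeff_formalLaplace, coeff_smul, coeff_add, coeff_discInfty_deriv,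
    sub_mul (algebraMap ℂ discInfty.K ξ), coeff_sub,
    algebraMap_mul, smul_mul_assoc, coeff_smul, coeff_smul, coeff_t_mul, add_sub_cancel_right,
    coeff_formalLaplace, coeff_formalLaplace, discAt_zK, add_mul, coeff_add, algebraMap_mul,
    coeff_smul, coeff_t_mul, gamma_succ hα, zpow_add_one₀ (sign_ne_zero hε hα), hξ,
    add_sub_cancel_right]
  push_cast
  linear_combination (-p * (discAt p).coeff a (k + 1) * (ε : ℂ) ^ k * ε *
    ((α + k + 1) * Complex.Gamma (α + k + 1))) * hs

end

end FormalDisc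

/-! ### Stationary phase as a correspondence of horizontal functionals -/

namespace WeylModule

section Matching

variable {ε : ℤ} {N N' A B : WeylModule.{u}} {c : N.carrier ≃ₗ[ℂ] N'.carrier} {P P' : Finset ℂ}
  {a : Hom N A} {b : Hom N' B} {p ξ α : ℂ}

/-- The functionals `h` and `g` are exchanged by the formal Laplace transform. -/
def Matching (ε : ℤ) (a : Hom N A) (b : Hom N' B) (c : N.carrier ≃ₗ[ℂ] N'.carrier) (α : ℂ)
    (h : A.Completion (discAt p) →ₗ[(discAt p).K] (discAt p).K)
    (g : B.Completion discInfty →ₗ[discInfty.K] discInfty.K) : Prop :=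
  ∀ n, g (B.toCompletion discInfty (b.toLin (c n))) =
    formalLaplace ε p α (h (A.toCompletion (discAt p) (a.toLin n)))

theorem matching_iff {h : A.Completion (discAt p) →ₗ[(discAt p).K] (discAt p).K}
    {g : B.Completion discInfty →ₗ[discInfty.K] discInfty.K} :
    Matching ε a b c α h g ↔ ∀ n (k : ℤ),
      discInfty.coeff (g (B.toCompletion discInfty (b.toLin (c n)))) (k + 1) =
        ((ε : ℂ) ^ k * Complex.Gamma (α + k + 1)) *
          (discAt p).coeff (h (A.toCompletion (discAt p) (a.toLin n))) k := by
  refine forall_congr' fun n => ⟨fun h k => by rw [h, coeff_formalLaplace], fun h => ?_⟩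
  refine coeff_ext fun m => ?_
  obtain ⟨k, rfl⟩ : ∃ k, m = k + 1 := ⟨m - 1, by ring⟩
  rw [h, coeff_formalLaplace]

variable (hd : IsDualPair ε N N' c) (ha : IsExtension P a) (hb : IsExtension P' b)
  (hα : ∀ n : ℤ, α ≠ n) (hξ : ξ = -ε * p)
include hd hα

include hb hξ in
-- The restriction of h to `N`, composed with the formal Laplace transform, is a solution on `N'`
-- because the transform intertwines the Weyl algebra actions; it then lifts to the completion of
-- `B`.
theorem exists_matching_right {h : A.Completion (discAt p) →ₗ[(discAt p).K] (discAt p).K}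
    (hh : IsHorizontalAt A p α h) : ∃ g, IsHorizontalInfty B ξ α g ∧ Matching ε a b c α h g := by
  have hs := isSolution_of_functional (isRegular_discAt p) a hh
  let φ := h.restrictScalars ℂ ∘ₗ A.toCompletionC (discAt p) ∘ₗ a.toLin
  have hs' : IsSolution N' discInfty (algebraMap ℂ discInfty.K ξ - α • discInfty.t)
      (formalLaplace ε p α ∘ₗ φ ∘ₗ c.symm.toLinearMap) := by
    constructor
    · intro n
      have h1 := hd.symm.map_x n
      change formalLaplace ε p α (φ (c.symm (N'.x n))) = _ * formalLaplace ε p α (φ (c.symm n))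
      rw [h1, map_smul, hs.map_d, map_smul, formalLaplace_deriv hd.sign hα, smul_smul]
      push_cast
      rw [neg_neg, hd.sq, one_smul]
      rfl
    · intro n
      have h1 := hd.symm.map_d n
      change formalLaplace ε p α (φ (c.symm (N'.d n))) =
        discInfty.deriv (formalLaplace ε p α (φ (c.symm n))) +
          _ * formalLaplace ε p α (φ (c.symm n))
      rw [h1, map_smul, hs.map_x, map_smul, formalLaplace_z_mul hd.sign hα _ hξ, smul_smul]
      push_cast
      rw [show -(ε : ℂ) * -ε = 1 by linear_combination hd.sq, one_smul]
      rfl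
  obtain ⟨g, hg, hg'⟩ := hs'.exists_lift isRegular_discInfty hb
  refine ⟨g, hg', fun n => ?_⟩
  rw [hg]
  simp only [LinearMap.comp_apply, LinearEquiv.coe_coe, LinearEquiv.symm_apply_apply]
  rfl

include ha hξ in
theorem exists_matching_left {g : B.Completion discInfty →ₗ[discInfty.K] discInfty.K}
    (hg : IsHorizontalInfty B ξ α g) :
    ∃ h, IsHorizontalAt A p α h ∧ Matching ε a b c α h g := by
  have hs := isSolution_of_functional isRegular_discInfty b hg
  let φ := g.restrictScalars ℂ ∘ₗ B.toCompletionC discInfty ∘ₗ b.toLin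
  let E := LinearEquiv.ofBijective (formalLaplace ε p α)
    ⟨formalLaplace_injective hd.sign hα, formalLaplace_surjective hd.sign hα⟩
  have hE (y : discInfty.K) : formalLaplace ε p α (E.symm y) = y := E.apply_symm_apply y
  have hs' : IsSolution N (discAt p) (α • ((discAt p).t)⁻¹)
      (E.symm.toLinearMap ∘ₗ φ ∘ₗ c.toLinearMap) := by
    constructor
    · intro n
      refine formalLaplace_injective (ε := ε) (α := α) hd.sign hα ?_
      rw [formalLaplace_z_mul hd.sign hα _ hξ]
      change formalLaplace ε p α (E.symm (φ (c (N.x n)))) = -(ε : ℂ) • (discInfty.deriv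
        (formalLaplace ε p α (E.symm (φ (c n)))) + _ * formalLaplace ε p α (E.symm (φ (c n))))
      rw [hE, hE, hd.map_x, map_smul, hs.map_d]
    · intro n
      refine formalLaplace_injective (ε := ε) (α := α) hd.sign hα ?_
      rw [formalLaplace_deriv hd.sign hα]
      change formalLaplace ε p α (E.symm (φ (c (N.d n)))) = (ε : ℂ) • (discInfty.zK *
        formalLaplace ε p α (E.symm (φ (c n))))
      rw [hE, hE, hd.map_d, map_smul, hs.map_x]
  obtain ⟨h, hh, hh'⟩ := hs'.exists_lift (isRegular_discAt p) ha
  refine ⟨h, hh', fun n => ?_⟩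
  rw [hh]
  exact (hE _).symm

omit hα in
include hb in
theorem Matching.right_unique {h : A.Completion (discAt p) →ₗ[(discAt p).K] (discAt p).K}
    {g g' : B.Completion discInfty →ₗ[discInfty.K] discInfty.K} (h1 : Matching ε a b c α h g)
    (h2 : Matching ε a b c α h g') : g = g' := by
  refine completion_functional_ext isRegular_discInfty hb fun n => ?_
  obtain ⟨n, rfl⟩ := c.surjective n
  rw [h1, h2]

include ha in
theorem Matching.left_unique {h h' : A.Completion (discAt p) →ₗ[(discAt p).K] (discAt p).K}
    {g : B.Completion discInfty →ₗ[discInfty.K] discInfty.K} (h1 : Matching ε a b c α h g)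
    (h2 : Matching ε a b c α h' g) : h = h' := by
  refine completion_functional_ext (isRegular_discAt p) ha fun n =>
    formalLaplace_injective (ε := ε) (α := α) hd.sign hα ?_
  rw [← h1, ← h2]

include ha hb hξ

/-- The formal Laplace transform exchanges the horizontal functionals. -/
theorem exists_matching_equiv :
    ∃ Φ : horizontal (A.connAt p) ((discAt p).chr α 0) ≃ₗ[ℂ]
      horizontal (B.connInfty ξ) (discInfty.chr α 0),
      ∀ h g, Matching ε a b c α h.1 g.1 ↔ g = Φ h := by
  choose F hF using fun h : horizontal (A.connAt p) ((discAt p).chr α 0) =>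
    exists_matching_right hd hb hα hξ (a := a) (isHorizontalAt_iff.2 h.2)
  let Φ : horizontal (A.connAt p) ((discAt p).chr α 0) →ₗ[ℂ]
      horizontal (B.connInfty ξ) (discInfty.chr α 0) :=
    { toFun := fun h => ⟨F h, isHorizontalInfty_iff.1 (hF h).1⟩
      map_add' := fun h h' => Subtype.ext <| Matching.right_unique hd hb (hF (h + h')).2 fun n => by
        change F h _ + F h' _ = formalLaplace ε p α (h.1 _ + h'.1 _)
        rw [map_add, (hF h).2, (hF h').2]
      map_smul' := fun r h => Subtype.ext <| Matching.right_unique hd hb (hF (r • h)).2 fun n => by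
        change r • F h _ = formalLaplace ε p α (r • h.1 _)
        rw [map_smul, (hF h).2] }
  have hΦ (h) : Matching ε a b c α h.1 (Φ h).1 := (hF h).2
  refine ⟨LinearEquiv.ofBijective Φ ⟨fun h h' e => ?_, fun g => ?_⟩, fun h g => ⟨fun hg => ?_, ?_⟩⟩
  · exact Subtype.ext (Matching.left_unique hd ha hα (hΦ h) (e ▸ hΦ h'))
  · obtain ⟨h, hh, hm⟩ := exists_matching_left hd ha hα hξ (isHorizontalInfty_iff.2 g.2) (b := b)
    exact ⟨⟨h, isHorizontalAt_iff.1 hh⟩, Subtype.ext (Matching.right_unique hd hb (hΦ _) hm)⟩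
  · exact Subtype.ext (Matching.right_unique hd hb hg (hΦ h))
  · rintro rfl
    exact hΦ h

omit hd ha hb hα hξ in
theorem stationaryPhase_iff {u : A.Completion (discAt p)} {v : B.Completion discInfty} :
    StationaryPhase ε A B a.toLin (fun n => b.toLin (c n)) p ξ α u v ↔
      u ∈ A.psi p α ∧ v ∈ B.psiInfty ξ α ∧
        ∀ (h : horizontal (A.connAt p) ((discAt p).chr α 0))
          (g : horizontal (B.connInfty ξ) (discInfty.chr α 0)), Matching ε a b c α h.1 g.1 →
          (discAt p).coeff (h.1 u) 0 = discInfty.coeff (g.1 v) 0 := by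
  refine and_congr_right fun _ => and_congr_right fun _ => ⟨fun H h g hm => ?_, fun H h g hh hg hm =>
    ?_⟩
  · exact H _ _ (isHorizontalAt_iff.2 h.2) (isHorizontalInfty_iff.2 g.2) (matching_iff.1 hm)
  · exact H ⟨h, isHorizontalAt_iff.1 hh⟩ ⟨g, isHorizontalInfty_iff.1 hg⟩ (matching_iff.2 hm)

variable {ι ι' : Type*} [Fintype ι] [Fintype ι']
  {e : Module.Basis ι (discAt p).K (A.Completion (discAt p))} {μ γ : ι → ℂ}
  {e' : Module.Basis ι' discInfty.K (B.Completion discInfty)} {μ' γ' : ι' → ℂ}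

/-- The vector u prescribes the values of all horizontal functionals on v, and these separate the
points of the eigenspace. -/
theorem stationaryPhase_right_unique (he' : IsNormalBasis (B.connInfty ξ) e' μ' γ')
    {u : A.Completion (discAt p)} {v v' : B.Completion discInfty}
    (h1 : StationaryPhase ε A B a.toLin (fun n => b.toLin (c n)) p ξ α u v)
    (h2 : StationaryPhase ε A B a.toLin (fun n => b.toLin (c n)) p ξ α u v') : v = v' := by
  obtain ⟨Φ, hΦ⟩ := exists_matching_equiv hd ha hb hα hξ
  rw [stationaryPhase_iff] at h1 h2
  refine sub_eq_zero.1 (he'.eq_zero_of_pairing (isConnection_connInfty ξ)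
    (Submodule.sub_mem _ h1.2.1 h2.2.1) fun g hg => ?_)
  have hm := (hΦ (Φ.symm ⟨g, hg⟩) ⟨g, hg⟩).2 (Φ.apply_symm_apply _).symm
  rw [map_sub, coeff_sub, ← h1.2.2 _ ⟨g, hg⟩ hm, ← h2.2.2 _ ⟨g, hg⟩ hm, sub_self]

theorem stationaryPhase_left_unique (he : IsNormalBasis (A.connAt p) e μ γ)
    {u u' : A.Completion (discAt p)} {v : B.Completion discInfty}
    (h1 : StationaryPhase ε A B a.toLin (fun n => b.toLin (c n)) p ξ α u v)
    (h2 : StationaryPhase ε A B a.toLin (fun n => b.toLin (c n)) p ξ α u' v) : u = u' := by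
  obtain ⟨Φ, hΦ⟩ := exists_matching_equiv hd ha hb hα hξ
  rw [stationaryPhase_iff] at h1 h2
  refine sub_eq_zero.1 (he.eq_zero_of_pairing (isConnection_connAt p)
    (Submodule.sub_mem _ h1.1 h2.1) fun h hh => ?_)
  have hm := (hΦ ⟨h, hh⟩ (Φ ⟨h, hh⟩)).2 rfl
  rw [map_sub, coeff_sub, h1.2.2 ⟨h, hh⟩ _ hm, h2.2.2 ⟨h, hh⟩ _ hm, sub_self]

/-- Evaluation on u, carried over by the matching, is a functional on the horizontal functionals at
infinity; by the perfect pairing it is evaluation on some v. -/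
theorem exists_stationaryPhase_right (he' : IsNormalBasis (B.connInfty ξ) e' μ' γ')
    {u : A.Completion (discAt p)} (hu : u ∈ A.psi p α) :
    ∃ v, StationaryPhase ε A B a.toLin (fun n => b.toLin (c n)) p ξ α u v := by
  obtain ⟨Φ, hΦ⟩ := exists_matching_equiv hd ha hb hα hξ
  obtain ⟨v, hv, hv'⟩ := he'.exists_pairing_eq (isConnection_connInfty ξ) (α := α)
    { toFun := fun g => (discAt p).coeff ((Φ.symm g).1 u) 0
      map_add' := fun g g' => by rw [map_add]; rfl
      map_smul' := fun r g => by rw [map_smul]; rfl }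
  refine ⟨v, stationaryPhase_iff.2 ⟨hu, hv, fun h g hm => ?_⟩⟩
  rw [hv', (hΦ h g).1 hm]
  simp

theorem exists_stationaryPhase_left (he : IsNormalBasis (A.connAt p) e μ γ)
    {v : B.Completion discInfty} (hv : v ∈ B.psiInfty ξ α) :
    ∃ u, StationaryPhase ε A B a.toLin (fun n => b.toLin (c n)) p ξ α u v := by
  obtain ⟨Φ, hΦ⟩ := exists_matching_equiv hd ha hb hα hξ
  obtain ⟨u, hu, hu'⟩ := he.exists_pairing_eq (isConnection_connAt p) (α := α)
    { toFun := fun h => discInfty.coeff ((Φ h).1 v) 0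
      map_add' := fun g g' => by rw [map_add]; rfl
      map_smul' := fun r g => by rw [map_smul]; rfl }
  refine ⟨u, stationaryPhase_iff.2 ⟨hu, hv, fun h g hm => ?_⟩⟩
  rw [hu', (hΦ h g).1 hm]
  rfl

end Matching

end WeylModule

namespace WeylModule

variable {M N N' : WeylModule.{u}}

/-! ### Lattices and normal bases -/

theorem _root_.HasLogLattice.exists_isNormalBasis {p : ℂ} (h : HasLogLattice M p) :
    ∃ (r : ℕ) (e : Module.Basis (Fin r) (discAt p).K (M.Completion (discAt p))) (μ : Fin r → ℂ),
      IsNormalBasis (M.connAt p) e μ (fun _ => 0) ∧ (∀ i, μ i = 0 ∨ ∀ n : ℤ, (μ i).re ≠ n) ∧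
        ∀ i k, ∀ n : ℤ, n ≠ 0 → μ i - μ k ≠ n := by
  classical
  obtain ⟨r, e, μ, h1, h2, h3⟩ := h
  obtain ⟨f, hf⟩ := FormalDisc.exists_isNormalBasis (isConnection_connAt p) e μ (fun _ => 0)
    (fun i k n hn => by
      rw [connAt_apply, map_sub, map_smul, map_smul, e.repr_self, Finsupp.sub_apply,
        Finsupp.smul_apply, Finsupp.smul_apply, smul_eq_mul, smul_eq_mul, coeff_sub, coeff_t_mul,
        h1 _ _ _ (by omega), coeff_chr_mul, Finsupp.single_apply, zero_mul, add_zero]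
      by_cases hk : i = k
      · subst hk
        rw [if_pos rfl, coeff_one]
        by_cases h0 : n = 0
        · simp [h0]
        · rw [if_neg (by omega), if_neg h0]
          simp
      · rw [if_neg (fun h => hk h.1.symm), if_neg hk]
        simp) (fun i k _ => h3 i k)
  exact ⟨r, f, μ, hf, h2, h3⟩

/-- In the coordinate t = 1/x, the operator −x∂ has the matrix −A/t − C + O(t); hence the exponents
are μ = −C and γ = −A. -/
theorem _root_.HasRankOneLattice.exists_isNormalBasis {Ξ : Finset ℂ} (h : HasRankOneLattice M Ξ) :
    ∃ (r : ℕ) (e : Module.Basis (Fin r) discInfty.K (M.Completion discInfty)) (μ γ : Fin r → ℂ),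
      IsNormalBasis (M.connInfty 0) e μ γ ∧ (∀ i, -γ i ∈ Ξ) ∧ (∀ i, ∀ n : ℤ, (μ i).re ≠ n) ∧
        ∀ i k, γ i = γ k → ∀ n : ℤ, n ≠ 0 → μ i - μ k ≠ n := by
  classical
  obtain ⟨r, e, A, C, h1, h2, h3, h4⟩ := h
  have hres : ∀ i k, -A i = -A k → ∀ n : ℤ, n ≠ 0 → -C i - -C k ≠ n := fun i k hik n hn h =>
    h4 i k (neg_injective hik) (-n) (neg_ne_zero.2 hn) (by push_cast; linear_combination -h)
  obtain ⟨f, hf⟩ := FormalDisc.exists_isNormalBasis (isConnection_connInfty 0) e (fun i => -C i)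
    (fun i => -A i) (fun i k n hn => by
      rw [connInfty_apply, zero_smul, sub_zero, map_sub, map_smul, map_neg, map_smul, e.repr_self,
        Finsupp.sub_apply, Finsupp.neg_apply, Finsupp.smul_apply, Finsupp.smul_apply, smul_eq_mul,
        smul_eq_mul, coeff_sub, coeff_neg, coeff_t_inv_mul, h1 _ _ _ (by omega), coeff_chr_mul,
        Finsupp.single_apply]
      by_cases hk : i = k
      · subst hk
        rw [if_pos rfl, coeff_one, coeff_one]
        by_cases h0 : n = 0
        · simp [h0]
        · by_cases h1 : n = -1
          · simp [h1]
          · rw [if_neg (by omega), if_neg (by omega), if_neg h0, if_neg (by omega)]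
            simp
      · rw [if_neg (fun h => hk h.1.symm), if_neg (fun h => hk h.1.symm), if_neg hk]
        simp) hres
  refine ⟨r, f, _, _, hf, fun i => by rw [neg_neg]; exact h2 i, fun i n h => h3 i (-n) ?_, hres⟩
  rw [Complex.neg_re] at h
  push_cast
  linarith

theorem hasLogLattice_of_isNormalBasis {ι : Type*} [Fintype ι] {p : ℂ}
    {e : Module.Basis ι (discAt p).K (M.Completion (discAt p))} {μ : ι → ℂ}
    (he : IsNormalBasis (M.connAt p) e μ (fun _ => 0))
    (h1 : ∀ i, μ i = 0 ∨ ∀ n : ℤ, (μ i).re ≠ n)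
    (h2 : ∀ i k, ∀ n : ℤ, n ≠ 0 → μ i - μ k ≠ n) : HasLogLattice M p := by
  classical
  let E := Fintype.equivFin ι
  refine ⟨_, e.reindex E, fun i => μ (E.symm i), fun i k n _ => ?_, fun i => h1 _,
    fun i k => h2 _ _⟩
  have h3 : M.nabla (discAt p) (e (E.symm i)) =
      ((discAt p).t⁻¹ * (discAt p).chr (μ (E.symm i)) 0) • e (E.symm i) := by
    rw [mul_smul, ← he, connAt_apply, smul_smul, inv_mul_cancel₀ (t_ne_zero _), one_smul]
  rw [Module.Basis.reindex_apply, h3, map_smul, ← Module.Basis.reindex_apply,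
    Module.Basis.repr_self, Finsupp.smul_apply, smul_eq_mul, mul_assoc, coeff_t_inv_mul,
    coeff_chr_mul, zero_mul, add_zero, Finsupp.single_apply]
  by_cases hk : i = k
  · subst hk
    rw [if_pos rfl, coeff_one]
    by_cases hn : n = -1
    · simp [hn]
    · rw [if_neg (by omega), if_neg (by omega), mul_zero]
  · rw [if_neg hk, if_neg (fun h => hk h.1.symm)]
    simp

theorem hasRankOneLattice_of_isNormalBasis {ι : Type*} [Fintype ι] {Ξ : Finset ℂ}
    {e : Module.Basis ι discInfty.K (M.Completion discInfty)} {μ γ : ι → ℂ}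
    (he : IsNormalBasis (M.connInfty 0) e μ γ) (h1 : ∀ i, -γ i ∈ Ξ)
    (h2 : ∀ i, ∀ n : ℤ, (μ i).re ≠ n)
    (h3 : ∀ i k, γ i = γ k → ∀ n : ℤ, n ≠ 0 → μ i - μ k ≠ n) : HasRankOneLattice M Ξ := by
  classical
  let E := Fintype.equivFin ι
  refine ⟨_, e.reindex E, fun i => -γ (E.symm i), fun i => -μ (E.symm i), fun i k n _ => ?_,
    fun i => h1 _, fun i n h => h2 (E.symm i) (-n) ?_, fun i k hik n hn h =>
      h3 (E.symm i) (E.symm k) (neg_injective hik) (-n) (neg_ne_zero.2 hn) ?_⟩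
  · have h3 : M.nabla discInfty (e (E.symm i)) =
        -((discInfty.t * discInfty.chr (μ (E.symm i)) (γ (E.symm i))) • e (E.symm i)) := by
      rw [mul_smul, ← he, connInfty_apply, smul_neg, zero_smul, sub_zero, smul_smul,
        mul_inv_cancel₀ (t_ne_zero _), one_smul, neg_neg]
    rw [Module.Basis.reindex_apply, h3, map_neg, map_smul, ← Module.Basis.reindex_apply,
      Module.Basis.repr_self, Finsupp.neg_apply, Finsupp.smul_apply, smul_eq_mul, mul_assoc,
      coeff_neg, coeff_t_mul, coeff_chr_mul, Finsupp.single_apply]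
    by_cases hk : i = k
    · subst hk
      rw [if_pos rfl, coeff_one, coeff_one]
      by_cases hn : n = 0
      · simp [hn]
      · by_cases hn1 : n = 1
        · simp [hn1]
        · rw [if_neg (by omega), if_neg (by omega), if_neg (by tauto), if_neg (by tauto)]
          simp
    · rw [if_neg hk, if_neg (fun h => hk h.1.symm), if_neg (fun h => hk h.1.symm)]
      simp
  · rw [Complex.neg_re] at h
    push_cast
    linarith
  · push_cast
    linear_combination -h

/-! ### Torsion -/

theorem dPoly_smul (q : ℂ[X]) (m : M.poly) :
    M.dPoly (q • m) = Polynomial.derivative q • m + q • M.dPoly m := by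
  induction q using Polynomial.induction_on' generalizing m with
  | add p q hp hq =>
    rw [add_smul, map_add, hp, hq, map_add, add_smul, add_smul]
    abel
  | monomial n c =>
    induction n generalizing m with
    | zero =>
      have h (b : M.poly) : (Polynomial.monomial 0 c : ℂ[X]) • b = c • b := by
        rw [Polynomial.monomial_zero_left, Polynomial.C_eq_algebraMap, algebraMap_smul]
      rw [h, h, Polynomial.monomial_zero_left, Polynomial.derivative_C, zero_smul, zero_add,
        map_smul]
    | succ n ih =>
      rw [← Polynomial.monomial_mul_X, mul_smul, ih, dPoly_X_smul, Polynomial.derivative_mul,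
        Polynomial.derivative_X, add_smul, mul_smul, mul_smul, mul_smul, one_smul, smul_add]
      abel

theorem aeval_X_sub_C (p : ℂ) :
    Polynomial.aeval M.x (Polynomial.X - Polynomial.C p) = M.x - p • 1 := by
  rw [map_sub, Polynomial.aeval_X, Polynomial.aeval_C, Algebra.algebraMap_eq_smul_one]

theorem isUnit_aeval_polePoly {P : Finset ℂ} (h : ∀ p ∈ P, IsUnit (M.x - p • 1)) :
    IsUnit (Polynomial.aeval M.x (polePoly P)) := by
  classical
  rw [polePoly]
  induction P using Finset.induction_on with
  | empty => simp
  | insert p s hp ih =>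
    rw [Finset.prod_insert hp, map_mul, aeval_X_sub_C]
    exact (h p (Finset.mem_insert_self p s)).mul
      (ih fun q hq => h q (Finset.mem_insert_of_mem hq))

theorem isUnit_of_isUnit_aeval_polePoly {P : Finset ℂ}
    (h : IsUnit (Polynomial.aeval M.x (polePoly P))) {p : ℂ} (hp : p ∈ P) :
    IsUnit (M.x - p • 1) := by
  classical
  rw [polePoly, ← Finset.mul_prod_erase _ _ hp] at h
  rw [← aeval_X_sub_C]
  have h' := h
  rw [map_mul] at h
  rw [mul_comm, map_mul] at h'
  rw [Module.End.isUnit_iff] at h h' ⊢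
  exact ⟨Function.Injective.of_comp h'.1, Function.Surjective.of_comp h.2⟩

theorem isTorsionFree_iff : Module.IsTorsionFree ℂ[X] M.poly ↔
    ∀ (q : ℂ[X]) (m : M.poly), q ≠ 0 → q • m = 0 → m = 0 := by
  rw [Module.isTorsionFree_iff_smul_eq_zero]
  constructor
  · intro h q m hq hm
    exact (h q m hm).resolve_left hq
  · intro h q m
    exact fun hm => or_iff_not_imp_left.2 fun hq => h q m hq hm

/-- A submodule stable under `∂` and killed by a non-zero polynomial vanishes. -/
theorem eq_zero_of_smul_eq_zero (T : Set M.poly) (hT : ∀ m ∈ T, M.dPoly m ∈ T) (q : ℂ[X])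
    (hq : q ≠ 0) (h : ∀ m ∈ T, q • m = 0) : ∀ m ∈ T, m = 0 := by
  induction hn : q.natDegree using Nat.strong_induction_on generalizing q with
  | _ n ih =>
    by_cases h0 : q.natDegree = 0
    · rw [Polynomial.eq_C_of_natDegree_eq_zero h0] at hq h
      intro m hm
      have h1 := h m hm
      rw [Polynomial.C_eq_algebraMap, algebraMap_smul] at h1
      exact (smul_eq_zero.1 h1).resolve_left fun h2 => hq (by rw [h2, Polynomial.C_0])
    -- Both m and ∂m are killed by q, so differentiating q m = 0 gives q' m = 0, and the degree
    -- drops.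
    · refine ih _ ?_ (Polynomial.derivative q) ?_ (fun m hm => ?_) rfl
      · rw [← hn]
        exact Polynomial.natDegree_derivative_lt h0
      · intro h1
        exact h0 (Polynomial.derivative_eq_zero.1 h1)
      · have h1 := M.dPoly_smul q m
        rw [h m hm, map_zero, h _ (hT m hm), add_zero] at h1
        exact h1.symm

/-- The torsion is stable under ∂, and finiteness up to localization provides one non-zero
polynomial killing all of it. Differentiating that polynomial down to a constant shows that the
torsion vanishes. -/
theorem isTorsionFree_of_finite {P : Finset ℂ} (hu : IsUnit (Polynomial.aeval M.x (polePoly P)))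
    (hf : ∃ L : Submodule ℂ[X] M.poly, L.FG ∧ ∀ m : M.poly, ∃ k : ℕ, (polePoly P ^ k) • m ∈ L) :
    Module.IsTorsionFree ℂ[X] M.poly := by
  classical
  obtain ⟨L, hL, hL'⟩ := hf
  let T := Submodule.torsion ℂ[X] M.poly
  have hTL : (T ⊓ L).FG := by
    have : IsNoetherian ℂ[X] L := isNoetherian_of_fg_of_noetherian L hL
    have h := (IsNoetherian.noetherian ((T ⊓ L).comap L.subtype)).map L.subtype
    rwa [Submodule.map_comap_subtype, inf_comm L, inf_assoc, inf_idem] at h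
  have key : ∃ q : ℂ[X], q ≠ 0 ∧ ∀ m ∈ T ⊓ L, q • m = 0 := by
    obtain ⟨s, hs⟩ := hTL
    have hex : ∀ m : s, ∃ q : ℂ[X], q ≠ 0 ∧ q • (m : M.poly) = 0 := by
      intro m
      have hm : (m : M.poly) ∈ T := (hs ▸ Submodule.subset_span m.2 : (m : M.poly) ∈ T ⊓ L).1
      obtain ⟨a, ha⟩ := (Submodule.mem_torsion_iff _).1 hm
      exact ⟨a, nonZeroDivisors.ne_zero a.2, ha⟩
    choose q hq0 hq using hex
    refine ⟨∏ m, q m, Finset.prod_ne_zero_iff.2 fun m _ => hq0 m, fun m hm => ?_⟩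
    rw [← hs] at hm
    induction hm using Submodule.span_induction with
    | mem x hx =>
      rw [← Finset.prod_erase_mul _ _ (Finset.mem_univ (⟨x, hx⟩ : s)), mul_smul, hq, smul_zero]
    | zero => rw [smul_zero]
    | add x y _ _ hx hy => rw [smul_add, hx, hy, add_zero]
    | smul a x _ hx => rw [smul_comm, hx, smul_zero]
  obtain ⟨q, hq0, hq⟩ := key
  have hinj (k : ℕ) (m : M.poly) (h : polePoly P ^ k • m = 0) : m = 0 := by
    have hk := (Module.End.isUnit_iff _).1 (hu.pow k)
    rw [← map_pow] at hk
    obtain ⟨m, rfl⟩ := M.toPoly.surjective m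
    rw [smul_toPoly, map_eq_zero_iff _ M.toPoly.injective] at h
    rw [hk.1 (h.trans (map_zero _).symm), map_zero]
  have hqT : ∀ m ∈ T, q • m = 0 := fun m hm => by
    obtain ⟨k, hk⟩ := hL' m
    have := hq _ ⟨T.smul_mem _ hm, hk⟩
    rw [smul_comm] at this
    exact hinj k _ this
  have hTd : ∀ m ∈ T, M.dPoly m ∈ T := by
    intro m hm
    obtain ⟨a, ha⟩ := (Submodule.mem_torsion_iff _).1 hm
    -- From a m = 0 follows a' m + a ∂m = 0; a second factor a kills the first term.
    refine (Submodule.mem_torsion_iff _).2 ⟨a * a, ?_⟩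
    have ha' : (a : ℂ[X]) • m = 0 := ha
    have h1 := congrArg M.dPoly ha'
    rw [dPoly_smul, map_zero] at h1
    have h2 := congrArg (fun w => (a : ℂ[X]) • w) h1
    simp only [smul_add, smul_zero] at h2
    rw [smul_comm, ha', smul_zero, zero_add] at h2
    change ((a : ℂ[X]) * a) • M.dPoly m = 0
    rw [mul_smul, h2]
  have hz := eq_zero_of_smul_eq_zero (T : Set M.poly) hTd q hq0 hqT
  rw [isTorsionFree_iff]
  intro r m hr hm
  exact hz m ((Submodule.mem_torsion_iff _).2 ⟨⟨r, mem_nonZeroDivisors_of_ne_zero hr⟩, hm⟩)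

/-- A module over `ℂ[x]` on which all `x - p` are injective is torsion-free. -/
theorem isTorsionFree_of_injective (h : ∀ p : ℂ, Function.Injective (M.x - p • 1 : Module.End ℂ M.carrier)) :
    Module.IsTorsionFree ℂ[X] M.poly := by
  rw [isTorsionFree_iff]
  intro q
  induction hn : q.natDegree generalizing q with
  | zero =>
    intro m hq hm
    rw [Polynomial.eq_C_of_natDegree_eq_zero hn] at hq hm
    rw [Polynomial.C_eq_algebraMap, algebraMap_smul] at hm
    exact (smul_eq_zero.1 hm).resolve_left fun h2 => hq (by rw [h2, Polynomial.C_0])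
  | succ n ih =>
    intro m hq hm
    obtain ⟨p, hp⟩ := IsAlgClosed.exists_root q (by
      rw [Polynomial.degree_eq_natDegree hq, hn]
      exact_mod_cast Nat.succ_ne_zero n)
    obtain ⟨r, rfl⟩ := Polynomial.dvd_iff_isRoot.2 hp
    have hr : r ≠ 0 := right_ne_zero_of_mul hq
    refine ih r ?_ m hr ?_
    · rw [Polynomial.natDegree_mul (Polynomial.X_sub_C_ne_zero p) hr,
        Polynomial.natDegree_X_sub_C] at hn
      omega
    · rw [mul_smul] at hm
      obtain ⟨w, hw⟩ := M.toPoly.surjective (r • m)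
      rw [← hw, smul_toPoly, aeval_X_sub_C, map_eq_zero_iff _ M.toPoly.injective] at hm
      rw [← hw, h p (hm.trans (map_zero _).symm), map_zero]

end WeylModule

namespace WeylModule

variable {M N N' A B : WeylModule.{u}}

/-! ### Submodules, saturation and minimal extensions -/

theorem d_aeval (q : ℂ[X]) (m : M.carrier) : M.d (Polynomial.aeval M.x q m) =
    Polynomial.aeval M.x (Polynomial.derivative q) m + Polynomial.aeval M.x q (M.d m) := by
  have h := M.dPoly_smul q (M.toPoly m)
  rw [smul_toPoly, smul_toPoly, dPoly_toPoly, dPoly_toPoly, smul_toPoly, ← map_add] at h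
  exact M.toPoly.injective h

theorem Hom.map_aeval (f : Hom N M) (q : ℂ[X]) (n : N.carrier) :
    f.toLin (Polynomial.aeval N.x q n) = Polynomial.aeval M.x q (f.toLin n) := by
  have h := f.polyMap.map_smul q (N.toPoly n)
  rw [smul_toPoly, Hom.polyMap_toPoly, Hom.polyMap_toPoly, smul_toPoly] at h
  exact M.toPoly.injective h

theorem aeval_mul_apply (p q : ℂ[X]) (m : M.carrier) :
    Polynomial.aeval M.x (p * q) m = Polynomial.aeval M.x p (Polynomial.aeval M.x q m) := by
  rw [map_mul, Module.End.mul_apply]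

theorem IsSub.aeval_mem {S : Submodule ℂ M.carrier} (hS : M.IsSub S) (q : ℂ[X]) {m : M.carrier}
    (hm : m ∈ S) : Polynomial.aeval M.x q m ∈ S := by
  induction q using Polynomial.induction_on' with
  | add p q hp hq =>
    rw [map_add]
    exact S.add_mem hp hq
  | monomial n c =>
    rw [Polynomial.aeval_monomial, Module.End.mul_apply, Module.algebraMap_end_apply]
    refine S.smul_mem _ ?_
    induction n with
    | zero => exact hm
    | succ n ih =>
      rw [pow_succ', Module.End.mul_apply]
      exact (hS _ ih).1

/-- The elements sent to `S` by a power of `q`. -/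
noncomputable def sat (M : WeylModule.{u}) (q : ℂ[X]) {S : Submodule ℂ M.carrier}
    (hS : M.IsSub S) : Submodule ℂ M.carrier where
  carrier := {m | ∃ k : ℕ, Polynomial.aeval M.x (q ^ k) m ∈ S}
  add_mem' := by
    rintro m m' ⟨k, hk⟩ ⟨l, hl⟩
    refine ⟨k + l, ?_⟩
    rw [map_add]
    refine S.add_mem ?_ ?_
    · rw [add_comm, pow_add, aeval_mul_apply]
      exact hS.aeval_mem _ hk
    · rw [pow_add, aeval_mul_apply]
      exact hS.aeval_mem _ hl
  zero_mem' := ⟨0, by rw [map_zero]; exact S.zero_mem⟩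
  smul_mem' := by
    rintro c m ⟨k, hk⟩
    exact ⟨k, by rw [map_smul]; exact S.smul_mem c hk⟩

theorem isSub_sat (q : ℂ[X]) {S : Submodule ℂ M.carrier} (hS : M.IsSub S) :
    M.IsSub (M.sat q hS) := by
  rintro m ⟨k, hk⟩
  refine ⟨⟨k, ?_⟩, ⟨k + 1, ?_⟩⟩
  · have h := hS.aeval_mem Polynomial.X hk
    rwa [← aeval_mul_apply, mul_comm, aeval_mul_apply, Polynomial.aeval_X] at h
  -- Commuting ∂ past q^(k+1) leaves a term still divisible by q^k, hence the additional power.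
  · have h := M.d_aeval (q ^ (k + 1)) m
    rw [← sub_eq_iff_eq_add'] at h
    rw [← h]
    refine S.sub_mem (hS _ ?_).2 ?_
    · rw [pow_succ', aeval_mul_apply]
      exact hS.aeval_mem q hk
    · rw [Polynomial.derivative_pow_succ, mul_assoc, mul_comm, mul_assoc, mul_comm,
        aeval_mul_apply]
      exact hS.aeval_mem _ hk

theorem isSub_bot : M.IsSub ⊥ := by
  intro s hs
  rw [Submodule.mem_bot] at hs
  simp [hs]

theorem pow_sub_eq_aeval (p : ℂ) (k : ℕ) : (M.x - p • 1 : Module.End ℂ M.carrier) ^ k =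
    Polynomial.aeval M.x ((Polynomial.X - Polynomial.C p) ^ k) := by
  rw [map_pow, aeval_X_sub_C]

/-- The elements killed by some power of x − p, being the saturation of zero, form a submodule
supported at p. -/
theorem IsMinimalAt.injective {p : ℂ} (h : M.IsMinimalAt p) :
    Function.Injective (M.x - p • 1 : Module.End ℂ M.carrier) := by
  rw [injective_iff_map_eq_zero]
  intro m hm
  have hb := h.no_sub (M.sat (Polynomial.X - Polynomial.C p) isSub_bot) (isSub_sat _ _) (by
    rintro s ⟨k, hk⟩
    exact ⟨k, by rw [pow_sub_eq_aeval]; exact hk⟩)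
  have : m ∈ M.sat (Polynomial.X - Polynomial.C p) isSub_bot :=
    ⟨1, by rw [← pow_sub_eq_aeval, pow_one, hm]; exact Submodule.zero_mem _⟩
  rwa [hb] at this

/-- The points are removed one at a time: once S is saturated at the other points, the quotient is
supported at p, so the saturation is everything. -/
theorem eq_top_of_isMinimalAt (h : ∀ p, M.IsMinimalAt p) (P : Finset ℂ)
    {S : Submodule ℂ M.carrier} (hS : M.IsSub S)
    (hP : ∀ m, ∃ k : ℕ, Polynomial.aeval M.x (polePoly P ^ k) m ∈ S) : S = ⊤ := by
  classical
  induction P using Finset.induction_on generalizing S with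
  | empty =>
    rw [Submodule.eq_top_iff']
    intro m
    obtain ⟨k, hk⟩ := hP m
    simpa [polePoly] using hk
  | insert p s hp ih =>
    have h1 : M.sat (polePoly s) hS = ⊤ := by
      refine (h p).no_quot _ (isSub_sat _ _) fun m => ?_
      obtain ⟨k, hk⟩ := hP m
      refine ⟨k, k, ?_⟩
      rw [pow_sub_eq_aeval, ← aeval_mul_apply, ← mul_pow]
      rwa [polePoly, Finset.prod_insert hp, mul_comm] at hk
    refine ih hS fun m => ?_
    have : m ∈ M.sat (polePoly s) hS := h1 ▸ Submodule.mem_top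
    exact this

section MinimalExtension

variable {P : Finset ℂ} {j : Hom N M}

/-- The kernel of a localization consists of torsion, which minimality at all points excludes. -/
theorem _root_.IsMinimalExtension.injective (h : IsMinimalExtension P j) :
    Function.Injective j.toLin := by
  have := isTorsionFree_of_injective fun p => (h.isMinimalAt p).injective
  rw [injective_iff_map_eq_zero]
  intro n hn
  obtain ⟨k, hk⟩ := IsExtension.exists_ker h.isExtension hn
  have h1 := isTorsionFree_iff.1 this (polePoly P ^ k) (N.toPoly n)
    (pow_ne_zero _ (polePoly_ne_zero P)) (by rw [smul_toPoly, hk, map_zero])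
  rwa [map_eq_zero_iff _ N.toPoly.injective] at h1

/-- A minimal extension is contained in every extension. -/
theorem _root_.IsMinimalExtension.exists_eq (h : IsMinimalExtension P j) {j' : Hom N' M}
    (h' : IsExtension P j') (n : N.carrier) : ∃ n', j'.toLin n' = j.toLin n := by
  -- The part of `N` contained in `N'` has a quotient supported in P, so by minimality it is all of
  -- `N`.
  let S : Submodule ℂ N.carrier := (LinearMap.range j'.toLin).comap j.toLin
  have hS : N.IsSub S := by
    rintro n ⟨n', hn'⟩
    exact ⟨⟨N'.x n', by rw [j'.map_x, hn', j.map_x]⟩, ⟨N'.d n', by rw [j'.map_d, hn', j.map_d]⟩⟩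
  have : S = ⊤ := by
    refine eq_top_of_isMinimalAt h.isMinimalAt P hS fun n => ?_
    obtain ⟨k, n', hk⟩ := IsExtension.exists_eq h' (j.toLin n)
    exact ⟨k, n', by rw [j.map_aeval, hk]⟩
  have hn : n ∈ S := this ▸ Submodule.mem_top
  exact hn

/-- Minimal extensions are unique. -/
theorem _root_.IsMinimalExtension.exists_iso (h : IsMinimalExtension P j) {j' : Hom N' M}
    (h' : IsMinimalExtension P j') :
    ∃ w : Hom N N', Function.Bijective w.toLin ∧ ∀ n, j'.toLin (w.toLin n) = j.toLin n := by
  choose f hf using h.exists_eq h'.isExtension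
  have hi := h'.injective
  refine ⟨{ toLin :=
              { toFun := f
                map_add' := fun n m => hi (by rw [map_add, hf, hf, hf, map_add])
                map_smul' := fun c n => hi (by rw [RingHom.id_apply, map_smul, hf, hf, map_smul]) }
            map_x := fun n => hi ((hf _).trans ?_)
            map_d := fun n => hi ((hf _).trans ?_) }, ⟨fun n m hnm => ?_, fun n' => ?_⟩, hf⟩
  · rw [j.map_x, j'.map_x]
    exact congrArg _ (hf n).symm
  · rw [j.map_d, j'.map_d]
    exact congrArg _ (hf n).symm
  · exact h.injective (by rw [← hf, ← hf]; exact congrArg _ hnm)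
  · obtain ⟨n, hn⟩ := h'.exists_eq h.isExtension n'
    exact ⟨n, hi ((hf n).trans hn)⟩

end MinimalExtension

/-! ### Laplace transforms are minimal -/

/-- Taylor coefficients of locally nilpotent operators: the image of `X` contains no horizontal
elements. -/
theorem eq_zero_of_commutator {Q : Type*} [AddCommGroup Q] [Module ℂ Q] {X δ : Module.End ℂ Q}
    (hc : δ * X - X * δ = 1) (hnil : ∀ q, ∃ k : ℕ, (δ ^ k) q = 0) {q : Q} (h : δ (X q) = 0) :
    X q = 0 := by
  -- If δ(Xq) = 0, this identity turns δ^(k+1) q = 0 into δ^k q = 0, so nilpotency descends to q =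
  -- 0.
  have hk (k : ℕ) : δ ^ (k + 1) * X = X * δ ^ (k + 1) + (k + 1 : ℂ) • δ ^ k := by
    have hc' : δ * X = X * δ + 1 := by rw [← hc]; abel
    induction k with
    | zero => simp [hc']
    | succ k ih =>
      rw [pow_succ' δ (k + 1), mul_assoc, ih, mul_add, ← mul_assoc, hc', mul_smul_comm, ← pow_succ',
        add_mul, one_mul, mul_assoc, add_assoc]
      congr 1
      push_cast
      rw [add_smul, one_smul, add_smul, one_smul, add_comm]
      module
  obtain ⟨K, hK⟩ := hnil q
  have key : ∀ k : ℕ, (δ ^ k) q = 0 → q = 0 := by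
    intro k
    induction k with
    | zero => intro h; simpa using h
    | succ k ih =>
      intro h1
      refine ih ?_
      have h2 := LinearMap.congr_fun (hk k) q
      rw [Module.End.mul_apply, pow_succ, Module.End.mul_apply, h, map_zero, ← pow_succ,
        LinearMap.add_apply, Module.End.mul_apply, h1, map_zero, zero_add, LinearMap.smul_apply] at h2
      exact (smul_eq_zero.1 h2.symm).resolve_left (by exact_mod_cast Nat.succ_ne_zero k)
  rw [key K hK, map_zero]

/-- The truncated k − 1 is harmless at k = 0, where its coefficient vanishes. -/
theorem d_pow_x (M : WeylModule.{u}) (ξ : ℂ) (k : ℕ) (m : M.carrier) :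
    ((M.d - ξ • 1 : Module.End ℂ M.carrier) ^ k) (M.x m) =
      M.x (((M.d - ξ • 1 : Module.End ℂ M.carrier) ^ k) m) +
        (k : ℂ) • ((M.d - ξ • 1 : Module.End ℂ M.carrier) ^ (k - 1)) m := by
  induction k with
  | zero => simp
  | succ k ih =>
    rw [pow_succ', Module.End.mul_apply, ih, map_add, map_smul, ← Module.End.mul_apply,
      Module.End.mul_apply]
    have h (m : M.carrier) : (M.d - ξ • 1 : Module.End ℂ M.carrier) (M.x m) =
        m + M.x ((M.d - ξ • 1 : Module.End ℂ M.carrier) m) := by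
      simp only [LinearMap.sub_apply, LinearMap.smul_apply, Module.End.one_apply, d_x_apply, map_sub,
        map_smul]
      abel
    rw [h, Nat.add_sub_cancel, Module.End.mul_apply]
    rcases k with _ | k
    · simp; abel
    · rw [Nat.add_sub_cancel, ← Module.End.mul_apply _ (_ ^ k), ← pow_succ']
      push_cast
      module

/-- The exponents at infinity are not integers. -/
def HasNonintegralExponents (M : WeylModule.{u}) : Prop :=
  ∃ (r : ℕ) (e : Module.Basis (Fin r) discInfty.K (M.Completion discInfty)) (μ γ : Fin r → ℂ),
    IsNormalBasis (M.connInfty 0) e μ γ ∧ ∀ i, ∀ n : ℤ, μ i ≠ n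

theorem HasNonintegralExponents.psiInfty_eq_bot (h : HasNonintegralExponents M) (ξ : ℂ) (n : ℤ) :
    M.psiInfty ξ n = ⊥ := by
  obtain ⟨r, e, μ, γ, he, hμ⟩ := h
  refine (he.twist ξ (connInfty_eq ξ)).maxGenEigenspace_eq_bot (isConnection_connInfty ξ)
    fun i _ m hm => hμ i (n - m) ?_
  push_cast
  linear_combination hm

theorem HasNonintegralExponents.horizontal_eq_zero (h : HasNonintegralExponents M) {ξ : ℂ}
    {g : M.Completion discInfty →ₗ[discInfty.K] discInfty.K} (hg : IsHorizontalInfty M ξ 0 g) :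
    g = 0 := by
  obtain ⟨r, e, μ, γ, he, hμ⟩ := h
  have hb := (he.twist ξ (connInfty_eq ξ)).horizontal_eq_bot (α := 0) fun i _ n hn => hμ i n (by
    rw [hn, add_zero])
  have := isHorizontalInfty_iff.1 hg
  rwa [hb] at this

section Laplace

variable {ε : ℤ} {c : N.carrier ≃ₗ[ℂ] N'.carrier} {P : Finset ℂ} {a : Hom N A}
  (hd : IsDualPair ε N N' c) (hA : HasNonintegralExponents A)
  [Module.IsTorsionFree ℂ[X] A.poly]
include hA

/-- There are no horizontal sections. -/
theorem d_sub_injective (ha : Function.Injective a.toLin) (ξ : ℂ) :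
    Function.Injective (N.d - ξ • 1 : Module.End ℂ N.carrier) := by
  rw [injective_iff_map_eq_zero]
  intro n hn
  rw [LinearMap.sub_apply, LinearMap.smul_apply, Module.End.one_apply, sub_eq_zero] at hn
  -- A section with ∂n = ξn has exponent 0 in the component ξ at infinity, where integral
  -- eigenspaces vanish; torsion-freeness then gives n = 0 in `A` itself.
  have h1 : A.connInfty ξ (A.toCompletion discInfty (a.toLin n)) = 0 := by
    rw [connInfty_apply, ← toCompletion_d isRegular_discInfty, ← a.map_d, hn, map_smul,
      toCompletion_smul, sub_self, smul_zero, neg_zero]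
  have h2 : A.toCompletion discInfty (a.toLin n) ∈ A.psiInfty ξ (0 : ℤ) := by
    refine (Module.End.mem_maxGenEigenspace _ _ _).2 ⟨1, ?_⟩
    have h2 (v : A.Completion discInfty) : (A.connInfty ξ - ((0 : ℤ) : ℂ) • 1 : Module.End ℂ _) v =
      A.connInfty ξ v - ((0 : ℤ) : ℂ) • v := rfl
    rw [pow_one, h2, h1, Int.cast_zero, zero_smul, sub_zero]
  rw [hA.psiInfty_eq_bot, Submodule.mem_bot] at h2
  have h3 : A.toCompletion discInfty (a.toLin n) = A.toCompletion discInfty 0 := by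
    rw [h2, toCompletion, map_zero, TensorProduct.tmul_zero]
  have h4 := toCompletion_injective isRegular_discInfty h3
  exact ha (h4.trans (map_zero _).symm)

include hd in
theorem x_sub_injective_of_dual (ha : Function.Injective a.toLin) (ζ : ℂ) :
    Function.Injective (N'.x - ζ • 1 : Module.End ℂ N'.carrier) := by
  rw [injective_iff_map_eq_zero]
  intro n hn
  obtain ⟨m, rfl⟩ := c.surjective n
  have h := d_sub_injective hA ha (ε * ζ)
  rw [injective_iff_map_eq_zero] at h
  rw [h m ?_, map_zero]
  refine c.injective ?_
  rw [LinearMap.sub_apply, LinearMap.smul_apply, Module.End.one_apply] at hn ⊢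
  rw [sub_eq_zero] at hn
  rw [map_sub, hd.map_d, map_smul, hn, map_zero, smul_smul, sub_self]

omit [Module.IsTorsionFree ℂ[X] A.poly] in
/-- There are no quotients with a non-zero horizontal section. -/
theorem eq_top_of_locally_nilpotent (ha : IsExtension P a) (ξ : ℂ) {S : Submodule ℂ N.carrier}
    (hS : N.IsSub S) (h : ∀ n, ∃ k : ℕ, ((N.d - ξ • 1 : Module.End ℂ N.carrier) ^ k) n ∈ S) :
    S = ⊤ := by
  classical
  let δ : Module.End ℂ N.carrier := N.d - ξ • 1
  have hδS : S ≤ S.comap δ := fun s hs => S.sub_mem (hS s hs).2 (S.smul_mem ξ hs)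
  let X' : Module.End ℂ (N.carrier ⧸ S) := S.mapQ S N.x fun s hs => (hS s hs).1
  let δ' : Module.End ℂ (N.carrier ⧸ S) := S.mapQ S δ hδS
  have hX' (n : N.carrier) : X' (S.mkQ n) = S.mkQ (N.x n) := rfl
  have hδ' (n : N.carrier) : δ' (S.mkQ n) = S.mkQ (δ n) := rfl
  have hδk (k : ℕ) (n : N.carrier) : (δ' ^ k) (S.mkQ n) = S.mkQ ((δ ^ k) n) := by
    induction k generalizing n with
    | zero => rfl
    | succ k ih => rw [pow_succ, Module.End.mul_apply, hδ', ih, pow_succ, Module.End.mul_apply]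
  have hc : δ' * X' - X' * δ' = 1 := by
    refine LinearMap.ext fun q => ?_
    obtain ⟨n, rfl⟩ := S.mkQ_surjective q
    rw [LinearMap.sub_apply, Module.End.mul_apply, Module.End.mul_apply, hX', hδ', hδ', hX',
      ← map_sub, Module.End.one_apply]
    have := N.d_pow_x ξ 1 n
    simp only [pow_one, Nat.cast_one, one_smul, Nat.sub_self, pow_zero, Module.End.one_apply] at this
    congr 1
    rw [show δ (N.x n) = N.x (δ n) + n from this]
    abel
  have hnil : ∀ q, ∃ k : ℕ, (δ' ^ k) q = 0 := by
    intro q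
    obtain ⟨n, rfl⟩ := S.mkQ_surjective q
    obtain ⟨k, hk⟩ := h n
    refine ⟨k, ?_⟩
    rw [hδk, Submodule.mkQ_apply, Submodule.Quotient.mk_eq_zero]
    exact hk
  by_contra hne
  obtain ⟨q₁, hq₁⟩ : ∃ q : N.carrier ⧸ S, q ≠ 0 := by
    by_contra! h0
    refine hne (Submodule.eq_top_iff'.2 fun n => ?_)
    have := h0 (S.mkQ n)
    rwa [Submodule.mkQ_apply, Submodule.Quotient.mk_eq_zero] at this
  -- The last non-zero iterate of δ' on a non-zero element is horizontal.
  obtain ⟨q, hq, hδq⟩ : ∃ q : N.carrier ⧸ S, q ≠ 0 ∧ δ' q = 0 := by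
    have hex := hnil q₁
    have hpos : Nat.find hex ≠ 0 := fun h0 => hq₁ (by simpa [h0] using Nat.find_spec hex)
    obtain ⟨k, hk⟩ := Nat.exists_eq_succ_of_ne_zero hpos
    refine ⟨(δ' ^ k) q₁, Nat.find_min hex (by omega), ?_⟩
    rw [← Module.End.mul_apply, ← pow_succ', ← Nat.succ_eq_add_one, ← hk]
    exact Nat.find_spec hex
  have hqX : q ∉ LinearMap.range X' := by
    rintro ⟨q', rfl⟩
    exact hq (eq_zero_of_commutator hc hnil hδq)
  -- A functional that kills the image of X but not q plays the role of evaluation at x = 0.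
  obtain ⟨φ, hφq, hφX⟩ := Submodule.exists_dual_map_eq_bot_of_notMem hqX inferInstance
  have hφX' (n : N.carrier) : φ (S.mkQ (N.x n)) = 0 := by
    have h1 : φ (X' (S.mkQ n)) ∈ (LinearMap.range X').map φ :=
      Submodule.mem_map_of_mem ⟨_, rfl⟩
    rwa [hφX, Submodule.mem_bot] at h1
  -- Taylor coefficients at x = 0. Local nilpotency makes the series polynomial in x, so it lies in
  -- ℂ((1/x)), with the m-th term in order −m.
  let cf : N.carrier → ℤ → ℂ := fun n m => (m.toNat.factorial : ℂ)⁻¹ * φ (S.mkQ ((δ ^ m.toNat) n))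
  have hcf (n : N.carrier) (K : ℕ) (hK : (δ ^ K) n ∈ S) (m : ℕ) (hm : K ≤ m) : cf n m = 0 := by
    obtain ⟨l, rfl⟩ := Nat.exists_eq_add_of_le' hm
    have h1 : (δ ^ (l + K)) n ∈ S := by
      rw [pow_add, Module.End.mul_apply]
      generalize (δ ^ K) n = s at hK
      induction l generalizing s with
      | zero => exact hK
      | succ l ih =>
        rw [pow_succ, Module.End.mul_apply]
        exact ih (by omega) _ (hδS hK)
    simp only [cf, Int.toNat_natCast]
    rw [Submodule.mkQ_apply, (Submodule.Quotient.mk_eq_zero S).2 h1, map_zero, mul_zero]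
  choose K hK using h
  let F : N.carrier → discInfty.K := fun n =>
    discInfty.ofFun (fun m => if m ≤ 0 then cf n (-m) else 0) (-K n)
  have hF (n : N.carrier) (m : ℤ) : discInfty.coeff (F n) m = if m ≤ 0 then cf n (-m) else 0 := by
    simp only [F, coeff_ofFun]
    split_ifs with h1 h2
    · obtain ⟨l, hl⟩ := Int.eq_ofNat_of_zero_le (show 0 ≤ -m by omega)
      rw [hl]
      exact (hcf n (K n) (hK n) l (by omega)).symm
    · rfl
    · rfl
    · rfl
  let f : N.carrier →ₗ[ℂ] discInfty.K :=
    { toFun := F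
      map_add' := fun n n' => coeff_ext fun m => by
        rw [coeff_add, hF, hF, hF]
        split_ifs
        · simp only [cf, map_add]; ring
        · simp
      map_smul' := fun r n => coeff_ext fun m => by
        rw [RingHom.id_apply, coeff_smul, hF, hF]
        split_ifs
        · simp only [cf, map_smul, smul_eq_mul]; ring
        · simp }
  have hsol : IsSolution N discInfty (algebraMap ℂ discInfty.K ξ - (0 : ℂ) • discInfty.t) f := by
    constructor
    · intro n
      refine coeff_ext fun m => ?_
      rw [discInfty_zK, coeff_t_inv_mul]
      change discInfty.coeff (F _) m = discInfty.coeff (F n) (m + 1)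
      rw [hF, hF]
      rcases lt_trichotomy m 0 with h1 | rfl | h1
      · obtain ⟨l, rfl⟩ : ∃ l : ℕ, m = -(l + 1 : ℕ) := ⟨(-m - 1).toNat, by omega⟩
        rw [if_pos (by omega), if_pos (by omega),
          show -(-((l + 1 : ℕ) : ℤ) + 1) = (l : ℤ) by push_cast; ring, neg_neg]
        simp only [cf, Int.toNat_natCast]
        have h2 : (δ ^ (l + 1)) (N.x n) = _ := N.d_pow_x ξ (l + 1) n
        rw [h2, map_add, map_add, hφX', zero_add, Nat.add_sub_cancel, map_smul, map_smul,
          smul_eq_mul, Nat.factorial_succ, ← mul_assoc]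
        congr 1
        have h3 : ((l : ℂ) + 1) ≠ 0 := by exact_mod_cast Nat.succ_ne_zero l
        push_cast
        field_simp
      · rw [if_pos le_rfl, if_neg (by norm_num)]
        have := hφX' n
        simpa [cf] using this
      · rw [if_neg (by omega), if_neg (by omega)]
    · intro n
      have h1 : N.d n = δ n + ξ • n := by
        simp [δ]
      rw [h1, map_add, map_smul, zero_smul, sub_zero, algebraMap_mul]
      congr 1
      refine coeff_ext fun m => ?_
      rw [coeff_discInfty_deriv]
      change discInfty.coeff (F _) m = -((m - 1) * discInfty.coeff (F n) (m - 1))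
      rw [hF, hF]
      rcases le_or_gt m 0 with h1 | h1
      · obtain ⟨l, rfl⟩ : ∃ l : ℕ, m = -(l : ℕ) := ⟨(-m).toNat, by omega⟩
        rw [if_pos (by omega), if_pos (by omega),
          show -(-(l : ℤ) - 1) = ((l + 1 : ℕ) : ℤ) by push_cast; ring, neg_neg]
        simp only [cf, Int.toNat_natCast]
        rw [pow_succ, Module.End.mul_apply, Nat.factorial_succ]
        have h3 : ((l : ℂ) + 1) ≠ 0 := by exact_mod_cast Nat.succ_ne_zero l
        push_cast
        field_simp
        ring
      · rw [if_neg (by omega)]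
        rcases (show 1 ≤ m by omega).eq_or_lt with rfl | h2
        · simp
        · rw [if_neg (by omega)]
          simp
  obtain ⟨g, hg, hg'⟩ := hsol.exists_lift isRegular_discInfty ha
  -- The exponent 0 is integral, so the functional must vanish, although its constant coefficient on
  -- a lift of q is φ(q) ≠ 0.
  have hg0 := hA.horizontal_eq_zero hg'
  obtain ⟨n, rfl⟩ := S.mkQ_surjective q
  have h1 := hg n
  rw [hg0, LinearMap.zero_apply] at h1
  have h2 : discInfty.coeff (F n) 0 = 0 := by
    change discInfty.coeff (f n) 0 = 0
    rw [← h1, coeff_zero]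
  rw [hF, if_pos le_rfl] at h2
  refine hφq ?_
  simpa [cf] using h2

include hd in
-- On the common space ∂ − εζ equals ε(x' − ζ). So support at ζ in the dual variable means local
-- nilpotency of ∂ − εζ on `N`, which is excluded for submodules and for quotients.
theorem isMinimalAt_of_dual (ha : IsExtension P a) (hinj : Function.Injective a.toLin) (ζ : ℂ) :
    N'.IsMinimalAt ζ where
  no_sub S _ h := by
    rw [Submodule.eq_bot_iff]
    intro s hs
    obtain ⟨k, hk⟩ := h s hs
    have hi := x_sub_injective_of_dual hd hA hinj ζ
    induction k with
    | zero => simpa using hk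
    | succ k ih =>
      refine ih (hi ?_)
      rw [← Module.End.mul_apply, ← pow_succ', hk, map_zero]
  no_quot S hS h := by
    have hε : (ε : ℂ) ≠ 0 := left_ne_zero_of_mul (hd.sq ▸ one_ne_zero)
    have hS' : N.IsSub (S.comap c.toLinearMap) := by
      intro n hn
      rw [Submodule.mem_comap, Submodule.mem_comap]
      exact ⟨(hd.map_x n).symm ▸ S.smul_mem _ (hS _ hn).2,
        (hd.map_d n).symm ▸ S.smul_mem _ (hS _ hn).1⟩
    have hk (k : ℕ) (n : N.carrier) : c (((N.d - ((ε : ℂ) * ζ) • 1 : Module.End ℂ N.carrier) ^ k) n) =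
        (ε : ℂ) ^ k • ((N'.x - ζ • 1 : Module.End ℂ N'.carrier) ^ k) (c n) := by
      induction k generalizing n with
      | zero => simp
      | succ k ih =>
        have e : c ((N.d - ((ε : ℂ) * ζ) • 1 : Module.End ℂ N.carrier) n) =
            (ε : ℂ) • (N'.x - ζ • 1 : Module.End ℂ N'.carrier) (c n) := by
          rw [LinearMap.sub_apply, LinearMap.sub_apply, LinearMap.smul_apply, LinearMap.smul_apply,
            Module.End.one_apply, Module.End.one_apply, map_sub, map_smul, hd.map_d, smul_sub,
            smul_smul]
        rw [pow_succ, Module.End.mul_apply, ih, e, map_smul, smul_smul, ← pow_succ,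
          pow_succ (N'.x - ζ • 1 : Module.End ℂ N'.carrier), Module.End.mul_apply]
    have := eq_top_of_locally_nilpotent hA ha (ε * ζ) hS' fun n => by
      obtain ⟨k, hn⟩ := h (c n)
      refine ⟨k, ?_⟩
      rw [Submodule.mem_comap]
      change c _ ∈ S
      rw [hk]
      exact S.smul_mem _ hn
    rw [Submodule.eq_top_iff'] at this ⊢
    intro n
    have h1 := this (c.symm n)
    rw [Submodule.mem_comap] at h1
    simpa using h1

end Laplace

end WeylModule

/-! ### The regular part of a bundle -/

namespace WeylModule

variable {M N N' A B : WeylModule.{u}}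

/-- A submodule, as a module over the Weyl algebra. -/
def ofSub (M : WeylModule.{u}) (S : Submodule ℂ M.carrier) (hS : M.IsSub S) : WeylModule.{u} where
  carrier := S
  x := M.x.restrict fun s hs => (hS s hs).1
  d := M.d.restrict fun s hs => (hS s hs).2
  comm := LinearMap.ext fun s => Subtype.ext (LinearMap.congr_fun M.comm s.1)

/-- The inclusion of a submodule. -/
def ofSubHom (M : WeylModule.{u}) (S : Submodule ℂ M.carrier) (hS : M.IsSub S) :
    Hom (M.ofSub S hS) M where
  toLin := S.subtype
  map_x _ := rfl
  map_d _ := rfl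

theorem mem_fil_of_pow {Δ : FormalDisc} {a : Δ.K} (ha : a ∈ Δ.fil 1) (k : ℕ) :
    a ^ k ∈ Δ.fil k := by
  induction k with
  | zero => simpa using algebraMap_mem_fil (Δ := Δ) 1
  | succ k ih =>
    rw [pow_succ, Nat.cast_succ]
    exact mul_mem_fil ih ha

theorem algebraMap_polePoly_mem {P : Finset ℂ} {p : ℂ} (hp : p ∈ P) :
    algebraMap ℂ[X] (discAt p).K (polePoly P) ∈ (discAt p).fil 1 := by
  refine mem_fil_of_succ (algebraMap_discAt_mem p _) ?_
  have h := coeff_algebraMap_discAt p (polePoly P) 0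
  rw [Nat.cast_zero, Polynomial.taylor_coeff_zero] at h
  rw [h, polePoly, Polynomial.eval_prod]
  exact Finset.prod_eq_zero hp (by simp)

theorem exists_nat_mem_fil {Δ : FormalDisc} (a : Δ.K) : ∃ k : ℕ, a ∈ Δ.fil (-k) := by
  obtain ⟨n, hn⟩ := exists_mem_fil a
  exact ⟨(-n).toNat, fil_antitone (by omega) hn⟩

/-- The elements which are regular for all horizontal functionals of exponent zero. -/
noncomputable def regularPart (M : WeylModule.{u}) (P : Finset ℂ) : Submodule ℂ M.carrier where
  carrier := {m | ∀ p ∈ P, ∀ h, IsHorizontalAt M p 0 h →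
    h (M.toCompletion (discAt p) m) ∈ (discAt p).fil 0}
  add_mem' hm hm' p hp h hh := by
    rw [toCompletion_add, map_add]
    exact Submodule.add_mem _ (hm p hp h hh) (hm' p hp h hh)
  zero_mem' p _ h _ := by
    rw [toCompletion, map_zero, TensorProduct.tmul_zero, map_zero]
    exact Submodule.zero_mem _
  smul_mem' c m hm p hp h hh := by
    rw [toCompletion_smul, LinearMap.map_smul_of_tower]
    exact Submodule.smul_mem _ c (hm p hp h hh)

/-- Functionals of exponent zero commute with d/dx, and d/dx preserves power series: the critical
coefficient of order −1 carries the factor 0. -/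
theorem isSub_regularPart (M : WeylModule.{u}) (P : Finset ℂ) : M.IsSub (M.regularPart P) := by
  refine fun m hm => ⟨fun p hp h hh => ?_, fun p hp h hh => ?_⟩
  · rw [toCompletion_x, map_smul, smul_eq_mul, discAt_zK]
    have h1 : algebraMap ℂ (discAt p).K p + (discAt p).t ∈ (discAt p).fil 0 := by
      refine Submodule.add_mem _ (algebraMap_mem_fil p) fun k hk => ?_
      have := coeff_t_zpow (discAt p) 1 k
      rw [zpow_one] at this
      rw [this, if_neg (by omega)]
    simpa using mul_mem_fil h1 (hm p hp h hh)
  · rw [toCompletion_d (isRegular_discAt p), hh, zero_smul, zero_mul, add_zero]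
    intro k hk
    rw [coeff_discAt_deriv]
    rcases (show k + 1 ≤ 0 by omega).lt_or_eq with h1 | h1
    · rw [hm p hp h hh _ h1, mul_zero]
    · have h2 : (k : ℂ) + 1 = 0 := by exact_mod_cast h1
      rw [h2, zero_mul]

/-- A functional of exponent zero is constant on the normal basis vectors of exponent zero and
vanishes on the others, whose exponents are not integers. So the poles of the coordinates of m bound
those of h(m), uniformly in h. -/
theorem _root_.HasLogLattice.exists_pole_bound {p : ℂ} (hM : HasLogLattice M p) (m : M.carrier) :
    ∃ k : ℕ, ∀ h, IsHorizontalAt M p 0 h →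
      h (M.toCompletion (discAt p) m) ∈ (discAt p).fil (-k) := by
  obtain ⟨r, e, μ, he, hμ, -⟩ := hM.exists_isNormalBasis
  choose k hk using fun i => exists_nat_mem_fil (e.repr (M.toCompletion (discAt p) m) i)
  refine ⟨∑ i, k i, fun h hh => ?_⟩
  rw [← e.sum_repr (M.toCompletion (discAt p) m), map_sum]
  refine Submodule.sum_mem _ fun i _ => ?_
  rw [map_smul, smul_eq_mul]
  have h1 : h (e i) ∈ (discAt p).fil 0 := by
    intro n hn
    by_contra h0
    obtain ⟨-, h2⟩ := he.coeff_apply_of_mem (isHorizontalAt_iff.1 hh) i n h0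
    rw [add_zero] at h2
    rcases hμ i with h3 | h3
    · rw [h3] at h2
      have : n = 0 := by exact_mod_cast h2.symm
      omega
    · exact h3 n (by rw [h2]; simp)
  refine fil_antitone ?_ (mul_mem_fil (hk i) h1)
  have := Finset.single_le_sum (f := k) (fun _ _ => Nat.zero_le _) (Finset.mem_univ i)
  omega

theorem isExtension_regularPart {P Ξ : Finset ℂ} (hM : IsMeromorphicBundle P Ξ M) :
    IsExtension P (M.ofSubHom (M.regularPart P) (M.isSub_regularPart P)) := by
  classical
  refine isExtension_of (isUnit_aeval_polePoly hM.invertible) (fun m => ?_)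
    (Subtype.val_injective)
  choose! k hk using fun p (hp : p ∈ P) => (hM.logarithmic p hp).exists_pole_bound m
  refine ⟨∑ p ∈ P, k p, ⟨_, fun p hp h hh => ?_⟩, rfl⟩
  change h (M.toCompletion (discAt p)
    (Polynomial.aeval M.x (polePoly P ^ ∑ p ∈ P, k p) m)) ∈ _
  rw [toCompletion_poly, map_smul, smul_eq_mul, map_pow]
  refine fil_antitone ?_ (mul_mem_fil (mem_fil_of_pow (algebraMap_polePoly_mem hp) _) (hk p hp h hh))
  have := Finset.single_le_sum (f := k) (fun _ _ => Nat.zero_le _) hp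
  omega

/-- A minimal extension is contained in every extension, in particular in the regular part. Apart
from injectivity this is all that `isMeromorphicBundle_of_dual` needs of minimality. -/
theorem _root_.IsMinimalExtension.regular {P Ξ : Finset ℂ} (hM : IsMeromorphicBundle P Ξ M)
    {j : Hom N M} (hj : IsMinimalExtension P j) (n : N.carrier) : j.toLin n ∈ M.regularPart P := by
  obtain ⟨n', hn'⟩ := hj.exists_eq (isExtension_regularPart hM) n
  rw [← hn']
  exact n'.2

/-! ### Localization -/

section Localize

variable (N) (P : Finset ℂ)

/-- The elements of the completion at infinity which are regular outside `P`. -/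
noncomputable def localizeCarrier : Submodule ℂ (N.Completion discInfty) where
  carrier := {v | ∃ (k : ℕ) (n : N.carrier),
    algebraMap ℂ[X] discInfty.K (polePoly P ^ k) • v = N.toCompletion discInfty n}
  add_mem' := by
    rintro v w ⟨k, n, hn⟩ ⟨l, m, hm⟩
    refine ⟨k + l, Polynomial.aeval N.x (polePoly P ^ l) n +
      Polynomial.aeval N.x (polePoly P ^ k) m, ?_⟩
    rw [toCompletion_add, toCompletion_poly, toCompletion_poly, ← hn, ← hm, smul_add, pow_add,
      map_mul, smul_smul, smul_smul, mul_comm]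
  zero_mem' := ⟨0, 0, by rw [smul_zero, toCompletion, map_zero, TensorProduct.tmul_zero]⟩
  smul_mem' := by
    rintro c v ⟨k, n, hn⟩
    exact ⟨k, c • n, by rw [toCompletion_smul, ← hn, smul_comm]⟩

theorem deriv_zK : discInfty.deriv discInfty.zK = 1 := by
  have h := discInfty.deriv_X_smul 1
  rwa [X_smul_eq, X_smul_eq, isRegular_discInfty.deriv_one, mul_zero, add_zero, mul_one] at h

variable {N P} in
theorem zK_smul_mem {v : N.Completion discInfty} (hv : v ∈ N.localizeCarrier P) :
    discInfty.zK • v ∈ N.localizeCarrier P := by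
  obtain ⟨k, n, hn⟩ := hv
  exact ⟨k, N.x n, by rw [toCompletion_x, ← hn, smul_comm]⟩

variable {N P} in
theorem nabla_mem {v : N.Completion discInfty} (hv : v ∈ N.localizeCarrier P) :
    N.nabla discInfty v ∈ N.localizeCarrier P := by
  obtain ⟨k, n, hn⟩ := hv
  set q := algebraMap ℂ[X] discInfty.K (polePoly P ^ k) with hq
  obtain ⟨r, hr⟩ : ∃ r : ℂ[X], discInfty.deriv q = algebraMap ℂ[X] discInfty.K r := by
    rw [hq]
    generalize polePoly P ^ k = s
    induction s using Polynomial.induction_on' with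
    | add f g hf hg =>
      obtain ⟨a, ha⟩ := hf
      obtain ⟨b, hb⟩ := hg
      exact ⟨a + b, by rw [map_add, map_add, ha, hb, map_add]⟩
    | monomial m c =>
      induction m with
      | zero =>
        refine ⟨0, ?_⟩
        rw [Polynomial.monomial_zero_left, algebraMap_C, Algebra.algebraMap_eq_smul_one, map_smul,
          isRegular_discInfty.deriv_one, smul_zero, map_zero]
      | succ m ih =>
        obtain ⟨a, ha⟩ := ih
        refine ⟨a * Polynomial.X + Polynomial.monomial m c, ?_⟩
        rw [← Polynomial.monomial_mul_X, map_mul, isRegular_discInfty.deriv_mul, ha, algebraMap_X,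
          deriv_zK, mul_one, map_add, map_mul, algebraMap_X]
  -- q² ∇v = q ∇(q v) − q' (q v), and q v comes from `N`.
  refine ⟨k + k, Polynomial.aeval N.x (polePoly P ^ k) (N.d n) - Polynomial.aeval N.x r n, ?_⟩
  have h1 := congrArg (N.nabla discInfty) hn
  rw [nabla_smul isRegular_discInfty, hr, ← toCompletion_d isRegular_discInfty] at h1
  have h2 : N.toCompletion discInfty (Polynomial.aeval N.x (polePoly P ^ k) (N.d n) -
      Polynomial.aeval N.x r n) = q • N.toCompletion discInfty (N.d n) -
        algebraMap ℂ[X] discInfty.K r • N.toCompletion discInfty n := by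
    rw [sub_eq_add_neg, ← neg_one_smul ℂ, toCompletion_add, toCompletion_smul, toCompletion_poly,
      toCompletion_poly,
      neg_one_smul ℂ (algebraMap ℂ[X] discInfty.K r • N.toCompletion discInfty n), ← hq,
      sub_eq_add_neg]
  rw [h2, ← h1, ← hn, smul_add, smul_smul, smul_smul, smul_smul, mul_comm q, add_sub_cancel_left,
    pow_add, map_mul]

/-- The meromorphic bundle induced by a torsion-free module, inside the completion at infinity. -/
noncomputable def localize : WeylModule.{u} where
  carrier := N.localizeCarrier P
  x := ((LinearMap.lsmul discInfty.K (N.Completion discInfty) discInfty.zK).restrictScalars ℂ).restrict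
    fun _ => zK_smul_mem
  d := (N.nabla discInfty).restrict fun _ => nabla_mem
  comm := by
    refine LinearMap.ext fun v => Subtype.ext ?_
    change discInfty.zK • N.nabla discInfty v.1 - N.nabla discInfty (discInfty.zK • v.1) = -v.1
    rw [nabla_smul isRegular_discInfty, deriv_zK, one_smul]
    abel

/-- The localization map. -/
noncomputable def localizeHom : Hom N (N.localize P) where
  toLin := (N.toCompletionC discInfty).codRestrict _ fun n => ⟨0, n, by
    rw [pow_zero, map_one, one_smul]
    rfl⟩
  map_x n := Subtype.ext (toCompletion_x n)
  map_d n := Subtype.ext (toCompletion_d isRegular_discInfty n)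

theorem localize_aeval (q : ℂ[X]) (v : (N.localize P).carrier) :
    (Polynomial.aeval (N.localize P).x q v).1 = algebraMap ℂ[X] discInfty.K q • v.1 := by
  induction q using Polynomial.induction_on' with
  | add p q hp hq =>
    rw [map_add, map_add, add_smul, ← hp, ← hq]
    rfl
  | monomial n c =>
    rw [Polynomial.aeval_monomial, Module.End.mul_apply, Module.algebraMap_end_apply]
    have h : ((((N.localize P).x ^ n) v).1 : N.Completion discInfty) = discInfty.zK ^ n • v.1 := by
      induction n with
      | zero => rw [pow_zero, pow_zero, one_smul]; rfl
      | succ n ih =>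
        rw [pow_succ', Module.End.mul_apply, pow_succ', mul_smul, ← ih]
        rfl
    rw [← Polynomial.C_mul_X_pow_eq_monomial, map_mul, map_pow, algebraMap_X, algebraMap_C, mul_smul,
      ← h, algebraMap_smul]
    rfl

theorem isExtension_localizeHom [Module.IsTorsionFree ℂ[X] N.poly] :
    IsExtension P (N.localizeHom P) := by
  have hq (k : ℕ) : algebraMap ℂ[X] discInfty.K (polePoly P ^ k) ≠ 0 :=
    (isUnit_of_mem_powers isRegular_discInfty (polePoly P ^ k) ⟨k, rfl⟩).ne_zero
  refine isExtension_of ?_ (fun v => ?_) fun n n' h =>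
    toCompletion_injective isRegular_discInfty (congrArg Subtype.val h)
  · rw [Module.End.isUnit_iff]
    have h1 := hq 1
    rw [pow_one] at h1
    refine ⟨fun v w h => Subtype.ext ?_, fun v => ?_⟩
    · have h2 := congrArg Subtype.val h
      rw [localize_aeval, localize_aeval] at h2
      exact smul_right_injective _ h1 h2
    · obtain ⟨k, n, hn⟩ := v.2
      refine ⟨⟨(algebraMap ℂ[X] discInfty.K (polePoly P))⁻¹ • v.1, k + 1, n, ?_⟩, Subtype.ext ?_⟩
      · rw [pow_succ, map_mul, smul_smul, mul_assoc, mul_inv_cancel₀ h1, mul_one, hn]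
      · exact (localize_aeval N P (polePoly P) ⟨_, _⟩).trans
          (by rw [smul_smul, mul_inv_cancel₀ h1, one_smul])
  · obtain ⟨k, n, hn⟩ := v.2
    exact ⟨k, n, Subtype.ext (by rw [localize_aeval, hn]; rfl)⟩

end Localize

end WeylModule

/-! ### Filtered vector spaces with an operator of degree one -/

section Filtered

variable {W κ : Type*} [AddCommGroup W] [Module ℂ W] [Fintype κ] {F : ℕ → Submodule ℂ W}
  {σ : ℕ → W →ₗ[ℂ] (κ → ℂ)}

/-- The symbol takes values in a finite-dimensional space and its kernel on each step lies in the
previous one. -/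
theorem finiteDimensional_of_symbol (hker : ∀ j, ∀ n ∈ F (j + 1), σ (j + 1) n = 0 → n ∈ F j)
    (h0 : FiniteDimensional ℂ (F 0)) (j : ℕ) : FiniteDimensional ℂ (F j) := by
  induction j with
  | zero => exact h0
  | succ j ih =>
    have : (F j).FG := (Submodule.fg_top _).1 ih.fg_top
    refine Module.Finite.iff_fg.2 (Submodule.fg_of_fg_map_of_fg_inf_ker (σ (j + 1))
      (IsNoetherian.noetherian _) ?_)
    have hle : F (j + 1) ⊓ LinearMap.ker (σ (j + 1)) ≤ F j := fun n hn => hker j n hn.1 hn.2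
    exact Module.Finite.iff_fg.1 (Submodule.finiteDimensional_of_le hle)

theorem finrank_succ_le_of_symbol (hker : ∀ j, ∀ n ∈ F (j + 1), σ (j + 1) n = 0 → n ∈ F j)
    (h0 : FiniteDimensional ℂ (F 0)) (j : ℕ) :
    Module.finrank ℂ (F (j + 1)) ≤ Module.finrank ℂ (F j) + Fintype.card κ := by
  have := finiteDimensional_of_symbol hker h0
  rw [← LinearMap.finrank_range_add_finrank_ker ((σ (j + 1)).domRestrict (F (j + 1))), add_comm]
  refine add_le_add ?_ ?_
  · rw [← Submodule.finrank_map_subtype_eq]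
    refine Submodule.finrank_mono ?_
    rintro _ ⟨n, hn, rfl⟩
    exact hker j n.1 n.2 hn
  · exact (Submodule.finrank_le _).trans (by simp)

/-- The symbol spaces σ j (F j) sit in a fixed finite-dimensional space, and multiplication by D j
embeds each into the next. Their dimensions increase and are bounded; from the place on where the
maximum is attained, every symbol of degree j + 1 is the symbol of some z m. -/
theorem exists_stable_of_symbol (hker : ∀ j, ∀ n ∈ F (j + 1), σ (j + 1) n = 0 → n ∈ F j)
    {z : Module.End ℂ W} (hz : ∀ j, ∀ n ∈ F j, z n ∈ F (j + 1)) {D : ℕ → κ → ℂ}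
    (hD : ∀ j i, D j i ≠ 0) (hσ : ∀ j, ∀ n ∈ F j, σ (j + 1) (z n) = D j * σ j n) :
    ∃ j₀, ∀ j, j₀ ≤ j → ∀ n ∈ F (j + 1), ∃ m ∈ F j, n - z m ∈ F j := by
  let G (j : ℕ) : Submodule ℂ (κ → ℂ) := (F j).map (σ j)
  let E (j : ℕ) : (κ → ℂ) →ₗ[ℂ] (κ → ℂ) := LinearMap.mulLeft ℂ (D j)
  have hE (j : ℕ) : Function.Injective (E j) := fun v w h => funext fun i =>
    mul_left_cancel₀ (hD j i) (congrFun h i)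
  have hle (j : ℕ) : (G j).map (E j) ≤ G (j + 1) := by
    rintro _ ⟨_, ⟨n, hn, rfl⟩, rfl⟩
    exact ⟨z n, hz j n hn, hσ j n hn⟩
  have hfr (j : ℕ) : Module.finrank ℂ ((G j).map (E j)) = Module.finrank ℂ (G j) :=
    LinearEquiv.finrank_eq (Submodule.equivMapOfInjective (E j) (hE j) (G j)).symm
  have hmono : Monotone fun j => Module.finrank ℂ (G j) := monotone_nat_of_le_succ fun j => by
    rw [← hfr j]
    exact Submodule.finrank_mono (hle j)
  have hbdd : BddAbove (Set.range fun j => Module.finrank ℂ (G j)) :=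
    ⟨Module.finrank ℂ (κ → ℂ), by rintro _ ⟨j, rfl⟩; exact Submodule.finrank_le _⟩
  obtain ⟨j₀, hj₀⟩ := Nat.sSup_mem (Set.range_nonempty _) hbdd
  refine ⟨j₀, fun j hj n hn => ?_⟩
  have heq : (G j).map (E j) = G (j + 1) := by
    refine Submodule.eq_of_le_of_finrank_le (hle j) ?_
    rw [hfr]
    exact (le_csSup hbdd ⟨j + 1, rfl⟩).trans (hj₀.symm.le.trans (hmono hj))
  obtain ⟨_, ⟨m, hm, rfl⟩, hm'⟩ : σ (j + 1) n ∈ (G j).map (E j) := heq ▸ ⟨n, hn, rfl⟩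
  refine ⟨m, hm, hker j _ (Submodule.sub_mem _ hn (hz j m hm)) ?_⟩
  rw [map_sub, hσ j m hm, ← hm']
  exact sub_self _

end Filtered

/-! ### Rational functions without poles -/

theorem algebraMap_discInfty_mem (q : ℂ[X]) :
    algebraMap ℂ[X] discInfty.K q ∈ discInfty.fil (-q.natDegree) := by
  intro k hk
  obtain ⟨n, rfl⟩ : ∃ n : ℕ, k = -n := ⟨(-k).toNat, by omega⟩
  rw [coeff_algebraMap_discInfty]
  exact Polynomial.coeff_eq_zero_of_natDegree_lt (by omega)

/-- A rational function with no poles on the sphere and a zero at infinity vanishes: regularity in P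
makes the denominator divide f, and then the degree of f contradicts the zero at infinity. -/
theorem eq_zero_of_regular {P : Finset ℂ} {f : ℂ[X]} {k : ℕ}
    (h : ∀ p ∈ P, ∃ b ∈ (discAt p).fil 0, algebraMap ℂ[X] (discAt p).K f =
      algebraMap ℂ[X] (discAt p).K (polePoly P ^ k) * b)
    (h' : ∃ b ∈ discInfty.fil 1, algebraMap ℂ[X] discInfty.K f =
      algebraMap ℂ[X] discInfty.K (polePoly P ^ k) * b) : f = 0 := by
  have hdvd : polePoly P ^ k ∣ f := by
    rw [polePoly, ← Finset.prod_pow]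
    refine Finset.prod_dvd_of_coprime (fun p _ q _ hpq => ?_) fun p hp => ?_
    · exact (Polynomial.isCoprime_X_sub_C_of_isUnit_sub (sub_ne_zero.2 hpq).isUnit).pow
    · rw [Polynomial.X_sub_C_pow_dvd_iff, Polynomial.X_pow_dvd_iff]
      intro d hd
      obtain ⟨b, hb, hfb⟩ := h p hp
      rw [← Polynomial.taylor_apply, ← coeff_algebraMap_discAt, hfb, map_pow]
      exact mul_mem_fil (WeylModule.mem_fil_of_pow (WeylModule.algebraMap_polePoly_mem hp) k) hb d
        (by omega)
  by_contra hf
  have hdeg := Polynomial.natDegree_le_of_dvd hdvd hf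
  obtain ⟨b, hb, hfb⟩ := h'
  have h1 := mul_mem_fil (algebraMap_discInfty_mem (polePoly P ^ k)) hb (-f.natDegree) (by omega)
  rw [← hfb, coeff_algebraMap_discInfty] at h1
  exact hf (Polynomial.leadingCoeff_eq_zero.1 h1)

namespace WeylModule

variable {M N N' A B : WeylModule.{u}} {P Ξ : Finset ℂ}

/-! ### Lattices over the polynomial ring -/

theorem isLocalizedModule_of {L : Type u} [AddCommGroup L] [Module ℂ[X] L] (f : L →ₗ[ℂ[X]] M.poly)
    (hf : Function.Injective f) (hu : IsUnit (Polynomial.aeval M.x (polePoly P)))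
    (hL : ∀ m : M.poly, ∃ (k : ℕ) (l : L), (polePoly P ^ k) • m = f l) :
    IsLocalizedModule (Submonoid.powers (polePoly P)) f where
  map_units := by
    rintro ⟨_, k, rfl⟩
    have h := hu.pow k
    rw [← map_pow, Module.End.isUnit_iff] at h
    rw [Module.End.isUnit_iff]
    have e (m : M.carrier) : algebraMap ℂ[X] (Module.End ℂ[X] M.poly) (polePoly P ^ k) (M.toPoly m) =
        M.toPoly (Polynomial.aeval M.x (polePoly P ^ k) m) := smul_toPoly _ m
    refine ⟨fun m m' hm => ?_, fun m => ?_⟩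
    · obtain ⟨m, rfl⟩ := M.toPoly.surjective m
      obtain ⟨m', rfl⟩ := M.toPoly.surjective m'
      exact congrArg _ (h.1 (M.toPoly.injective ((e m).symm.trans (hm.trans (e m')))))
    · obtain ⟨m, rfl⟩ := M.toPoly.surjective m
      obtain ⟨m', rfl⟩ := h.2 m
      exact ⟨M.toPoly m', e m'⟩
  surj m := by
    obtain ⟨k, l, hl⟩ := hL m
    exact ⟨⟨l, ⟨_, k, rfl⟩⟩, hl⟩
  exists_of_eq h := ⟨1, by rw [hf h]⟩

/-- A basis of a lattice is a basis of the formal completion. -/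
theorem exists_basis_completion {Δ : FormalDisc} {κ : Δ.K} (hΔ : Δ.IsRegular κ) {L : Type u}
    [AddCommGroup L] [Module ℂ[X] L] (f : L →ₗ[ℂ[X]] M.poly)
    [IsLocalizedModule (Submonoid.powers (polePoly P)) f] {ι : Type*} (b : Module.Basis ι ℂ[X] L) :
    ∃ e : Module.Basis ι Δ.K (M.Completion Δ), ∀ l i,
      e.repr (M.toCompletionₗ Δ (f l)) i = algebraMap ℂ[X] Δ.K (b.repr l i) := by
  let E := LinearEquiv.ofBijective (f.baseChange Δ.K)
    (baseChange_bijective_of_isLocalizedModule (Submonoid.powers (polePoly P)) f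
      fun s hs => isUnit_of_mem_powers hΔ s hs)
  refine ⟨(b.baseChange Δ.K).map E, fun l i => ?_⟩
  have h : E.symm (M.toCompletionₗ Δ (f l)) = (1 : Δ.K) ⊗ₜ[ℂ[X]] l := by
    rw [LinearEquiv.symm_apply_eq]
    rfl
  rw [Module.Basis.map_repr, LinearEquiv.trans_apply, h, Module.Basis.baseChange_repr_tmul,
    Algebra.smul_def, mul_one]

theorem exists_bound {Δ : FormalDisc} {V ι : Type*} [AddCommGroup V] [Module Δ.K V] [Fintype ι]
    (e : Module.Basis ι Δ.K V) (h : V →ₗ[Δ.K] Δ.K) :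
    ∃ J : ℕ, ∀ v, (∀ i, e.repr v i ∈ Δ.fil 0) → h v ∈ Δ.fil (-J) := by
  choose J hJ using fun i => exists_nat_mem_fil (h (e i))
  refine ⟨∑ i, J i, fun v hv => ?_⟩
  rw [← e.sum_repr v, map_sum]
  refine Submodule.sum_mem _ fun i _ => ?_
  rw [map_smul, smul_eq_mul]
  refine fil_antitone ?_ (mul_mem_fil (hv i) (hJ i))
  have := Finset.single_le_sum (f := J) (fun _ _ => Nat.zero_le _) (Finset.mem_univ i)
  omega

/-- Global sections of a lattice on the whole Riemann sphere. -/
theorem finiteDimensional_of_lattice (hu : IsUnit (Polynomial.aeval M.x (polePoly P)))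
    (hf : ∃ L : Submodule ℂ[X] M.poly, L.FG ∧ ∀ m : M.poly, ∃ k : ℕ, (polePoly P ^ k) • m ∈ L)
    {r : P → ℕ} (e : ∀ p : P, Module.Basis (Fin (r p)) (discAt p).K (M.Completion (discAt p)))
    {s : ℕ} (e' : Module.Basis (Fin s) discInfty.K (M.Completion discInfty))
    (U : Submodule ℂ M.carrier)
    (hU : ∀ m ∈ U, ∀ p : P, ∀ i, (e p).repr (M.toCompletion (discAt p) m) i ∈ (discAt p).fil 0)
    (hU' : ∀ m ∈ U, ∀ i, e'.repr (M.toCompletion discInfty m) i ∈ discInfty.fil 0) :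
    FiniteDimensional ℂ U := by
  have htf := isTorsionFree_of_finite hu hf
  obtain ⟨L, hL, hL'⟩ := hf
  have : Module.Finite ℂ[X] L := Module.Finite.iff_fg.2 hL
  have : Module.Free ℂ[X] L := inferInstance
  let b := Module.Free.chooseBasis ℂ[X] L
  have := isLocalizedModule_of (P := P) L.subtype Subtype.val_injective hu fun m => by
    obtain ⟨k, hk⟩ := hL' m
    exact ⟨k, ⟨_, hk⟩, rfl⟩
  choose f hf using fun p : ℂ => exists_basis_completion (isRegular_discAt p) (P := P) L.subtype b
  obtain ⟨g, hg⟩ := exists_basis_completion isRegular_discInfty (P := P) L.subtype b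
  choose J hJ using fun (x : P × Module.Free.ChooseBasisIndex ℂ[X] L) =>
    exists_bound (e x.1) ((f x.1).coord x.2)
  choose J' hJ' using fun i => exists_bound e' (g.coord i)
  -- `Φ` and `Φ'` record, in a basis of L, the finitely many polar coefficients in P and the
  -- non-positive ones at infinity. If all vanish, the coordinates are rational functions without
  -- poles and zero at infinity.
  let Φ : U →ₗ[ℂ] ((Σ x : P × Module.Free.ChooseBasisIndex ℂ[X] L, Fin (J x)) → ℂ) :=
    LinearMap.pi fun x => (discAt x.1.1).coeffₗ (-((x.2 : ℕ) + 1)) ∘ₗ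
      ((f x.1.1).coord x.1.2).restrictScalars ℂ ∘ₗ M.toCompletionC (discAt x.1.1) ∘ₗ U.subtype
  let Φ' : U →ₗ[ℂ] ((Σ i : Module.Free.ChooseBasisIndex ℂ[X] L, Fin (J' i + 1)) → ℂ) :=
    LinearMap.pi fun x => discInfty.coeffₗ (-(x.2 : ℕ)) ∘ₗ
      (g.coord x.1).restrictScalars ℂ ∘ₗ M.toCompletionC discInfty ∘ₗ U.subtype
  refine FiniteDimensional.of_injective (Φ.prod Φ') ?_
  rw [injective_iff_map_eq_zero]
  rintro ⟨m, hm⟩ h0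
  obtain ⟨h1, h2⟩ := Prod.mk.inj h0
  obtain ⟨k, hk⟩ := hL' (M.toPoly m)
  have hloc {Δ : FormalDisc} {κ : Δ.K} (hΔ : Δ.IsRegular κ)
      (w : Module.Basis (Module.Free.ChooseBasisIndex ℂ[X] L) Δ.K (M.Completion Δ))
      (hw : ∀ l i, w.repr (M.toCompletionₗ Δ (L.subtype l)) i = algebraMap ℂ[X] Δ.K (b.repr l i))
      (i) : algebraMap ℂ[X] Δ.K (b.repr ⟨_, hk⟩ i) =
        algebraMap ℂ[X] Δ.K (polePoly P ^ k) * w.repr (M.toCompletion Δ m) i := by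
    rw [← hw, Submodule.subtype_apply, map_smul, toCompletionₗ_toPoly, ← algebraMap_smul_completion,
      map_smul, Finsupp.smul_apply, smul_eq_mul]
  have hb : b.repr ⟨_, hk⟩ = 0 := by
    refine Finsupp.ext fun i => eq_zero_of_regular (k := k) (P := P) (fun p hp => ?_) ?_
    · refine ⟨_, fun n hn => ?_, hloc (isRegular_discAt p) (f p) (hf p) i⟩
      by_cases hn' : n < -J (⟨p, hp⟩, i)
      · exact hJ (⟨p, hp⟩, i) _ (hU m hm ⟨p, hp⟩) n hn'
      · have h3 := congrFun h1 ⟨(⟨p, hp⟩, i), ⟨(-n - 1).toNat, by omega⟩⟩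
        have h4 : (-(((-n - 1).toNat : ℕ) + 1) : ℤ) = n := by omega
        change (discAt p).coeff ((f p).repr (M.toCompletion (discAt p) m) i)
          (-(((-n - 1).toNat : ℕ) + 1)) = 0 at h3
        rwa [h4] at h3
    · refine ⟨_, fun n hn => ?_, hloc isRegular_discInfty g hg i⟩
      by_cases hn' : n < -J' i
      · exact hJ' i _ (hU' m hm) n hn'
      · have h3 := congrFun h2 ⟨i, ⟨(-n).toNat, by omega⟩⟩
        have h4 : (-((-n).toNat : ℕ) : ℤ) = n := by omega
        change discInfty.coeff (g.repr (M.toCompletion discInfty m) i) (-((-n).toNat : ℕ)) = 0 at h3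
        rwa [h4] at h3
  have h5 := congrArg Subtype.val (b.repr.map_eq_zero_iff.1 hb)
  have h6 := isTorsionFree_iff.1 htf _ _ (pow_ne_zero k (polePoly_ne_zero P)) h5
  exact Subtype.ext (M.toPoly.map_eq_zero_iff.1 h6)

end WeylModule

/-! ### The filtration by pole order of the sections holomorphic at infinity -/

namespace WeylModule

variable {N N' A : WeylModule.{u}} {P Ξ : Finset ℂ} {ε : ℤ} {c : N.carrier ≃ₗ[ℂ] N'.carrier}

theorem IsDualPair.x_apply (hd : IsDualPair ε N N' c) (n : N.carrier) :
    N'.x (c n) = (ε : ℂ) • c (N.d n) := by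
  rw [hd.map_d, smul_smul, hd.sq, one_smul]

theorem aeval_mem_of_x_mem {T : Submodule ℂ N.carrier} (hT : ∀ n ∈ T, N.x n ∈ T) (q : ℂ[X])
    {n : N.carrier} (hn : n ∈ T) : Polynomial.aeval N.x q n ∈ T := by
  induction q using Polynomial.induction_on' with
  | add p q hp hq =>
    rw [map_add]
    exact T.add_mem hp hq
  | monomial k r =>
    rw [Polynomial.aeval_monomial, Module.End.mul_apply, Module.algebraMap_end_apply]
    refine T.smul_mem r ?_
    induction k with
    | zero => simpa using hn
    | succ k ih =>
      rw [pow_succ', Module.End.mul_apply]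
      exact hT _ ih

section Coordinates

variable {a : Hom N A}

theorem coeff_d_at {p μ : ℂ} {h : A.Completion (discAt p) →ₗ[(discAt p).K] (discAt p).K}
    (hh : h ∈ horizontal (A.connAt p) ((discAt p).chr μ 0)) (n : N.carrier) (m : ℤ) :
    (discAt p).coeff (h (A.toCompletion (discAt p) (a.toLin (N.d n)))) m =
      (m + 1 + μ) * (discAt p).coeff (h (A.toCompletion (discAt p) (a.toLin n))) (m + 1) := by
  have h1 := congrArg (fun f => (discAt p).coeff f (m + 1))
    (hh (A.toCompletion (discAt p) (a.toLin n)))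
  simp only [connAt_apply, map_smul, smul_eq_mul, coeff_t_mul, add_sub_cancel_right, coeff_add,
    coeff_theta, coeff_chr_mul, zero_mul, add_zero] at h1
  rw [a.map_d, toCompletion_d (isRegular_discAt p), h1]
  push_cast
  ring

theorem coeff_d_infty {μ γ : ℂ} {h : A.Completion discInfty →ₗ[discInfty.K] discInfty.K}
    (hh : h ∈ horizontal (A.connInfty 0) (discInfty.chr μ γ)) (n : N.carrier) (m : ℤ) :
    discInfty.coeff (h (A.toCompletion discInfty (a.toLin (N.d n)))) m =
      -γ * discInfty.coeff (h (A.toCompletion discInfty (a.toLin n))) m -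
        (m - 1 + μ) * discInfty.coeff (h (A.toCompletion discInfty (a.toLin n))) (m - 1) := by
  have h1 := congrArg (fun f => discInfty.coeff f (m - 1))
    (hh (A.toCompletion discInfty (a.toLin n)))
  simp only [connInfty_apply, zero_smul, sub_zero, map_neg, map_smul, smul_eq_mul, coeff_neg,
    coeff_t_inv_mul, sub_add_cancel, coeff_add, coeff_theta, coeff_chr_mul] at h1
  rw [a.map_d, toCompletion_d isRegular_discInfty, ← neg_neg (discInfty.coeff _ m), h1]
  push_cast
  ring

/-- The elements for which the functional `h` takes values of order at least `k`. -/
noncomputable def orderAt (a : Hom N A) {Δ : FormalDisc} (h : A.Completion Δ →ₗ[Δ.K] Δ.K) (k : ℤ) :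
    Submodule ℂ N.carrier :=
  (Δ.fil k).comap (h.restrictScalars ℂ ∘ₗ A.toCompletionC Δ ∘ₗ a.toLin)

theorem mem_orderAt {Δ : FormalDisc} {h : A.Completion Δ →ₗ[Δ.K] Δ.K} {k : ℤ} {n : N.carrier} :
    n ∈ orderAt a h k ↔ h (A.toCompletion Δ (a.toLin n)) ∈ Δ.fil k := Iff.rfl

theorem orderAt_antitone {Δ : FormalDisc} {h : A.Completion Δ →ₗ[Δ.K] Δ.K} {k l : ℤ} (hkl : k ≤ l) :
    orderAt a h l ≤ orderAt a h k := fun _ hn => fil_antitone hkl hn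

theorem d_mem_orderAt_infty {μ γ : ℂ} {h : A.Completion discInfty →ₗ[discInfty.K] discInfty.K}
    (hh : h ∈ horizontal (A.connInfty 0) (discInfty.chr μ γ)) {k : ℤ} {n : N.carrier}
    (hn : n ∈ orderAt a h k) : N.d n ∈ orderAt a h k := by
  intro m hm
  change discInfty.coeff (h (A.toCompletion discInfty (a.toLin (N.d n)))) m = 0
  rw [coeff_d_infty hh, mem_orderAt.1 hn m hm, mem_orderAt.1 hn (m - 1) (by omega), mul_zero,
    mul_zero, sub_zero]

theorem d_sub_mem_orderAt_infty {μ γ : ℂ} {h : A.Completion discInfty →ₗ[discInfty.K] discInfty.K}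
    (hh : h ∈ horizontal (A.connInfty 0) (discInfty.chr μ γ)) {k : ℤ} {n : N.carrier}
    (hn : n ∈ orderAt a h k) : N.d n + γ • n ∈ orderAt a h (k + 1) := by
  intro m hm
  change discInfty.coeff (h (A.toCompletion discInfty (a.toLin (N.d n + γ • n)))) m = 0
  rw [map_add, toCompletion_add, map_add, coeff_add, coeff_d_infty hh,
    mem_orderAt.1 hn (m - 1) (by omega), map_smul, toCompletion_smul, LinearMap.map_smul_of_tower, coeff_smul]
  ring

/-- On this coordinate ∂ has the leading coefficient −γ, so ∂ + γ, which is a factor of the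
polynomial up to sign, raises the order at infinity; the other factors do not lower it. -/
theorem polePoly_mem_orderAt_infty (hd : IsDualPair ε N N' c) {μ γ : ℂ}
    {h : A.Completion discInfty →ₗ[discInfty.K] discInfty.K}
    (hh : h ∈ horizontal (A.connInfty 0) (discInfty.chr μ γ)) (hγ : -γ ∈ Ξ) {k : ℤ} {n : N.carrier}
    (hn : n ∈ orderAt a h k) : c.symm (Polynomial.aeval N'.x
      (polePoly (Ξ.image fun ξ => (ε : ℂ) * ξ)) (c n)) ∈ orderAt a h (k + 1) := by
  have hx {l : ℤ} : ∀ y ∈ (orderAt a h l).map c.toLinearMap, N'.x y ∈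
      (orderAt a h l).map c.toLinearMap := by
    rintro _ ⟨y, hy, rfl⟩
    refine ⟨(ε : ℂ) • N.d y, Submodule.smul_mem _ _ (d_mem_orderAt_infty hh hy), ?_⟩
    rw [map_smul]
    exact (hd.x_apply y).symm
  have hm : (ε : ℂ) * -γ ∈ Ξ.image fun ξ => (ε : ℂ) * ξ := Finset.mem_image_of_mem _ hγ
  rw [polePoly, ← Finset.mul_prod_erase _ _ hm, mul_comm, aeval_mul_apply, aeval_X_sub_C]
  have h1 : (N'.x - ((ε : ℂ) * -γ) • 1 : Module.End ℂ N'.carrier) (c n) =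
      c ((ε : ℂ) • (N.d n + γ • n)) := by
    rw [LinearMap.sub_apply, hd.x_apply, map_smul, map_add, map_smul, LinearMap.smul_apply,
      Module.End.one_apply]
    module
  rw [h1]
  obtain ⟨y, hy, hy'⟩ := aeval_mem_of_x_mem (hx (l := k + 1))
    (∏ x ∈ (Ξ.image fun ξ => (ε : ℂ) * ξ).erase ((ε : ℂ) * -γ), (Polynomial.X - Polynomial.C x))
    ⟨(ε : ℂ) • (N.d n + γ • n), Submodule.smul_mem _ _ (d_sub_mem_orderAt_infty hh hn), rfl⟩
  rw [LinearEquiv.coe_coe] at hy'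
  rw [← hy', LinearEquiv.symm_apply_apply]
  exact hy

end Coordinates

section Lattice

variable (a : Hom N A) {s : ℕ} (e' : Module.Basis (Fin s) discInfty.K (A.Completion discInfty))
  {r : P → ℕ} (e : ∀ p : P, Module.Basis (Fin (r p)) (discAt p).K (A.Completion (discAt p)))
  (μ : ∀ p : P, Fin (r p) → ℂ)

/-- The elements which belong to the lattice spanned by `e'` at infinity. -/
noncomputable def inftyLattice (k : ℤ) : Submodule ℂ N.carrier :=
  ⨅ i, orderAt a (e'.coord i) k

/-- The elements of `inftyLattice` with poles of order at most `j`. -/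
noncomputable def poleLattice (j : ℕ) : Submodule ℂ N.carrier :=
  inftyLattice a e' 0 ⊓ ⨅ p, ⨅ i, orderAt a ((e p).coord i) (-j)

variable {a e' e}

theorem mem_inftyLattice {k : ℤ} {n : N.carrier} :
    n ∈ inftyLattice a e' k ↔ ∀ i, n ∈ orderAt a (e'.coord i) k := Submodule.mem_iInf _

theorem mem_poleLattice {j : ℕ} {n : N.carrier} : n ∈ poleLattice a e' e j ↔
    n ∈ inftyLattice a e' 0 ∧ ∀ p i, n ∈ orderAt a ((e p).coord i) (-j) := by
  simp [poleLattice, Submodule.mem_iInf]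

theorem poleLattice_mono : Monotone (poleLattice a e' e) := fun j k h n hn =>
  mem_poleLattice.2 ⟨(mem_poleLattice.1 hn).1, fun p i =>
    orderAt_antitone (by omega) ((mem_poleLattice.1 hn).2 p i)⟩

theorem exists_mem_inftyLattice (n : N.carrier) : ∃ k : ℕ, n ∈ inftyLattice a e' (-k) := by
  choose k hk using fun i => exists_nat_mem_fil (e'.repr (A.toCompletion discInfty (a.toLin n)) i)
  refine ⟨∑ i, k i, mem_inftyLattice.2 fun i => fil_antitone ?_ (hk i)⟩
  have := Finset.single_le_sum (f := k) (fun _ _ => Nat.zero_le _) (Finset.mem_univ i)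
  omega

theorem exists_mem_poleLattice {n : N.carrier} (hn : n ∈ inftyLattice a e' 0) :
    ∃ j : ℕ, n ∈ poleLattice a e' e j := by
  choose k hk using fun (x : Σ p : P, Fin (r p)) =>
    exists_nat_mem_fil ((e x.1).repr (A.toCompletion (discAt x.1) (a.toLin n)) x.2)
  refine ⟨∑ x, k x, mem_poleLattice.2 ⟨hn, fun p i => fil_antitone ?_ (hk ⟨p, i⟩)⟩⟩
  have := Finset.single_le_sum (f := k) (fun _ _ => Nat.zero_le _) (Finset.mem_univ ⟨p, i⟩)
  omega

/-- The non-zero exponents in the finite singular points. -/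
abbrev NonzeroExponent : Type := Σ p : P, {i : Fin (r p) // μ p i ≠ 0}

/-- The polar coefficients of order `j`. -/
noncomputable def polarSymbol (a : Hom N A)
    (e : ∀ p : P, Module.Basis (Fin (r p)) (discAt p).K (A.Completion (discAt p)))
    (μ : ∀ p : P, Fin (r p) → ℂ) (j : ℕ) : N.carrier →ₗ[ℂ] (NonzeroExponent μ → ℂ) :=
  LinearMap.pi fun x => (discAt x.1).coeffₗ (-j) ∘ₗ ((e x.1).coord x.2.1).restrictScalars ℂ ∘ₗ
    A.toCompletionC (discAt x.1) ∘ₗ a.toLin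

variable {μ' γ' : Fin s → ℂ} (he' : IsNormalBasis (A.connInfty 0) e' μ' γ')
  (he : ∀ p : P, IsNormalBasis (A.connAt p) (e p) (μ p) fun _ => 0)
  (hreg : ∀ n, a.toLin n ∈ A.regularPart P)

include he' in
theorem d_mem_inftyLattice {k : ℤ} {n : N.carrier} (hn : n ∈ inftyLattice a e' k) :
    N.d n ∈ inftyLattice a e' k := mem_inftyLattice.2 fun i =>
  d_mem_orderAt_infty (he'.coord_mem (isConnection_connInfty 0) i) (mem_inftyLattice.1 hn i)

include he' he in
theorem d_mem_poleLattice {j : ℕ} {n : N.carrier} (hn : n ∈ poleLattice a e' e j) :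
    N.d n ∈ poleLattice a e' e (j + 1) := by
  obtain ⟨h1, h2⟩ := mem_poleLattice.1 hn
  refine mem_poleLattice.2 ⟨d_mem_inftyLattice he' h1, fun p i m hm => ?_⟩
  refine (coeff_d_at ((he p).coord_mem (isConnection_connAt _) i) n m).trans ?_
  rw [mem_orderAt.1 (h2 p i) (m + 1) (by push_cast at hm; omega), mul_zero]

include he hreg in
-- By `hreg` the coordinates of exponent zero have no poles at all, so only the non-zero exponents
-- contribute to the leading polar part.
theorem mem_poleLattice_of_polarSymbol {j : ℕ} {n : N.carrier}
    (hn : n ∈ poleLattice a e' e (j + 1)) (h : polarSymbol a e μ (j + 1) n = 0) :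
    n ∈ poleLattice a e' e j := by
  obtain ⟨h1, h2⟩ := mem_poleLattice.1 hn
  refine mem_poleLattice.2 ⟨h1, fun p i => ?_⟩
  by_cases hi : μ p i = 0
  · have h3 := (he p).coord_mem (isConnection_connAt _) i
    rw [hi] at h3
    exact fil_antitone (by omega) (hreg n p p.2 _ (isHorizontalAt_iff.2 h3))
  · have h3 : (discAt p).coeff ((e p).coord i (A.toCompletion (discAt p) (a.toLin n)))
      (-(j + 1 : ℕ)) = 0 := congrFun h (⟨p, ⟨i, hi⟩⟩ : NonzeroExponent μ)
    have h4 := mem_fil_of_succ (h2 p i) h3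
    exact fil_antitone (by push_cast; omega) h4

include he in
theorem polarSymbol_d (j : ℕ) (n : N.carrier) : polarSymbol a e μ (j + 1) (N.d n) =
    (fun x : NonzeroExponent μ => μ x.1 x.2.1 - j) * polarSymbol a e μ j n := by
  funext x
  have h := coeff_d_at ((he x.1).coord_mem (isConnection_connAt _) x.2.1) (a := a) n (-(j + 1 : ℕ))
  refine h.trans ?_
  have h1 : (-(j + 1 : ℕ) + 1 : ℤ) = -j := by push_cast; ring
  rw [h1]
  push_cast
  change _ = (μ x.1 x.2.1 - j) * (discAt x.1).coeff _ (-j)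
  rw [show -((j : ℂ) + 1) + 1 + μ x.1 x.2.1 = μ x.1 x.2.1 - j by ring]
  rfl

variable (hA : IsMeromorphicBundle P Ξ A) (hinj : Function.Injective a.toLin)
include hA hinj

theorem finiteDimensional_poleLattice : FiniteDimensional ℂ (poleLattice a e' e 0) := by
  have := finiteDimensional_of_lattice (isUnit_aeval_polePoly hA.invertible) hA.finite e e'
    ((poleLattice a e' e 0).map a.toLin)
    (by
      rintro _ ⟨n, hn, rfl⟩ p i
      exact (mem_poleLattice.1 hn).2 p i)
    (by
      rintro _ ⟨n, hn, rfl⟩ i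
      exact mem_inftyLattice.1 (mem_poleLattice.1 hn).1 i)
  exact LinearEquiv.finiteDimensional (Submodule.equivMapOfInjective a.toLin hinj _).symm

include he' he hreg

theorem finrank_poleLattice_succ_le (j : ℕ) : Module.finrank ℂ (poleLattice a e' e (j + 1)) ≤
    Module.finrank ℂ (poleLattice a e' e j) + Fintype.card (NonzeroExponent μ) :=
  finrank_succ_le_of_symbol (F := poleLattice a e' e) (σ := polarSymbol a e μ) (fun _ _ hn h => mem_poleLattice_of_polarSymbol μ he hreg hn h)
    (finiteDimensional_poleLattice hA hinj) j

/-- ∂ multiplies the leading polar coefficients by μ − j, which is never zero for non-integral μ. -/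
theorem exists_poleLattice_stable (hμ : ∀ p i, μ p i ≠ 0 → ∀ n : ℤ, μ p i ≠ n) :
    ∃ j₀, ∀ j, j₀ ≤ j → ∀ n ∈ poleLattice a e' e (j + 1), ∃ m ∈ poleLattice a e' e j,
      n - N.d m ∈ poleLattice a e' e j :=
  exists_stable_of_symbol (F := poleLattice a e' e) (σ := polarSymbol a e μ) (z := N.d)
    (D := fun j x => μ x.1 x.2.1 - j) (fun _ _ hn h => mem_poleLattice_of_polarSymbol μ he hreg hn h)
    (fun _ _ hn => d_mem_poleLattice μ he' he hn)
    (fun j x => sub_ne_zero.2 (by exact_mod_cast hμ x.1 x.2.1 x.2.2 j))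
    fun j n _ => polarSymbol_d μ he j n

end Lattice

end WeylModule

/-! ### The lattice over the polynomials in the dual variable -/

namespace WeylModule

variable {N N' A B : WeylModule.{u}} {P Ξ : Finset ℂ} {ε : ℤ} {c : N.carrier ≃ₗ[ℂ] N'.carrier}

section DualLattice

variable {a : Hom N A} {s : ℕ} {e' : Module.Basis (Fin s) discInfty.K (A.Completion discInfty)}
  {μ' γ' : Fin s → ℂ} (hd : IsDualPair ε N N' c) (he' : IsNormalBasis (A.connInfty 0) e' μ' γ')

theorem IsDualPair.X_smul (hd : IsDualPair ε N N' c) (n : N.carrier) :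
    (Polynomial.X : ℂ[X]) • N'.toPoly (c n) = N'.toPoly (c ((ε : ℂ) • N.d n)) := by
  rw [X_smul_toPoly, hd.x_apply, map_smul c]

/-- The lattice at infinity, as a module over the polynomials in the dual variable. -/
noncomputable def dualLattice : Submodule ℂ[X] N'.poly where
  carrier := {w | ∃ n ∈ inftyLattice a e' 0, N'.toPoly (c n) = w}
  add_mem' := by
    rintro _ _ ⟨n, hn, rfl⟩ ⟨m, hm, rfl⟩
    exact ⟨n + m, Submodule.add_mem _ hn hm, by rw [map_add, map_add]⟩
  zero_mem' := ⟨0, Submodule.zero_mem _, by rw [map_zero, map_zero]⟩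
  smul_mem' := by
    rintro q _ ⟨n, hn, rfl⟩
    rw [smul_toPoly]
    obtain ⟨m, hm, hm'⟩ := aeval_mem_of_x_mem (N := N')
      (T := (inftyLattice a e' 0).map c.toLinearMap) (by
        rintro _ ⟨n, hn, rfl⟩
        refine ⟨(ε : ℂ) • N.d n, Submodule.smul_mem _ _ (d_mem_inftyLattice he' hn), ?_⟩
        rw [map_smul]
        exact (hd.x_apply n).symm) q ⟨n, hn, rfl⟩
    exact ⟨m, hm, congrArg _ hm'⟩

theorem mem_dualLattice {n : N.carrier} :
    N'.toPoly (c n) ∈ dualLattice hd he' (a := a) ↔ n ∈ inftyLattice a e' 0 := by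
  constructor
  · rintro ⟨m, hm, h⟩
    rwa [← c.injective (N'.toPoly.injective h)]
  · exact fun h => ⟨n, h, rfl⟩

/-- Each multiplication by the pole polynomial of the transform gains one order at infinity, so the
lattice becomes everything after localization. -/
theorem exists_smul_mem_dualLattice (hγ : ∀ i, -γ' i ∈ Ξ) (w : N'.poly) :
    ∃ k : ℕ, (polePoly (Ξ.image fun ξ => (ε : ℂ) * ξ) ^ k) • w ∈ dualLattice hd he' (a := a) := by
  obtain ⟨w, rfl⟩ := N'.toPoly.surjective w
  obtain ⟨n, rfl⟩ := c.surjective w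
  obtain ⟨k, hk⟩ := exists_mem_inftyLattice (a := a) (e' := e') n
  refine ⟨k, ?_⟩
  induction k generalizing n with
  | zero =>
    rw [pow_zero, one_smul]
    exact (mem_dualLattice hd he').2 hk
  | succ k ih =>
    have h1 := ih (c.symm (Polynomial.aeval N'.x
      (polePoly (Ξ.image fun ξ => (ε : ℂ) * ξ)) (c n))) (mem_inftyLattice.2 fun i => by
        have := polePoly_mem_orderAt_infty hd (he'.coord_mem (isConnection_connInfty 0) i) (hγ i)
          (mem_inftyLattice.1 hk i)
        exact orderAt_antitone (by push_cast; omega) this)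
    rwa [LinearEquiv.apply_symm_apply, ← smul_toPoly, smul_smul, ← pow_succ] at h1

variable {r : P → ℕ}
  {e : ∀ p : P, Module.Basis (Fin (r p)) (discAt p).K (A.Completion (discAt p))}
  {μ : ∀ p : P, Fin (r p) → ℂ}
  (he : ∀ p : P, IsNormalBasis (A.connAt p) (e p) (μ p) fun _ => 0)
  (hreg : ∀ n, a.toLin n ∈ A.regularPart P)
  (hA : IsMeromorphicBundle P Ξ A) (hinj : Function.Injective a.toLin)

include he hreg hA hinj

/-- Beyond the stable index j₀, a section of pole order j + 1 is ∂ of one of order j, modulo order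
j. Hence the finite-dimensional space of sections of pole order at most j₀ generates under ∂ = εx'.
-/
theorem dualLattice_fg (hμ : ∀ p i, μ p i ≠ 0 → ∀ n : ℤ, μ p i ≠ n) :
    (dualLattice hd he' (a := a)).FG := by
  obtain ⟨j₀, hj₀⟩ := exists_poleLattice_stable μ he' he hreg hA hinj hμ
  have hfin := finiteDimensional_of_symbol (F := poleLattice a e' e) (σ := polarSymbol a e μ)
    (fun _ _ hn h => mem_poleLattice_of_polarSymbol μ he hreg hn h)
    (finiteDimensional_poleLattice hA hinj)
  obtain ⟨G, hG⟩ := Module.Finite.iff_fg.1 (hfin j₀)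
  let f : N.carrier →ₗ[ℂ] N'.poly := N'.toPoly.toLinearMap ∘ₗ c.toLinearMap
  classical
  refine ⟨G.image f, le_antisymm (Submodule.span_le.2 ?_) ?_⟩
  · intro w hw
    obtain ⟨n, hn, rfl⟩ := Finset.mem_image.1 (Finset.mem_coe.1 hw)
    have : n ∈ poleLattice a e' e j₀ := hG ▸ Submodule.subset_span hn
    exact (mem_dualLattice hd he').2 (mem_poleLattice.1 this).1
  · let T : Submodule ℂ N.carrier :=
      ((Submodule.span ℂ[X] (G.image f : Set N'.poly)).restrictScalars ℂ).comap f
    have hT : ∀ j, poleLattice a e' e j ≤ T := by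
      have h0 : poleLattice a e' e j₀ ≤ T := by
        rw [← hG, Submodule.span_le]
        exact fun n hn => Submodule.subset_span (Finset.mem_coe.2 (Finset.mem_image_of_mem f hn))
      intro j
      induction j with
      | zero => exact (poleLattice_mono (Nat.zero_le _)).trans h0
      | succ j ih =>
        by_cases hj : j₀ ≤ j
        · intro n hn
          obtain ⟨m, hm, hnm⟩ := hj₀ j hj n hn
          rw [← sub_add_cancel n (N.d m)]
          refine T.add_mem (ih hnm) ?_
          have h1 := Submodule.smul_mem (Submodule.span ℂ[X] (G.image f : Set N'.poly))
            (Polynomial.C (ε : ℂ) * Polynomial.X) (ih hm)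
          rw [mul_smul, show f m = N'.toPoly (c m) from rfl, hd.X_smul, smul_toPoly,
            Polynomial.aeval_C, Module.algebraMap_end_apply, ← map_smul c, smul_smul, hd.sq,
            one_smul] at h1
          exact h1
        · exact (poleLattice_mono (by omega)).trans h0
    rintro _ ⟨n, hn, rfl⟩
    obtain ⟨j, hj⟩ := exists_mem_poleLattice (e := e) hn
    exact hT j hj

/-- A basis stays independent modulo the dual variable, so its ℂ-span meets ∂(F j) only in zero,
where F j are the sections of pole order at most j. As ∂ is injective, t + dim F j ≤ dim F (j+1),
while each step of the filtration adds at most the number of non-zero exponents. -/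
theorem rank_dualLattice_le [Module.IsTorsionFree ℂ[X] N'.poly] {t : ℕ}
    (b : Module.Basis (Fin t) ℂ[X] (dualLattice hd he' (a := a))) :
    t ≤ Fintype.card (NonzeroExponent μ) := by
  have hfin := finiteDimensional_of_symbol (F := poleLattice a e' e) (σ := polarSymbol a e μ)
    (fun _ _ hn h => mem_poleLattice_of_polarSymbol μ he hreg hn h)
    (finiteDimensional_poleLattice hA hinj)
  choose n hn hnb using fun i => (b i).2
  choose k hk using fun i => exists_mem_poleLattice (e := e) (hn i)
  let j := ∑ i, k i
  have hj (i) : n i ∈ poleLattice a e' e (j + 1) := poleLattice_mono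
    ((Finset.single_le_sum (f := k) (fun _ _ => Nat.zero_le _) (Finset.mem_univ i)).trans
      (Nat.le_succ _)) (hk i)
  have key (x : Fin t → ℂ) (m : N.carrier) (hm : m ∈ poleLattice a e' e j)
      (h : ∑ i, x i • n i = N.d m) : ∀ i, x i = 0 := by
    intro i
    have h1 : ∑ i, Polynomial.C (x i) • b i = (Polynomial.X : ℂ[X]) • (Polynomial.C (ε : ℂ) •
        (⟨N'.toPoly (c m), (mem_dualLattice hd he').2 (mem_poleLattice.1 hm).1⟩ :
          dualLattice hd he' (a := a))) := by
      refine Subtype.ext ?_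
      rw [Submodule.coe_smul, Submodule.coe_smul, smul_toPoly, Polynomial.aeval_C,
        Module.algebraMap_end_apply, ← map_smul c, hd.X_smul, map_smul N.d, smul_smul, hd.sq,
        one_smul, ← h, Submodule.coe_sum, map_sum, map_sum]
      refine Finset.sum_congr rfl fun i _ => ?_
      rw [Submodule.coe_smul, ← hnb i, smul_toPoly, Polynomial.aeval_C,
        Module.algebraMap_end_apply, map_smul c]
    have h2 := congrArg (fun w => (b.repr w i).coeff 0) h1
    simp only [map_sum, map_smul, Module.Basis.repr_self, Finsupp.coe_finsetSum, Finset.sum_apply,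
      Finsupp.smul_apply, smul_eq_mul, Polynomial.mul_coeff_zero, Polynomial.coeff_X_zero,
      zero_mul] at h2
    rw [Finset.sum_eq_single i] at h2
    · simpa using h2
    · intro l _ hl
      rw [Finsupp.single_eq_of_ne hl.symm, mul_zero]
    · simp
  have hli : LinearIndependent ℂ n := Fintype.linearIndependent_iff.2 fun x hx =>
    key x 0 (Submodule.zero_mem _) (by rw [hx, map_zero])
  have hdinj : Function.Injective N.d := fun m m' h => by
    have h1 : (Polynomial.X : ℂ[X]) • N'.toPoly (c (m - m')) = 0 := by
      rw [hd.X_smul, map_sub, h, sub_self, smul_zero, map_zero, map_zero]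
    have h2 := isTorsionFree_iff.1 inferInstance _ _ Polynomial.X_ne_zero h1
    rw [map_sub, map_sub, sub_eq_zero] at h2
    exact c.injective (N'.toPoly.injective h2)
  let U := Submodule.span ℂ (Set.range n)
  let D := (poleLattice a e' e j).map N.d
  have hdisj : U ⊓ D = ⊥ := by
    rw [Submodule.eq_bot_iff]
    rintro w ⟨hw, m, hm, rfl⟩
    obtain ⟨x, hx⟩ := (Submodule.mem_span_range_iff_exists_fun ℂ).1 hw
    rw [← hx]
    exact Finset.sum_eq_zero fun i _ => by rw [key x m hm hx i, zero_smul]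
  have hle : U ⊔ D ≤ poleLattice a e' e (j + 1) := by
    refine sup_le (Submodule.span_le.2 ?_) ?_
    · rintro _ ⟨i, rfl⟩
      exact hj i
    · rintro _ ⟨m, hm, rfl⟩
      exact d_mem_poleLattice μ he' he hm
  have := hfin j
  have := hfin (j + 1)
  have hU : FiniteDimensional ℂ U := FiniteDimensional.span_of_finite ℂ (Set.finite_range n)
  have h1 := Submodule.finrank_sup_add_finrank_inf_eq U D
  rw [hdisj, finrank_bot, add_zero, finrank_span_eq_card hli, Fintype.card_fin,
    ← LinearEquiv.finrank_eq (Submodule.equivMapOfInjective N.d hdinj (poleLattice a e' e j))] at h1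
  have h2 := Submodule.finrank_mono hle
  have h3 := finrank_poleLattice_succ_le μ he' he hreg hA hinj j
  omega

end DualLattice

end WeylModule

namespace WeylModule

variable {N N' A B : WeylModule.{u}} {P P' Ξ : Finset ℂ} {ε : ℤ} {c : N.carrier ≃ₗ[ℂ] N'.carrier}

/-! ### Taylor expansions -/

/-- The Taylor series `∑ φ(∂^k n) / k! t^k`. -/
noncomputable def taylorSeries (M : WeylModule.{u}) (ζ : ℂ) (φ : M.carrier →ₗ[ℂ] ℂ) :
    M.carrier →ₗ[ℂ] (discAt ζ).K where
  toFun m := (discAt ζ).ofFun (fun k => φ ((M.d ^ k.toNat) m) / (k.toNat.factorial : ℂ)) 0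
  map_add' m m' := coeff_ext fun k => by
    rw [coeff_add, coeff_ofFun, coeff_ofFun, coeff_ofFun, map_add, map_add, add_div]
    split_ifs <;> simp
  map_smul' r m := coeff_ext fun k => by
    rw [RingHom.id_apply, coeff_smul, coeff_ofFun, coeff_ofFun, map_smul, map_smul, smul_eq_mul,
      mul_div_assoc]
    split_ifs <;> simp

theorem coeff_taylorSeries {M : WeylModule.{u}} {ζ : ℂ} {φ : M.carrier →ₗ[ℂ] ℂ} (m : M.carrier)
    (k : ℕ) : (discAt ζ).coeff (M.taylorSeries ζ φ m) k = φ ((M.d ^ k) m) / (k.factorial : ℂ) := by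
  refine (coeff_ofFun (Δ := discAt ζ) _ _ _).trans ?_
  rw [if_neg (by omega), Int.toNat_natCast]

theorem coeff_taylorSeries_of_neg {M : WeylModule.{u}} {ζ : ℂ} {φ : M.carrier →ₗ[ℂ] ℂ}
    (m : M.carrier) {k : ℤ} (hk : k < 0) : (discAt ζ).coeff (M.taylorSeries ζ φ m) k = 0 :=
  (coeff_ofFun (Δ := discAt ζ) _ _ _).trans (if_pos hk)

/-- A functional on M/(x − ζ)M is the constant term of a solution: the relation ∂^k x = x ∂^k + k
∂^(k−1) turns x into ζ + t. This produces functionals of exponent zero. -/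
theorem isSolution_taylorSeries {M : WeylModule.{u}} {ζ : ℂ} {φ : M.carrier →ₗ[ℂ] ℂ}
    (hφ : ∀ m, φ (M.x m) = ζ * φ m) : IsSolution M (discAt ζ) 0 (M.taylorSeries ζ φ) where
  map_x m := coeff_ext fun k => by
    rw [discAt_zK, add_mul, coeff_add, algebraMap_mul, coeff_smul, coeff_t_mul]
    rcases lt_or_ge k 0 with hk | hk
    · rw [coeff_taylorSeries_of_neg _ hk, coeff_taylorSeries_of_neg _ hk,
        coeff_taylorSeries_of_neg _ (by omega)]
      ring
    · lift k to ℕ using hk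
      have h := M.d_pow_x 0 k m
      rw [zero_smul, sub_zero] at h
      rw [coeff_taylorSeries, coeff_taylorSeries, h, map_add, hφ, map_smul, smul_eq_mul]
      rcases k with _ | k
      · rw [coeff_taylorSeries_of_neg _ (by simp)]
        simp
      · rw [show ((k + 1 : ℕ) : ℤ) - 1 = k by push_cast; ring, coeff_taylorSeries,
          Nat.add_sub_cancel, Nat.factorial_succ]
        have h1 : (k.factorial : ℂ) ≠ 0 := Nat.cast_ne_zero.2 k.factorial_ne_zero
        have h2 : (k : ℂ) + 1 ≠ 0 := Nat.cast_add_one_ne_zero k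
        push_cast
        field_simp
  map_d m := coeff_ext fun k => by
    rw [zero_mul, add_zero, coeff_discAt_deriv]
    rcases lt_or_ge k 0 with hk | hk
    · rw [coeff_taylorSeries_of_neg _ hk]
      rcases (show k + 1 ≤ 0 by omega).lt_or_eq with h1 | h1
      · rw [coeff_taylorSeries_of_neg _ h1, mul_zero]
      · have h2 : (k : ℂ) + 1 = 0 := by exact_mod_cast h1
        rw [h2, zero_mul]
    · lift k to ℕ using hk
      rw [coeff_taylorSeries, show ((k : ℕ) : ℤ) + 1 = (k + 1 : ℕ) by push_cast; ring,
        coeff_taylorSeries, pow_succ, Module.End.mul_apply, Nat.factorial_succ]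
      have h1 : (k.factorial : ℂ) ≠ 0 := Nat.cast_ne_zero.2 k.factorial_ne_zero
      have h2 : (k : ℂ) + 1 ≠ 0 := Nat.cast_add_one_ne_zero k
      push_cast
      field_simp

/-! ### The dual bundle -/

theorem sum_of_fst_eq {I : Type*} [DecidableEq I] [Fintype I] {κ : I → Type*}
    [∀ i, Fintype (κ i)] [∀ i, DecidableEq (κ i)] {V : Type*} [AddCommMonoid V]
    (s : Finset (Σ i, κ i)) (i₀ : I) (hs : ∀ x ∈ s, x.1 = i₀) (G : (Σ i, κ i) → V) :
    ∑ x ∈ s, G x = ∑ k : κ i₀, if (⟨i₀, k⟩ : Σ i, κ i) ∈ s then G ⟨i₀, k⟩ else 0 := by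
  have h : ∑ x ∈ s, G x = ∑ x, if x ∈ s then G x else 0 := by
    rw [Finset.sum_ite_mem, Finset.univ_inter]
  rw [h, Fintype.sum_sigma, Finset.sum_eq_single i₀]
  · exact fun i _ hi => Finset.sum_eq_zero fun k _ => if_neg fun hk => hi (hs _ hk)
  · simp

section DualBundle

variable {a : Hom N A} {b : Hom N' B} (hd : IsDualPair ε N N' c) (ha : IsExtension P a)
  (hb : IsExtension P' b) {r : P → ℕ}
  {e : ∀ p : P, Module.Basis (Fin (r p)) (discAt p).K (A.Completion (discAt p))}
  {μ : ∀ p : P, Fin (r p) → ℂ}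
  (he : ∀ p : P, IsNormalBasis (A.connAt p) (e p) (μ p) fun _ => 0)
  (hμ : ∀ p i, μ p i = 0 ∨ ∀ n : ℤ, (μ p i).re ≠ n)
  (hres : ∀ p i k, ∀ n : ℤ, n ≠ 0 → μ p i - μ p k ≠ n)

theorem ne_intCast_of_re {z : ℂ} (hz : ∀ n : ℤ, z.re ≠ n) (n : ℤ) : z ≠ n := fun h =>
  hz n (by rw [h, Complex.intCast_re])

include hd ha hb he hμ hres

/-- The coordinate functionals of non-zero exponent in P are carried to infinity, with characters μ
+ εp/t. A relation therefore involves a single p and a single μ, and is carried back to a relation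
among coordinates at p. This bounds the rank of the transform from below. -/
theorem exists_linearIndependent_infty :
    ∃ g : NonzeroExponent μ → B.Completion discInfty →ₗ[discInfty.K] discInfty.K,
      (∀ x, g x ∈ horizontal (B.connInfty 0) (discInfty.chr (μ x.1 x.2.1) (ε * x.1))) ∧
        LinearIndependent discInfty.K g := by
  classical
  have hα (x : NonzeroExponent μ) : ∀ n : ℤ, μ x.1 x.2.1 ≠ n :=
    ne_intCast_of_re ((hμ x.1 x.2.1).resolve_left x.2.2)
  have hh (x : NonzeroExponent μ) : IsHorizontalAt A x.1 (μ x.1 x.2.1) ((e x.1).coord x.2.1) :=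
    isHorizontalAt_iff.2 ((he x.1).coord_mem (isConnection_connAt _) x.2.1)
  choose g hg hm using fun x => exists_matching_right hd hb (hα x) rfl (hh x) (a := a)
  have hg' (x) : g x ∈ horizontal (B.connInfty 0) (discInfty.chr (μ x.1 x.2.1) (ε * x.1)) := by
    have h := mem_horizontal_connInfty.1 (isHorizontalInfty_iff.1 (hg x))
    rwa [neg_mul, neg_neg] at h
  have hfst {x y : NonzeroExponent μ} (h : (ε : ℂ) * x.1 = ε * y.1) : x.1 = y.1 :=
    Subtype.ext (mul_left_cancel₀ (sign_ne_zero hd.sign (hα x)) h)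
  refine ⟨g, hg', linearIndependent_of_mem_horizontal hg' ?_ ?_⟩
  · rintro ⟨p, i⟩ ⟨q, k⟩ h
    obtain rfl : p = q := hfst h
    exact hres p i.1 k.1
  · rintro s w ⟨p, i₀⟩ hs hcl hsum
    have hp : ∀ x ∈ s, x.1 = p := fun x hx => hfst (hcl x hx).1
    have hαp : ∀ i, (⟨p, i⟩ : NonzeroExponent μ) ∈ s → μ p i.1 = μ p i₀.1 := fun i hi =>
      (hcl _ hi).2
    let h : A.Completion (discAt p) →ₗ[(discAt p).K] (discAt p).K :=
      ∑ i : {i // μ p i ≠ 0}, if (⟨p, i⟩ : NonzeroExponent μ) ∈ s then w ⟨p, i⟩ • (e p).coord i.1 else 0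
    have h0 : Matching ε a b c (μ p i₀.1) h 0 := by
      intro n
      rw [← hsum, LinearMap.sum_apply, sum_of_fst_eq s p hp, LinearMap.sum_apply, map_sum]
      refine Finset.sum_congr rfl fun i _ => ?_
      split_ifs with hi
      · rw [LinearMap.smul_apply, hm, LinearMap.smul_apply, map_smul, hαp i hi]
      · simp
    have h1 : h = 0 := Matching.left_unique hd ha (hα ⟨p, i₀⟩) h0 fun n => by simp
    have h2 := congrArg (fun h => h (e p i₀.1)) h1
    simp only [h, LinearMap.sum_apply, LinearMap.zero_apply] at h2
    rw [Finset.sum_eq_single i₀, if_pos hs, LinearMap.smul_apply, Module.Basis.coord_apply,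
      Module.Basis.repr_self, Finsupp.single_eq_same] at h2
    · exact (smul_eq_zero.1 h2).resolve_right one_ne_zero
    · intro i _ hi
      split_ifs
      · rw [LinearMap.smul_apply, Module.Basis.coord_apply, Module.Basis.repr_self,
          Finsupp.single_eq_of_ne (fun h => hi (Subtype.ext h)), smul_zero]
      · rfl
    · simp

end DualBundle

end WeylModule

/-! ### Functionals of exponent zero of the transform -/

namespace WeylModule

variable {N N' A B : WeylModule.{u}} {P P' Ξ : Finset ℂ} {ε : ℤ} {c : N.carrier ≃ₗ[ℂ] N'.carrier}

section Finite

variable {a : Hom N A} {b : Hom N' B} (hd : IsDualPair ε N N' c) (ha : IsExtension P a)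
  (hb : IsExtension P' b) {s : ℕ}
  {e' : Module.Basis (Fin s) discInfty.K (A.Completion discInfty)} {μ' γ' : Fin s → ℂ}
  (he' : IsNormalBasis (A.connInfty 0) e' μ' γ')

/-- The elements `n` of the lattice for which `∂ - ξ` cannot lower the order at infinity. -/
theorem mem_inftyLattice_of_d_sub (he' : IsNormalBasis (A.connInfty 0) e' μ' γ')
    (hμ' : ∀ i, ∀ n : ℤ, μ' i ≠ n) {ξ : ℂ} {m : N.carrier}
    (h : N.d m - ξ • m ∈ inftyLattice a e' 0)
    (h' : ∀ i, -γ' i = ξ → N.d m - ξ • m ∈ orderAt a (e'.coord i) 1) : m ∈ inftyLattice a e' 0 := by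
  refine mem_inftyLattice.2 fun i => ?_
  have hco (l : ℤ) : discInfty.coeff (e'.coord i (A.toCompletion discInfty
      (a.toLin (N.d m - ξ • m)))) l =
        (-γ' i - ξ) * discInfty.coeff (e'.coord i (A.toCompletion discInfty (a.toLin m))) l -
          (l - 1 + μ' i) *
            discInfty.coeff (e'.coord i (A.toCompletion discInfty (a.toLin m))) (l - 1) := by
    rw [sub_eq_add_neg, ← neg_smul, map_add, toCompletion_add, map_add, coeff_add,
      coeff_d_infty (he'.coord_mem (isConnection_connInfty 0) i), map_smul, toCompletion_smul,
      LinearMap.map_smul_of_tower, coeff_smul]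
    ring
  by_cases hi : -γ' i = ξ
  · intro l hl
    have h1 := mem_orderAt.1 (h' i hi) (l + 1) (by omega)
    rw [hco, hi, sub_self, zero_mul, zero_sub, neg_eq_zero, mul_eq_zero, add_sub_cancel_right] at h1
    refine h1.resolve_left fun h2 => hμ' i (-l) ?_
    push_cast at h2 ⊢
    linear_combination h2
  · obtain ⟨k, hk⟩ := exists_mem_inftyLattice (a := a) (e' := e') m
    have hk' := mem_inftyLattice.1 hk i
    clear hk
    induction k with
    | zero => exact hk'
    | succ k ih =>
      refine ih (orderAt_antitone (l := -(k + 1 : ℕ) + 1) (by push_cast; omega)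
        (mem_fil_of_succ hk' ?_))
      have h1 := mem_orderAt.1 (mem_inftyLattice.1 h i) (-(k + 1 : ℕ)) (by omega)
      rw [hco, mem_orderAt.1 hk' (-(k + 1 : ℕ) - 1) (by omega), mul_zero, sub_zero] at h1
      exact (mul_eq_zero.1 h1).resolve_left (sub_ne_zero.2 hi)

include hb in
/-- Horizontal functionals of exponent zero, separating sufficiently many elements. -/
theorem exists_horizontal_zero (hμ' : ∀ i, ∀ n : ℤ, μ' i ≠ n) {t : ℕ}
    (w : Module.Basis (Fin t) ℂ[X] (dualLattice hd he' (a := a))) (ξ : ℂ) {q : ℕ}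
    (hq : q + Fintype.card {i // -γ' i = ξ} ≤ t) :
    ∃ (v : Fin q → N.carrier)
      (h : Fin q → B.Completion (discAt (ε * ξ)) →ₗ[(discAt (ε * ξ)).K] (discAt (ε * ξ)).K),
      (∀ k, IsHorizontalAt B (ε * ξ) 0 (h k)) ∧ ∀ k l, (discAt (ε * ξ)).coeff
        (h k (B.toCompletion (discAt (ε * ξ)) (b.toLin (c (v l))))) 0 = if l = k then 1 else 0 := by
  classical
  let S : Submodule ℂ N.carrier := inftyLattice a e' 0
  let ι : S →ₗ[ℂ] dualLattice hd he' (a := a) :=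
    { toFun := fun n => ⟨N'.toPoly (c n.1), (mem_dualLattice hd he').2 n.2⟩
      map_add' := fun n m => Subtype.ext (by
        change N'.toPoly (c (n.1 + m.1)) = N'.toPoly (c n.1) + N'.toPoly (c m.1)
        rw [map_add, map_add])
      map_smul' := fun x n => Subtype.ext (by
        change N'.toPoly (c (x • n.1)) = x • N'.toPoly (c n.1)
        rw [map_smul, map_smul]) }
  -- The reduction of the lattice to its fibre at x' = εξ, in the basis w. It is surjective and
  -- kills ∂m − ξm for m in the lattice.
  let E : S →ₗ[ℂ] (Fin t → ℂ) := LinearMap.pi fun i =>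
    (Polynomial.aeval ((ε : ℂ) * ξ)).toLinearMap ∘ₗ (w.coord i).restrictScalars ℂ ∘ₗ ι
  have hE (n : S) (i : Fin t) : E n i = (w.repr (ι n) i).eval ((ε : ℂ) * ξ) := by
    change Polynomial.aeval ((ε : ℂ) * ξ) (w.repr (ι n) i) = _
    rw [Polynomial.coe_aeval_eq_eval]
  have hEsurj : Function.Surjective E := by
    intro y
    obtain ⟨n, hn, hn'⟩ := (∑ i, Polynomial.C (y i) • w i).2
    refine ⟨⟨n, hn⟩, funext fun i => ?_⟩
    have h1 : ι ⟨n, hn⟩ = ∑ i, Polynomial.C (y i) • w i := Subtype.ext hn'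
    rw [hE, h1, map_sum, Finsupp.coe_finsetSum, Finset.sum_apply, Finset.sum_eq_single i]
    · simp
    · intro l _ hl
      rw [map_smul, w.repr_self, Finsupp.smul_apply, Finsupp.single_eq_of_ne hl.symm, smul_zero]
    · simp
  have hEd (m : N.carrier) (hm : m ∈ S) (hm' : N.d m - ξ • m ∈ S) : E ⟨_, hm'⟩ = 0 := by
    funext i
    have h1 : ι ⟨_, hm'⟩ = (Polynomial.X - Polynomial.C ((ε : ℂ) * ξ)) •
        (Polynomial.C (ε : ℂ) • ι ⟨m, hm⟩) := by
      refine Subtype.ext ?_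
      change N'.toPoly (c (N.d m - ξ • m)) = (Polynomial.X - Polynomial.C ((ε : ℂ) * ξ)) •
        (Polynomial.C (ε : ℂ) • N'.toPoly (c m))
      rw [smul_toPoly, smul_toPoly, aeval_X_sub_C, Polynomial.aeval_C, Module.algebraMap_end_apply,
        ← map_smul c, LinearMap.sub_apply, hd.x_apply, LinearMap.smul_apply, Module.End.one_apply,
        ← map_smul c, ← map_smul c, map_smul N.d, smul_smul, hd.sq, one_smul, smul_smul,
        mul_right_comm, hd.sq, one_mul, map_sub]
    rw [hE, h1, map_smul, Finsupp.smul_apply, smul_eq_mul, Polynomial.eval_mul]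
    simp
  -- Leading coefficients along the components at infinity with eigenvalue ξ. If ∂m − ξm is in the
  -- lattice and they vanish on it, m is itself in the lattice.
  let G : S →ₗ[ℂ] ({i // -γ' i = ξ} → ℂ) := LinearMap.pi fun i =>
    discInfty.coeffₗ 0 ∘ₗ (e'.coord i.1).restrictScalars ℂ ∘ₗ A.toCompletionC discInfty ∘ₗ
      a.toLin ∘ₗ S.subtype
  have hG (n : S) (hn : G n = 0) (i) (hi : -γ' i = ξ) : n.1 ∈ orderAt a (e'.coord i) 1 :=
    mem_fil_of_succ (mem_inftyLattice.1 n.2 i) (congrFun hn (⟨i, hi⟩ : {i // -γ' i = ξ}))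
  -- Since S/ker G surjects onto the cokernel of `W` in the fibre, the codimension of `W` is at most
  -- the number of these components.
  let W : Submodule ℂ (Fin t → ℂ) := (LinearMap.ker G).map E
  have hW : q ≤ Module.finrank ℂ W := by
    have h1 := Submodule.finrank_quotient_add_finrank W
    rw [Module.finrank_fin_fun] at h1
    have h2 : Module.finrank ℂ ((Fin t → ℂ) ⧸ W) ≤ Fintype.card {i // -γ' i = ξ} := by
      let f : (S ⧸ LinearMap.ker G) →ₗ[ℂ] ((Fin t → ℂ) ⧸ W) :=
        (LinearMap.ker G).mapQ W E (Submodule.le_comap_map _ _)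
      have hf : Function.Surjective f := by
        intro y
        obtain ⟨y, rfl⟩ := W.mkQ_surjective y
        obtain ⟨n, rfl⟩ := hEsurj y
        exact ⟨(LinearMap.ker G).mkQ n, rfl⟩
      have : Module.Finite ℂ (S ⧸ LinearMap.ker G) :=
        Module.Finite.equiv G.quotKerEquivRange.symm
      refine (LinearMap.finrank_le_finrank_of_surjective hf).trans ?_
      rw [LinearEquiv.finrank_eq G.quotKerEquivRange]
      exact (Submodule.finrank_le _).trans (by simp)
    omega
  have hex (k : Fin q) : ∃ n : S, G n = 0 ∧ E n = ((Module.finBasis ℂ W) (Fin.castLE hW k)).1 :=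
    ((Module.finBasis ℂ W) (Fin.castLE hW k)).2
  choose v hvG hvE using hex
  let Y : Submodule ℂ N.carrier := LinearMap.range (N.d - ξ • 1)
  -- Lifts of the chosen basis vectors of `W` remain independent modulo (∂ − ξ)N: if a combination
  -- equals (∂ − ξ)m, then m is in the lattice and the combination is zero in the fibre.
  have hker : LinearMap.ker (Y.mkQ ∘ₗ Fintype.linearCombination ℂ fun k => (v k).1) = ⊥ := by
    rw [LinearMap.ker_eq_bot']
    intro x hx
    rw [LinearMap.comp_apply, Submodule.mkQ_apply, Submodule.Quotient.mk_eq_zero,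
      Fintype.linearCombination_apply] at hx
    obtain ⟨m, hm⟩ := hx
    have hm1 : N.d m - ξ • m = (∑ k, x k • v k : S).1 := by
      rw [Submodule.coe_sum]
      exact hm
    have hS : N.d m - ξ • m ∈ S := hm1 ▸ (∑ k, x k • v k : S).2
    have hm2 : (⟨_, hS⟩ : S) = ∑ k, x k • v k := Subtype.ext hm1
    have hG0 : G ⟨_, hS⟩ = 0 := by
      rw [hm2, map_sum]
      exact Finset.sum_eq_zero fun k _ => by rw [map_smul, hvG, smul_zero]
    have h1 := hEd m (mem_inftyLattice_of_d_sub he' hμ' hS fun i hi => hG ⟨_, hS⟩ hG0 i hi) hS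
    rw [hm2, map_sum] at h1
    have h2 : ∑ k, x k • (Module.finBasis ℂ W) (Fin.castLE hW k) = 0 := by
      refine Subtype.ext ?_
      rw [Submodule.coe_sum, Submodule.coe_zero, ← h1]
      exact Finset.sum_congr rfl fun k _ => by rw [map_smul, hvE, Submodule.coe_smul]
    exact funext (Fintype.linearIndependent_iff.1 ((Module.finBasis ℂ W).linearIndependent.comp _
      (Fin.castLE_injective hW)) x h2)
  obtain ⟨φ, hφ⟩ := LinearMap.exists_leftInverse_of_injective _ hker
  have hφv (k l : Fin q) : φ (Y.mkQ (v l).1) k = if l = k then 1 else 0 := by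
    have h1 := congrFun (LinearMap.congr_fun hφ (Pi.single l 1)) k
    rw [LinearMap.comp_apply, LinearMap.comp_apply, Fintype.linearCombination_apply_single, one_smul,
      LinearMap.id_apply, Pi.single_apply] at h1
    rw [h1]
    exact if_congr eq_comm rfl rfl
  -- The dual functionals factor through N'/(x' − εξ)N', so their Taylor series are solutions.
  let ψ (k : Fin q) : N'.carrier →ₗ[ℂ] ℂ :=
    LinearMap.proj k ∘ₗ φ ∘ₗ Y.mkQ ∘ₗ c.symm.toLinearMap
  have hψ (k : Fin q) (n : N.carrier) : ψ k (c n) = φ (Y.mkQ n) k := by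
    change φ (Y.mkQ (c.symm (c n))) k = _
    rw [LinearEquiv.symm_apply_apply]
  have hψx (k : Fin q) (m : N'.carrier) : ψ k (N'.x m) = (ε : ℂ) * ξ * ψ k m := by
    obtain ⟨n, rfl⟩ := c.surjective m
    have h1 : Y.mkQ (N.d n) = ξ • Y.mkQ n := by
      rw [← sub_eq_zero, ← map_smul, ← map_sub, Submodule.mkQ_apply, Submodule.Quotient.mk_eq_zero]
      exact ⟨n, rfl⟩
    rw [hd.x_apply, ← map_smul c, hψ, hψ, map_smul, h1, map_smul, map_smul, smul_smul]
    rfl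
  choose h hh hh' using fun k => (isSolution_taylorSeries (hψx k)).exists_lift (isRegular_discAt _) hb
  refine ⟨fun k => (v k).1, h, fun k u => ?_, fun k l => ?_⟩
  · rw [hh', zero_smul]
  · rw [hh]
    have h1 := coeff_taylorSeries (ζ := (ε : ℂ) * ξ) (φ := ψ k) (c (v l).1) 0
    rw [Nat.cast_zero] at h1
    rw [h1, pow_zero, Module.End.one_apply, Nat.factorial_zero, Nat.cast_one, div_one, hψ, hφv]

end Finite

end WeylModule

/-! ### The transform is a bundle of the type considered -/

namespace WeylModule

variable {N N' A B : WeylModule.{u}} {P P' Ξ : Finset ℂ} {ε : ℤ} {c : N.carrier ≃ₗ[ℂ] N'.carrier}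

theorem sum_of_inl {I J V : Type*} [Fintype I] [Fintype J] [DecidableEq I] [DecidableEq J]
    [AddCommMonoid V] (s : Finset (I ⊕ J)) (hs : ∀ j, Sum.inr j ∉ s) (G : I ⊕ J → V) :
    ∑ x ∈ s, G x = ∑ i, if Sum.inl i ∈ s then G (Sum.inl i) else 0 := by
  have h : ∑ x ∈ s, G x = ∑ x, if x ∈ s then G x else 0 := by
    rw [Finset.sum_ite_mem, Finset.univ_inter]
  rw [h, Fintype.sum_sum_type]
  simp [hs]

theorem sum_of_inr {I J V : Type*} [Fintype I] [Fintype J] [DecidableEq I] [DecidableEq J]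
    [AddCommMonoid V] (s : Finset (I ⊕ J)) (hs : ∀ i, Sum.inl i ∉ s) (G : I ⊕ J → V) :
    ∑ x ∈ s, G x = ∑ j, if Sum.inr j ∈ s then G (Sum.inr j) else 0 := by
  have h : ∑ x ∈ s, G x = ∑ x, if x ∈ s then G x else 0 := by
    rw [Finset.sum_ite_mem, Finset.univ_inter]
  rw [h, Fintype.sum_sum_type]
  simp [hs]

section Finite

variable {a : Hom N A} {b : Hom N' B} (hd : IsDualPair ε N N' c) (ha : IsExtension P a)
  (hb : IsExtension P' b) {s : ℕ}
  {e' : Module.Basis (Fin s) discInfty.K (A.Completion discInfty)} {μ' γ' : Fin s → ℂ}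
  (he' : IsNormalBasis (A.connInfty 0) e' μ' γ')
include hd ha hb he'

/-- Functionals coming from infinity have non-integral exponents, the others exponent zero, so a
relation splits. Relations of the first kind are carried back to coordinates at infinity; those of
the second are tested on the vectors v. -/
theorem exists_linearIndependent_at (hμ' : ∀ i, ∀ n : ℤ, (μ' i).re ≠ n)
    (hres : ∀ i k, γ' i = γ' k → ∀ n : ℤ, n ≠ 0 → μ' i - μ' k ≠ n) (ξ : ℂ) {q : ℕ}
    {v : Fin q → N.carrier}
    {h₀ : Fin q → B.Completion (discAt (ε * ξ)) →ₗ[(discAt (ε * ξ)).K] (discAt (ε * ξ)).K}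
    (hh₀ : ∀ k, IsHorizontalAt B (ε * ξ) 0 (h₀ k)) (hv : ∀ k l, (discAt (ε * ξ)).coeff
        (h₀ k (B.toCompletion (discAt (ε * ξ)) (b.toLin (c (v l))))) 0 = if l = k then 1 else 0) :
    ∃ (h : {i // -γ' i = ξ} ⊕ Fin q →
        B.Completion (discAt (ε * ξ)) →ₗ[(discAt (ε * ξ)).K] (discAt (ε * ξ)).K)
      (α : {i // -γ' i = ξ} ⊕ Fin q → ℂ),
      (∀ x, α x = 0 ∨ ∀ n : ℤ, (α x).re ≠ n) ∧ (∀ x y, ∀ n : ℤ, n ≠ 0 → α x - α y ≠ n) ∧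
      (∀ x, h x ∈ horizontal (B.connAt (ε * ξ)) ((discAt (ε * ξ)).chr (α x) 0)) ∧
        LinearIndependent (discAt (ε * ξ)).K h := by
  classical
  have hα (i : {i // -γ' i = ξ}) : ∀ n : ℤ, μ' i ≠ n := ne_intCast_of_re (hμ' i)
  have hg (i : {i // -γ' i = ξ}) : IsHorizontalInfty A ξ (μ' i) (e'.coord i.1) := by
    have h := he'.coord_mem (isConnection_connInfty 0) i.1
    rw [← neg_neg (γ' i.1), i.2] at h
    exact isHorizontalInfty_iff.2 (mem_horizontal_connInfty.2 h)
  have hξ : ξ = -((-ε : ℤ) : ℂ) * (ε * ξ) := by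
    push_cast
    linear_combination -ξ * hd.sq
  choose h₁ hh₁ hm using fun i => exists_matching_left hd.symm hb (hα i) hξ (hg i) (b := a)
  let h := Sum.elim h₁ h₀
  let α : {i // -γ' i = ξ} ⊕ Fin q → ℂ := Sum.elim (fun i => μ' i) fun _ => 0
  have h1 : ∀ x, α x = 0 ∨ ∀ n : ℤ, (α x).re ≠ n := by
    rintro (i | k)
    · exact Or.inr (hμ' i)
    · exact Or.inl rfl
  have h2 : ∀ x y, ∀ n : ℤ, n ≠ 0 → α x - α y ≠ n := by
    rintro (i | i) (k | k) n hn
    · exact hres i k (neg_injective (i.2.trans k.2.symm)) n hn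
    · change μ' i - 0 ≠ n
      rw [sub_zero]
      exact hα i n
    · change 0 - μ' k ≠ n
      intro h
      exact hα k (-n) (by push_cast; linear_combination -h)
    · change (0 : ℂ) - 0 ≠ n
      rw [sub_zero]
      exact_mod_cast hn.symm
  have h3 : ∀ x, h x ∈ horizontal (B.connAt (ε * ξ)) ((discAt (ε * ξ)).chr (α x) 0) := by
    rintro (i | k)
    · exact isHorizontalAt_iff.1 (hh₁ i)
    · exact isHorizontalAt_iff.1 (hh₀ k)
  refine ⟨h, α, h1, h2, h3, linearIndependent_of_mem_horizontal h3 (fun x y _ => h2 x y) ?_⟩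
  rintro S w (i₀ | k₀) hS hcl hsum
  · have hS' : ∀ k, Sum.inr k ∉ S := fun k hk => hα i₀ 0 (by
      rw [Int.cast_zero]
      exact (hcl _ hk).2.symm)
    have hαi : ∀ i, Sum.inl i ∈ S → μ' i.1 = μ' i₀.1 := fun i hi => (hcl _ hi).2
    let g : A.Completion discInfty →ₗ[discInfty.K] discInfty.K :=
      ∑ i : {i // -γ' i = ξ}, if Sum.inl i ∈ S then w (Sum.inl i) • e'.coord i.1 else 0
    have h0 : Matching (p := ε * ξ) (-ε) b a c.symm (μ' i₀.1) 0 g := by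
      intro n
      rw [← hsum, LinearMap.sum_apply, sum_of_inl S hS', LinearMap.sum_apply, map_sum]
      refine Finset.sum_congr rfl fun i _ => ?_
      split_ifs with hi
      · rw [LinearMap.smul_apply, hm, LinearMap.smul_apply, map_smul, hαi i hi]
        rfl
      · simp
    have h4 : g = 0 := Matching.right_unique hd.symm ha h0 fun n => by simp
    have h5 := congrArg (fun g => g (e' i₀.1)) h4
    simp only [g, LinearMap.sum_apply, LinearMap.zero_apply] at h5
    rw [Finset.sum_eq_single i₀, if_pos hS, LinearMap.smul_apply, Module.Basis.coord_apply,
      Module.Basis.repr_self, Finsupp.single_eq_same] at h5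
    · exact (smul_eq_zero.1 h5).resolve_right one_ne_zero
    · intro i _ hi
      split_ifs
      · rw [LinearMap.smul_apply, Module.Basis.coord_apply, Module.Basis.repr_self,
          Finsupp.single_eq_of_ne (fun h => hi (Subtype.ext h)), smul_zero]
      · rfl
    · simp
  · have hS' : ∀ i, Sum.inl i ∉ S := fun i hi => hα i 0 (by
      rw [Int.cast_zero]
      exact (hcl _ hi).2)
    have h5 := congrArg (fun g => (discAt (ε * ξ)).coeff (g (B.toCompletion (discAt (ε * ξ))
      (b.toLin (c (v k₀))))) 0) hsum
    simp only [LinearMap.zero_apply] at h5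
    rw [LinearMap.sum_apply, coeff_sum, sum_of_inr S hS', Finset.sum_eq_single k₀, if_pos hS,
      LinearMap.smul_apply, coeff_smul] at h5
    · change w (Sum.inr k₀) * (discAt (ε * ξ)).coeff (h₀ k₀ _) 0 = 0 at h5
      rwa [hv, if_pos rfl, mul_one] at h5
    · intro k _ hk
      split_ifs
      · rw [LinearMap.smul_apply, coeff_smul]
        change w (Sum.inr k) * (discAt (ε * ξ)).coeff (h₀ k _) 0 = 0
        rw [hv, if_neg hk.symm, mul_zero]
      · rfl
    · simp

end Finite

/-- The Laplace transform of a meromorphic bundle of the type considered is one. -/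
theorem isMeromorphicBundle_of_dual {a : Hom N A} {b : Hom N' B} (hd : IsDualPair ε N N' c)
    (hA : IsMeromorphicBundle P Ξ A) (ha : IsExtension P a) (hinj : Function.Injective a.toLin)
    (hreg : ∀ n, a.toLin n ∈ A.regularPart P)
    (hb : IsExtension (Ξ.image fun ξ => (ε : ℂ) * ξ) b) :
    IsMeromorphicBundle (Ξ.image fun ξ => (ε : ℂ) * ξ) (P.image fun p => -(ε : ℂ) * p) B := by
  classical
  obtain ⟨s, e', μ', γ', he', hγ', hμ', hres'⟩ := hA.infinity.exists_isNormalBasis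
  choose r e μ he hμ hres using fun p : P => (hA.logarithmic p p.2).exists_isNormalBasis
  have hni : HasNonintegralExponents A := ⟨s, e', μ', γ', he', fun i => ne_intCast_of_re (hμ' i)⟩
  have := isTorsionFree_of_finite (isUnit_aeval_polePoly hA.invertible) hA.finite
  have htf : Module.IsTorsionFree ℂ[X] N'.poly :=
    isTorsionFree_of_injective (x_sub_injective_of_dual hd hni hinj)
  have hfg := dualLattice_fg hd he' he hreg hA hinj
    fun p i hi => ne_intCast_of_re ((hμ p i).resolve_left hi)
  let L := dualLattice hd he' (a := a)
  have : Module.Finite ℂ[X] L := Module.Finite.iff_fg.2 hfg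
  obtain ⟨t, w⟩ : Σ t, Module.Basis (Fin t) ℂ[X] L := Module.basisOfFiniteTypeTorsionFree'
  have hle := rank_dualLattice_le hd he' he hreg hA hinj w
  have hu : IsUnit (Polynomial.aeval B.x (polePoly (Ξ.image fun ξ => (ε : ℂ) * ξ))) := by
    simpa using IsExtension.isUnit hb 1
  have hbinj : Function.Injective b.toLin := by
    rw [injective_iff_map_eq_zero]
    intro n hn
    obtain ⟨k, hk⟩ := IsExtension.exists_ker hb hn
    exact N'.toPoly.map_eq_zero_iff.1 (isTorsionFree_iff.1 htf _ _
      (pow_ne_zero k (polePoly_ne_zero _)) (by rw [smul_toPoly, hk, map_zero]))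
  let f : L →ₗ[ℂ[X]] B.poly := b.polyMap ∘ₗ L.subtype
  have hfinj : Function.Injective f := fun x y h => Subtype.ext (by
    obtain ⟨x', hx⟩ := N'.toPoly.surjective x.1
    obtain ⟨y', hy⟩ := N'.toPoly.surjective y.1
    have h' : b.polyMap x.1 = b.polyMap y.1 := h
    rw [← hx, ← hy, Hom.polyMap_toPoly, Hom.polyMap_toPoly] at h'
    rw [← hx, ← hy, hbinj (B.toPoly.injective h')])
  have hfs (m : B.poly) : ∃ (k : ℕ) (l : L),
      (polePoly (Ξ.image fun ξ => (ε : ℂ) * ξ) ^ k) • m = f l := by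
    obtain ⟨m, rfl⟩ := B.toPoly.surjective m
    obtain ⟨k, n, hn⟩ := IsExtension.exists_eq hb m
    obtain ⟨l, hl⟩ := exists_smul_mem_dualLattice hd he' hγ' (N'.toPoly n)
    refine ⟨l + k, ⟨_, hl⟩, ?_⟩
    change _ = b.polyMap (polePoly (Ξ.image fun ξ => (ε : ℂ) * ξ) ^ l • N'.toPoly n)
    rw [map_smul, Hom.polyMap_toPoly, ← hn, pow_add, mul_smul, smul_toPoly]
  have hloc := isLocalizedModule_of f hfinj hu hfs
  -- A basis of the lattice is a basis of every completion, so all completions have the same rank t.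
  have hrank {Δ : FormalDisc} {κ : Δ.K} (hΔ : Δ.IsRegular κ) :
      FiniteDimensional Δ.K (B.Completion Δ) ∧ Module.finrank Δ.K (B.Completion Δ) = t := by
    obtain ⟨f, -⟩ := exists_basis_completion hΔ (P := Ξ.image fun ξ => (ε : ℂ) * ξ) f w
    exact ⟨Module.Finite.of_basis f, by rw [Module.finrank_eq_card_basis f, Fintype.card_fin]⟩
  refine ⟨fun p hp => isUnit_of_isUnit_aeval_polePoly hu hp, ?_, ?_, ?_⟩
  · refine ⟨LinearMap.range f, ?_, fun m => ?_⟩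
    · rw [LinearMap.range_eq_map]
      exact (Module.finite_def.1 inferInstance).map f
    · obtain ⟨k, l, hl⟩ := hfs m
      exact ⟨k, l, hl.symm⟩
  · intro p hp
    obtain ⟨ξ, hξ, rfl⟩ := Finset.mem_image.1 hp
    obtain ⟨hfd, hfr⟩ := hrank (isRegular_discAt (ε * ξ))
    -- The subtraction is truncated, but the independence obtained below also excludes more than t
    -- components, so the total count is exactly t.
    obtain ⟨q, hq⟩ : ∃ q, q = t - Fintype.card {i // -γ' i = ξ} := ⟨_, rfl⟩
    have hex : ∃ (v : Fin q → N.carrier)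
      (h : Fin q → B.Completion (discAt (ε * ξ)) →ₗ[(discAt (ε * ξ)).K] (discAt (ε * ξ)).K),
      (∀ k, IsHorizontalAt B (ε * ξ) 0 (h k)) ∧ ∀ k l, (discAt (ε * ξ)).coeff
        (h k (B.toCompletion (discAt (ε * ξ)) (b.toLin (c (v l))))) 0 = if l = k then 1 else 0 := by
      by_cases h : Fintype.card {i // -γ' i = ξ} ≤ t
      · exact exists_horizontal_zero hd hb he' (fun i => ne_intCast_of_re (hμ' i)) w ξ (by omega)
      · have hq0 : q = 0 := by omega
        subst hq0
        exact ⟨fun k => k.elim0, fun k => k.elim0, fun k => k.elim0, fun k => k.elim0⟩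
    obtain ⟨v, h₀, hh₀, hv⟩ := hex
    obtain ⟨h, α, h1, h2, h3, hli⟩ := exists_linearIndependent_at hd ha hb he' hμ' hres' ξ hh₀ hv
    have hc := hli.fintype_card_le_finrank
    rw [Subspace.dual_finrank_eq, hfr, Fintype.card_sum, Fintype.card_fin] at hc
    obtain ⟨f, hf, -⟩ := exists_isNormalBasis_of_horizontal h3 hli
      (by rw [hfr, Fintype.card_sum, Fintype.card_fin]; omega)
    exact hasLogLattice_of_isNormalBasis hf h1 h2
  · obtain ⟨hfd, hfr⟩ := hrank isRegular_discInfty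
    obtain ⟨g, hg, hli⟩ := exists_linearIndependent_infty hd ha hb he hμ hres
    have hc := hli.fintype_card_le_finrank
    rw [Subspace.dual_finrank_eq, hfr] at hc
    -- Independence gives the inequality opposite to `hle`, so the functionals form a basis of the
    -- dual.
    obtain ⟨f, hf, -⟩ := exists_isNormalBasis_of_horizontal hg hli (by rw [hfr]; omega)
    refine hasRankOneLattice_of_isNormalBasis hf (fun x => ?_)
      (fun x => (hμ x.1 x.2.1).resolve_left x.2.2) ?_
    · rw [← neg_mul]
      exact Finset.mem_image_of_mem _ x.1.2
    · rintro ⟨p, i⟩ ⟨q, k⟩ h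
      have hε : (ε : ℂ) ≠ 0 := left_ne_zero_of_mul_eq_one hd.sq
      obtain rfl : p = q := Subtype.ext (mul_left_cancel₀ hε h)
      exact hres p i.1 k.1

end WeylModule

/-! ### Shift of the exponents -/

namespace FormalDisc

variable {Δ : FormalDisc} {V : Type*} [AddCommGroup V] [Module Δ.K V] [Module ℂ V]
  [IsScalarTower ℂ Δ.K V]

theorem t_zpow_smul_mem_horizontal {D : V →ₗ[ℂ] V} {α : ℂ} {h : V →ₗ[Δ.K] Δ.K}
    (hh : h ∈ horizontal D (Δ.chr α 0)) (n : ℤ) :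
    Δ.t ^ n • h ∈ horizontal D (Δ.chr (α - n) 0) := by
  intro u
  rw [LinearMap.smul_apply, LinearMap.smul_apply, hh u, smul_eq_mul, smul_eq_mul, theta_mul,
    theta_t_zpow, Algebra.smul_def]
  simp only [chr, zero_smul, add_zero, map_sub, map_intCast]
  ring

end FormalDisc

namespace WeylModule

section Shift

variable {ε : ℤ} {N N' A B : WeylModule.{u}} {c : N.carrier ≃ₗ[ℂ] N'.carrier}
  {a : Hom N A} {b : Hom N' B} {p ξ α : ℂ}

/-- Multiplication by t^m lowers α by m and raises the index by m; the argument of Γ is unchanged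
and only the sign ε^m appears. -/
theorem Matching.shift (hε : (ε : ℂ) * ε = 1) (m : ℤ)
    {h : A.Completion (discAt p) →ₗ[(discAt p).K] (discAt p).K}
    {g : B.Completion discInfty →ₗ[discInfty.K] discInfty.K} (H : Matching ε a b c α h g) :
    Matching ε a b c (α - m) ((discAt p).t ^ m • h) (((ε : ℂ) ^ m) • discInfty.t ^ m • g) := by
  rw [matching_iff] at H ⊢
  intro n k
  have hε0 : (ε : ℂ) ≠ 0 := left_ne_zero_of_mul_eq_one hε
  have h1 := H n (k - m)
  rw [LinearMap.smul_apply, LinearMap.smul_apply, LinearMap.smul_apply, coeff_smul, smul_eq_mul,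
    smul_eq_mul, coeff_t_zpow_mul, coeff_t_zpow_mul, show k + 1 - m = k - m + 1 by ring, h1,
    zpow_sub₀ hε0]
  push_cast
  rw [show α + (k - m) + 1 = α - m + k + 1 by ring]
  field_simp

variable {ι ι' : Type*} [Fintype ι] [Fintype ι']
  {e : Module.Basis ι (discAt p).K (A.Completion (discAt p))} {μ γ : ι → ℂ}
  {e' : Module.Basis ι' discInfty.K (B.Completion discInfty)} {μ' γ' : ι' → ℂ}

/-- Provides the compatibility of transported filtrations with the local coordinates; the sign ε is
invisible to subspaces. -/
theorem stationaryPhase_shift (hε : (ε : ℂ) * ε = 1) (he : IsNormalBasis (A.connAt p) e μ γ)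
    (he' : IsNormalBasis (B.connInfty ξ) e' μ' γ')
    {u : A.Completion (discAt p)} {v : B.Completion discInfty} :
    StationaryPhase ε A B a.toLin (fun n => b.toLin (c n)) p ξ α u v ↔
      StationaryPhase ε A B a.toLin (fun n => b.toLin (c n)) p ξ (α + 1)
        ((discAt p).t • u) ((ε : ℂ) • discInfty.t • v) := by
  have hε0 : (ε : ℂ) ≠ 0 := left_ne_zero_of_mul_eq_one hε
  have hinv : (ε : ℂ)⁻¹ = ε := inv_eq_of_mul_eq_one_left hε
  rw [stationaryPhase_iff, stationaryPhase_iff]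
  have h1 : (discAt p).t • u ∈ A.psi p (α + 1) ↔ u ∈ A.psi p α :=
    he.t_smul_mem_iff (isConnection_connAt p)
  have h2 : (ε : ℂ) • discInfty.t • v ∈ B.psiInfty ξ (α + 1) ↔ v ∈ B.psiInfty ξ α := by
    rw [Submodule.smul_mem_iff _ hε0]
    exact he'.t_smul_mem_iff (isConnection_connInfty ξ)
  rw [h1, h2]
  refine and_congr_right fun _ => and_congr_right fun _ => ⟨fun H h g hm => ?_, fun H h g hm => ?_⟩
  · have hm' := hm.shift hε 1
    have hh := t_zpow_smul_mem_horizontal h.2 1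
    have hg := Submodule.smul_mem _ ((ε : ℂ) ^ (1 : ℤ)) (t_zpow_smul_mem_horizontal g.2 1)
    rw [Int.cast_one, add_sub_cancel_right] at hm' hh hg
    have h3 := H ⟨_, hh⟩ ⟨_, hg⟩ hm'
    rw [map_smul, LinearMap.map_smul_of_tower, map_smul]
    simpa [smul_eq_mul] using h3
  · have hm' := hm.shift hε (-1)
    have hh := t_zpow_smul_mem_horizontal h.2 (-1)
    have hg := Submodule.smul_mem _ ((ε : ℂ) ^ (-1 : ℤ)) (t_zpow_smul_mem_horizontal g.2 (-1))
    rw [Int.cast_neg, Int.cast_one, sub_neg_eq_add] at hm' hh hg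
    have h3 := H ⟨_, hh⟩ ⟨_, hg⟩ hm'
    simp only [LinearMap.smul_apply, map_smul, LinearMap.map_smul_of_tower, smul_eq_mul, zpow_neg_one,
      coeff_smul, hinv] at h3
    rw [mul_inv_cancel_left₀ (t_ne_zero _), mul_smul_comm, coeff_smul,
      inv_mul_cancel_left₀ (t_ne_zero _), ← mul_assoc, hε, one_mul] at h3
    exact h3

end Shift

/-! ### Functoriality -/

section Functoriality

variable {M M' : WeylModule.{u}} {Δ : FormalDisc}

/-- The identity. -/
def Hom.id (M : WeylModule.{u}) : Hom M M where
  toLin := LinearMap.id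
  map_x _ := rfl
  map_d _ := rfl

theorem Hom.completionMap_id (u : M.Completion Δ) : (Hom.id M).completionMap Δ u = u := by
  have h : (Hom.id M).polyMap = LinearMap.id := LinearMap.ext fun _ => rfl
  change TensorProduct.AlgebraTensorModule.lTensor Δ.K Δ.K (Hom.id M).polyMap u = u
  rw [h, TensorProduct.AlgebraTensorModule.lTensor_id]
  rfl

/-- The map of completions, linear over the field of Laurent series. -/
noncomputable def Hom.completionMapK (f : Hom M M') (Δ : FormalDisc) :
    M.Completion Δ →ₗ[Δ.K] M'.Completion Δ :=
  TensorProduct.AlgebraTensorModule.lTensor Δ.K Δ.K f.polyMap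

theorem Hom.completionMap_eq (f : Hom M M') (u : M.Completion Δ) :
    f.completionMap Δ u = f.completionMapK Δ u := rfl

theorem Hom.completionMapK_nabla (f : Hom M M') (u : M.Completion Δ) :
    f.completionMapK Δ (M.nabla Δ u) = M'.nabla Δ (f.completionMapK Δ u) := by
  induction u using TensorProduct.induction_on with
  | zero => rw [map_zero, map_zero, map_zero]
  | add x y hx hy => rw [map_add, map_add, hx, hy, map_add, map_add]
  | tmul x m =>
    have h (y : Δ.K) (m : M.poly) : f.completionMapK Δ (y ⊗ₜ m) = y ⊗ₜ f.polyMap m := rfl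
    obtain ⟨m, rfl⟩ := M.toPoly.surjective m
    rw [nabla_tmul, map_add, h, h, h, nabla_tmul, dPoly_toPoly, Hom.polyMap_toPoly,
      Hom.polyMap_toPoly, dPoly_toPoly, f.map_d]

theorem Hom.completionMap_leftInverse {f : Hom M M'} {g : Hom M' M}
    (h : ∀ m, g.toLin (f.toLin m) = m) (u : M.Completion Δ) :
    g.completionMap Δ (f.completionMap Δ u) = u := by
  rw [completionMap_eq, completionMap_eq]
  induction u using TensorProduct.induction_on with
  | zero => rw [map_zero, map_zero]
  | add x y hx hy => rw [map_add, map_add, hx, hy]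
  | tmul x m =>
    have h1 (y : Δ.K) (m : M.poly) : f.completionMapK Δ (y ⊗ₜ m) = y ⊗ₜ f.polyMap m := rfl
    have h2 (y : Δ.K) (m : M'.poly) : g.completionMapK Δ (y ⊗ₜ m) = y ⊗ₜ g.polyMap m := rfl
    obtain ⟨m, rfl⟩ := M.toPoly.surjective m
    rw [h1, h2, Hom.polyMap_toPoly, Hom.polyMap_toPoly, h]

theorem mem_maxGenEigenspace_of_commute {V V' : Type*} [AddCommGroup V] [Module ℂ V]
    [AddCommGroup V'] [Module ℂ V'] {D : Module.End ℂ V} {D' : Module.End ℂ V'} {f : V →ₗ[ℂ] V'}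
    (hf : ∀ u, f (D u) = D' (f u)) {α : ℂ} {u : V} (hu : u ∈ D.maxGenEigenspace α) :
    f u ∈ D'.maxGenEigenspace α := by
  rw [Module.End.mem_maxGenEigenspace] at hu ⊢
  obtain ⟨k, hk⟩ := hu
  refine ⟨k, ?_⟩
  have h (k : ℕ) (u : V) : ((D' - α • (1 : Module.End ℂ V')) ^ k) (f u) =
      f (((D - α • (1 : Module.End ℂ V)) ^ k) u) := by
    induction k generalizing u with
    | zero => rfl
    | succ k ih =>
      have h1 : (D' - α • (1 : Module.End ℂ V')) (f u) = f ((D - α • (1 : Module.End ℂ V)) u) := by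
        simp [hf]
      rw [pow_succ, Module.End.mul_apply, pow_succ, Module.End.mul_apply, h1, ih]
  rw [h, hk, map_zero]

theorem Hom.map_psi (f : Hom M M') {p α : ℂ} {u : M.Completion (discAt p)} (hu : u ∈ M.psi p α) :
    f.completionMap (discAt p) u ∈ M'.psi p α := by
  refine mem_maxGenEigenspace_of_commute (fun u => ?_) hu
  change f.completionMapK (discAt p) ((discAt p).t • M.nabla (discAt p) u) =
    (discAt p).t • M'.nabla (discAt p) (f.completionMapK (discAt p) u)
  rw [map_smul, Hom.completionMapK_nabla]

theorem Hom.map_psiInfty (f : Hom M M') {ξ α : ℂ} {u : M.Completion discInfty}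
    (hu : u ∈ M.psiInfty ξ α) : f.completionMap discInfty u ∈ M'.psiInfty ξ α := by
  refine mem_maxGenEigenspace_of_commute (fun u => ?_) hu
  change f.completionMapK discInfty (-(discInfty.t⁻¹ • (M.nabla discInfty u - ξ • u))) =
    -(discInfty.t⁻¹ • (M'.nabla discInfty (f.completionMapK discInfty u) -
      ξ • f.completionMapK discInfty u))
  rw [map_neg, map_smul, map_sub, Hom.completionMapK_nabla, LinearMap.map_smul_of_tower]

/-- Formal stationary phase is compatible with homomorphisms. -/
theorem stationaryPhase_map {ε : ℤ} {N N' : Type u} {A B A' B' : WeylModule.{u}} {a : N → A.carrier}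
    {b : N → B.carrier} {a' : N' → A'.carrier} {b' : N' → B'.carrier} (f : Hom A A') (g : Hom B B')
    (σ : N → N') (ha : ∀ n, a' (σ n) = f.toLin (a n)) (hb : ∀ n, b' (σ n) = g.toLin (b n))
    {p ξ α : ℂ} {u : A.Completion (discAt p)} {v : B.Completion discInfty}
    (H : StationaryPhase ε A B a b p ξ α u v) :
    StationaryPhase ε A' B' a' b' p ξ α (f.completionMap (discAt p) u)
      (g.completionMap discInfty v) := by
  obtain ⟨hu, hv, H⟩ := H
  refine ⟨f.map_psi hu, g.map_psiInfty hv, fun h k hh hk hm => ?_⟩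
  refine H (h ∘ₗ f.completionMapK (discAt p)) (k ∘ₗ g.completionMapK discInfty) (fun u => ?_)
    (fun v => ?_) fun n l => ?_
  · rw [LinearMap.comp_apply, Hom.completionMapK_nabla, hh]
    rfl
  · rw [LinearMap.comp_apply, Hom.completionMapK_nabla, hk]
    rfl
  · have := hm (σ n) l
    rw [ha, hb] at this
    exact this

end Functoriality

section Linear

variable {ε : ℤ} {N : Type u} {A B : WeylModule.{u}} {a : N → A.carrier} {b : N → B.carrier}
  {p ξ α : ℂ}

theorem stationaryPhase_zero : StationaryPhase ε A B a b p ξ α 0 0 :=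
  ⟨Submodule.zero_mem _, Submodule.zero_mem _, fun _ _ _ _ _ => by simp⟩

theorem _root_.StationaryPhase.add {u u' : A.Completion (discAt p)} {v v' : B.Completion discInfty}
    (h : StationaryPhase ε A B a b p ξ α u v) (h' : StationaryPhase ε A B a b p ξ α u' v') :
    StationaryPhase ε A B a b p ξ α (u + u') (v + v') :=
  ⟨Submodule.add_mem _ h.1 h'.1, Submodule.add_mem _ h.2.1 h'.2.1, fun f g hf hg hm => by
    rw [map_add, map_add, coeff_add, coeff_add, h.2.2 f g hf hg hm, h'.2.2 f g hf hg hm]⟩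

theorem _root_.StationaryPhase.smul {u : A.Completion (discAt p)} {v : B.Completion discInfty}
    (h : StationaryPhase ε A B a b p ξ α u v) (r : ℂ) :
    StationaryPhase ε A B a b p ξ α (r • u) (r • v) :=
  ⟨Submodule.smul_mem _ _ h.1, Submodule.smul_mem _ _ h.2.1, fun f g hf hg hm => by
    rw [LinearMap.map_smul_of_tower, LinearMap.map_smul_of_tower, coeff_smul, coeff_smul,
      h.2.2 f g hf hg hm]⟩

theorem stationaryPhase_smul_iff {u : A.Completion (discAt p)} {v : B.Completion discInfty} {r : ℂ}
    (hr : r ≠ 0) : StationaryPhase ε A B a b p ξ α (r • u) (r • v) ↔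
      StationaryPhase ε A B a b p ξ α u v :=
  ⟨fun h => by simpa [smul_smul, hr] using h.smul r⁻¹, fun h => h.smul r⟩

end Linear

end WeylModule

/-! ### Transport of parabolic structures -/

theorem nonintegral_add_one {α : ℂ} (hα : ∀ n : ℤ, α ≠ n) : ∀ n : ℤ, α + 1 ≠ n := fun n h =>
  hα (n - 1) (by push_cast; linear_combination h)

/-- For non-integral α the relation `R` stands for stationary phase read from either side, which
commutes with the shifts up to the scalar r. The axioms for integral α are separate hypotheses,
since there the filtration is prescribed and not transported. -/
theorem IsParabolic.transport {H H' : Type u} [AddCommGroup H] [Module ℂ H] [AddCommGroup H']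
    [Module ℂ H'] {V : ℂ → Submodule ℂ H} {T : H →ₗ[ℂ] H} {F : ℂ → ℝ → Submodule ℂ H}
    {V' : ℂ → Submodule ℂ H'} {T' : H' →ₗ[ℂ] H'} {F' : ℂ → ℝ → Submodule ℂ H'}
    (hF : IsParabolic V T F) (R : ℂ → H → H' → Prop) {r : ℂ} (hr : r ≠ 0)
    (hleft : ∀ α : ℂ, (∀ n : ℤ, α ≠ n) → ∀ u u' v, R α u v → R α u' v → u = u')
    (hzero : ∀ α : ℂ, (∀ n : ℤ, α ≠ n) → ∀ v, R α 0 v → v = 0)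
    (hex : ∀ α : ℂ, (∀ n : ℤ, α ≠ n) → ∀ v ∈ V' α, ∃ u ∈ V α, R α u v)
    (hshift : ∀ α : ℂ, (∀ n : ℤ, α ≠ n) → ∀ u v, R α u v ↔ R (α + 1) (T u) (r • T' v))
    (hT : Function.Surjective T) (hle : ∀ α β, F' α β ≤ V' α)
    (hF' : ∀ α : ℂ, (∀ n : ℤ, α ≠ n) → ∀ β v, v ∈ F' α β ↔ ∃ u ∈ F α β, R α u v)
    (hanti : ∀ n : ℤ, Antitone (F' n))
    (hcont : ∀ (n : ℤ) β, (⨅ γ : {γ : ℝ // γ < β}, F' n γ) ≤ F' n β)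
    (hint : ∀ n : ℤ, ∃ k : ℤ, F' n k = V' n ∧ F' n (k + 1) = ⊥)
    (hsh : ∀ (n : ℤ) β v, v ∈ F' n β ↔ T' v ∈ F' (n + 1) (β + 1)) : IsParabolic V' T' F' where
  antitone α := by
    by_cases hα : ∀ n : ℤ, α ≠ n
    · intro β γ h v hv
      obtain ⟨u, hu, huv⟩ := (hF' α hα _ v).1 hv
      exact (hF' α hα _ v).2 ⟨u, hF.antitone α h hu, huv⟩
    · push Not at hα
      obtain ⟨n, rfl⟩ := hα
      exact hanti n
  left_cont α β := by
    by_cases hα : ∀ n : ℤ, α ≠ n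
    · intro v hv
      rw [Submodule.mem_iInf] at hv
      -- One partner u of v serves for all γ < β, by uniqueness; left continuity of `F` then applies
      -- to it.
      obtain ⟨u, -, huv⟩ := (hF' α hα _ v).1 (hv ⟨β - 1, by linarith⟩)
      refine (hF' α hα _ v).2 ⟨u, hF.left_cont α β ?_, huv⟩
      rw [Submodule.mem_iInf]
      intro γ
      obtain ⟨u', hu', hu'v⟩ := (hF' α hα _ v).1 (hv γ)
      rwa [hleft α hα u u' v huv hu'v]
    · push Not at hα
      obtain ⟨n, rfl⟩ := hα
      exact hcont n β
  interval α := by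
    by_cases hα : ∀ n : ℤ, α ≠ n
    · obtain ⟨k, h1, h2⟩ := hF.interval α
      refine ⟨k, le_antisymm (hle _ _) fun v hv => ?_, (Submodule.eq_bot_iff _).2 fun v hv => ?_⟩
      · obtain ⟨u, hu, huv⟩ := hex α hα v hv
        exact (hF' α hα _ v).2 ⟨u, h1 ▸ hu, huv⟩
      · obtain ⟨u, hu, huv⟩ := (hF' α hα _ v).1 hv
        rw [h2, Submodule.mem_bot] at hu
        exact hzero α hα v (hu ▸ huv)
    · push Not at hα
      obtain ⟨n, rfl⟩ := hα
      exact hint n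
  shift α β v := by
    by_cases hα : ∀ n : ℤ, α ≠ n
    · rw [hF' α hα, ← Submodule.smul_mem_iff _ hr, hF' _ (nonintegral_add_one hα)]
      constructor
      · rintro ⟨u, hu, huv⟩
        exact ⟨T u, (hF.shift α β u).1 hu, (hshift α hα u v).1 huv⟩
      · rintro ⟨u, hu, huv⟩
        obtain ⟨u, rfl⟩ := hT u
        exact ⟨u, (hF.shift α β u).2 hu, (hshift α hα u v).2 huv⟩
    · push Not at hα
      obtain ⟨n, rfl⟩ := hα
      exact hsh n β v

/-- The weights of the integral eigenspaces of an admissible structure. -/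
theorem IsParabolic.mem_integral {H : Type u} [AddCommGroup H] [Module ℂ H] {V : ℂ → Submodule ℂ H}
    {T : H →ₗ[ℂ] H} {F : ℂ → ℝ → Submodule ℂ H} (hF : IsParabolic V T F) (hle : ∀ α β, F α β ≤ V α)
    (hV : ∀ α u, u ∈ V α ↔ T u ∈ V (α + 1)) (hT : Function.Bijective T) (h0 : F 0 0 = V 0)
    (h0' : ∀ β : ℝ, 0 < β → F 0 β = ⊥) (n : ℤ) (β : ℝ) (u : H) :
    u ∈ F n β ↔ u ∈ V n ∧ (β ≤ n ∨ u = 0) := by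
  induction n using Int.induction_on generalizing β u with
  | zero =>
    rw [Int.cast_zero, Int.cast_zero]
    by_cases hβ : β ≤ 0
    · have : F 0 β = V 0 := le_antisymm (hle _ _) (h0.symm.le.trans (hF.antitone 0 hβ))
      simp [this, hβ]
    · rw [h0' β (not_le.1 hβ), Submodule.mem_bot]
      constructor
      · rintro rfl
        exact ⟨Submodule.zero_mem _, Or.inr rfl⟩
      · exact fun h => h.2.resolve_left hβ
  | succ n ih =>
    obtain ⟨u, rfl⟩ := hT.2 u
    have h1 := hF.shift (n : ℤ) (β - 1) u
    rw [sub_add_cancel] at h1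
    have h2 : ((n + 1 : ℤ) : ℂ) = (n : ℤ) + 1 := by push_cast; ring
    rw [h2, ← h1, ih, hV, map_eq_zero_iff T hT.1]
    push_cast
    rw [sub_le_iff_le_add]
  | pred n ih =>
    have h1 := hF.shift ((-n - 1 : ℤ) : ℂ) β u
    have h2 : ((-n - 1 : ℤ) : ℂ) + 1 = (-n : ℤ) := by push_cast; ring
    rw [h2] at h1
    rw [h1, ih, hV ((-n - 1 : ℤ) : ℂ), h2, map_eq_zero_iff T hT.1]
    push_cast
    rw [le_sub_iff_add_le]

/-! ### The transform of a parabolic bundle -/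

namespace WeylModule

/-- `M'` is the parabolic transform of `M` with respect to a minimal extension `N` of `M`, where
`N'` is the space `N` in dual variables. -/
structure DualTransform (ε : ℤ) (P Ξ P' : Finset ℂ) {N N' : WeylModule.{u}}
    (c : N.carrier ≃ₗ[ℂ] N'.carrier) (M M' : FilteredModule.{u}) (a : Hom N M.toModule)
    (b : Hom N' M'.toModule) : Prop where
  dual : IsDualPair ε N N' c
  poles : P' = Ξ.image fun ξ => (ε : ℂ) * ξ
  isMinimalExtension : IsMinimalExtension P a
  isExtension : IsExtension P' b
  fin : ∀ ξ ∈ Ξ, FinFromInfty (-ε) M' M b.toLin (fun n => a.toLin (c.symm n)) (ε * ξ) ξ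
  inf : ∀ p ∈ P, InftyFromFin ε M M' a.toLin (fun n => b.toLin (c n)) p (-ε * p)

variable {ε : ℤ} {P Ξ P' : Finset ℂ} {N N' : WeylModule.{u}} {c : N.carrier ≃ₗ[ℂ] N'.carrier}
  {M M' : FilteredModule.{u}} {a : Hom N M.toModule} {b : Hom N' M'.toModule}

theorem _root_.IsMeromorphicBundle.hasNonintegralExponents {M : WeylModule.{u}}
    (h : IsMeromorphicBundle P Ξ M) : HasNonintegralExponents M := by
  obtain ⟨r, e, μ, γ, he, -, hμ, -⟩ := h.infinity.exists_isNormalBasis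
  exact ⟨r, e, μ, γ, he, fun i => ne_intCast_of_re (hμ i)⟩

theorem _root_.IsMeromorphicBundle.isTorsionFree {M : WeylModule.{u}}
    (h : IsMeromorphicBundle P Ξ M) : Module.IsTorsionFree ℂ[X] M.poly :=
  isTorsionFree_of_finite (isUnit_aeval_polePoly h.invertible) h.finite

theorem mulBy_bijective {M : WeylModule.{u}} {Δ : FormalDisc} {x : Δ.K} (hx : x ≠ 0) :
    Function.Bijective (M.mulBy x) :=
  ⟨smul_right_injective _ hx, fun u => ⟨x⁻¹ • u, smul_inv_smul₀ hx u⟩⟩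

namespace DualTransform

variable (T : DualTransform ε P Ξ P' c M M' a b) (hM : M.IsParabolicBundle P Ξ)
include T hM

theorem isMinimalAt (ζ : ℂ) : N'.IsMinimalAt ζ := by
  have := hM.isMeromorphicBundle.isTorsionFree
  exact isMinimalAt_of_dual T.dual hM.isMeromorphicBundle.hasNonintegralExponents
    T.isMinimalExtension.isExtension T.isMinimalExtension.injective ζ

theorem isMinimalExtension_dual : IsMinimalExtension P' b :=
  ⟨T.isExtension, T.isMinimalAt hM⟩

theorem isMeromorphicBundle :
    IsMeromorphicBundle P' (P.image fun p => -(ε : ℂ) * p) M'.toModule := by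
  obtain rfl := T.poles
  exact isMeromorphicBundle_of_dual T.dual hM.isMeromorphicBundle T.isMinimalExtension.isExtension
    T.isMinimalExtension.injective (T.isMinimalExtension.regular hM.isMeromorphicBundle)
    T.isExtension

/-- Non-integral eigenspaces receive their filtrations through stationary phase. At finite points
the integral ones are filtered trivially by definition, which gives admissibility; at infinity they
vanish, because the transform has no integral exponents there. -/
theorem isParabolicBundle :
    M'.IsParabolicBundle P' (P.image fun p => -(ε : ℂ) * p) := by
  have hM' := T.isMeromorphicBundle hM
  have ha := T.isMinimalExtension.isExtension
  have hb := T.isExtension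
  have hε : (ε : ℂ) ≠ 0 := left_ne_zero_of_mul_eq_one T.dual.sq
  obtain ⟨r, e, μ, γ, he⟩ := hM.isMeromorphicBundle.infinity.exists_isNormalBasis
  obtain ⟨r', e', μ', γ', he'⟩ := hM'.infinity.exists_isNormalBasis
  refine ⟨hM', ?_, ?_, ?_⟩
  · intro p hp
    obtain ⟨_, f, ν, hf, -⟩ := (hM'.logarithmic p hp).exists_isNormalBasis
    rw [T.poles] at hp
    obtain ⟨ξ, hξ, rfl⟩ := Finset.mem_image.1 hp
    have hT := T.fin ξ hξ
    have hξ' : ξ = -((-ε : ℤ) : ℂ) * (ε * ξ) := by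
      push_cast
      linear_combination -ξ * T.dual.sq
    have hn := he.1.twist ξ (connInfty_eq ξ)
    -- Here the source lies at infinity, so the sign of the shift is moved to the finite side as its
    -- inverse.
    refine (hM.parabolic_infinity ξ hξ).transport (fun α v u => StationaryPhase (-ε) M'.toModule
      M.toModule b.toLin (fun n => a.toLin (c.symm n)) (ε * ξ) ξ α u v) (r := ((-ε : ℤ) : ℂ)⁻¹)
      (by simpa using hε) ?_ ?_ ?_ ?_ ?_ ?_ ?_ ?_ ?_ ?_ ?_
    · exact fun α hα v v' u h h' => stationaryPhase_right_unique T.dual.symm hb ha hα hξ' hn h h'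
    · exact fun α hα u h => stationaryPhase_left_unique T.dual.symm hb ha hα hξ' hf h
        stationaryPhase_zero
    · intro α hα u hu
      obtain ⟨v, hv⟩ := exists_stationaryPhase_right T.dual.symm hb ha hα hξ' hn hu
      exact ⟨v, hv.2.1, hv⟩
    · intro α hα v u
      have h1 := stationaryPhase_shift (α := α) (u := u) (v := v) T.dual.symm.sq hf hn (a := b) (b := a)
        (c := c.symm)
      have hε' : ((-ε : ℤ) : ℂ) ≠ 0 := by simpa using hε
      have h2 := h1.trans (stationaryPhase_smul_iff (inv_ne_zero hε')).symm
      rwa [inv_smul_smul₀ hε'] at h2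
    · exact (mulBy_bijective (t_ne_zero _)).2
    · exact fun α β => M'.fin_le _ α β
    · exact fun α hα β u => hT.nonintegral α hα β u
    · intro n β γ h
      by_cases hγ : γ ≤ n
      · rw [hT.integral_le n β (h.trans hγ), hT.integral_le n γ hγ]
      · rw [hT.integral_gt n γ (not_le.1 hγ)]
        exact bot_le
    · intro n β
      by_cases hβ : β ≤ n
      · rw [hT.integral_le n β hβ]
        exact (iInf_le _ ⟨β - 1, by linarith⟩).trans (M'.fin_le _ _ _)
      · refine (iInf_le _ ⟨(n + β) / 2, by linarith [not_le.1 hβ]⟩).trans ?_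
        rw [hT.integral_gt n _ (by linarith [not_le.1 hβ])]
        exact bot_le
    · intro n
      exact ⟨n, hT.integral_le n n le_rfl, hT.integral_gt n _ (by linarith)⟩
    · intro n β u
      have h1 : (n : ℂ) + 1 = (n + 1 : ℤ) := by push_cast; ring
      rw [h1]
      by_cases hβ : β ≤ n
      · rw [hT.integral_le n β hβ, hT.integral_le (n + 1) (β + 1) (by push_cast; linarith), ← h1]
        exact (hf.t_smul_mem_iff (isConnection_connAt _)).symm
      · rw [hT.integral_gt n β (not_le.1 hβ),
          hT.integral_gt (n + 1) (β + 1) (by push_cast; linarith [not_le.1 hβ]), Submodule.mem_bot,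
          Submodule.mem_bot, map_eq_zero_iff _ (mulBy_bijective (t_ne_zero _)).1]
  · intro p hp
    rw [T.poles] at hp
    obtain ⟨ξ, hξ, rfl⟩ := Finset.mem_image.1 hp
    have hT := T.fin ξ hξ
    refine ⟨?_, fun β hβ => ?_⟩
    · have h := hT.integral_le 0 0 (by simp)
      rwa [Int.cast_zero] at h
    · have h := hT.integral_gt 0 β (by simpa using hβ)
      rwa [Int.cast_zero] at h
  · intro q hq
    obtain ⟨p, hp, rfl⟩ := Finset.mem_image.1 hq
    have hT := T.inf p hp
    obtain ⟨_, f, ν, hf, -⟩ := (hM.isMeromorphicBundle.logarithmic p hp).exists_isNormalBasis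
    have hn := he'.1.twist (-(ε : ℂ) * p) (connInfty_eq _)
    have hbot (n : ℤ) (β : ℝ) : M'.inf (-(ε : ℂ) * p) n β = ⊥ := by
      rw [← le_bot_iff, ← hM'.hasNonintegralExponents.psiInfty_eq_bot (-(ε : ℂ) * p) n]
      exact M'.inf_le _ _ _
    refine (hM.parabolic p hp).transport (fun α u v => StationaryPhase ε M.toModule
      M'.toModule a.toLin (fun n => b.toLin (c n)) p (-ε * p) α u v) hε ?_ ?_ ?_ ?_ ?_ ?_ ?_ ?_ ?_ ?_ ?_
    · exact fun α hα u u' v h h' => stationaryPhase_left_unique T.dual ha hb hα rfl hf h h'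
    · exact fun α hα v h => stationaryPhase_right_unique T.dual ha hb hα rfl hn h
        stationaryPhase_zero
    · intro α hα v hv
      obtain ⟨u, hu⟩ := exists_stationaryPhase_left T.dual ha hb hα rfl hf hv
      exact ⟨u, hu.1, hu⟩
    · exact fun α hα u v => stationaryPhase_shift T.dual.sq hf hn
    · exact (mulBy_bijective (t_ne_zero _)).2
    · exact fun α β => M'.inf_le _ α β
    · exact fun α hα β v => hT α hα β v
    · intro n β γ _
      rw [hbot, hbot]
    · intro n β
      refine (iInf_le _ ⟨β - 1, by linarith⟩).trans ?_
      rw [hbot, hbot]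
    · intro n
      exact ⟨0, by rw [hbot, hM'.hasNonintegralExponents.psiInfty_eq_bot], hbot _ _⟩
    · intro n β v
      have h1 : (n : ℂ) + 1 = (n + 1 : ℤ) := by push_cast; ring
      rw [h1, hbot, hbot, Submodule.mem_bot, Submodule.mem_bot,
        map_eq_zero_iff _ (mulBy_bijective (t_ne_zero _)).1]

end DualTransform

end WeylModule

namespace WeylModule

/-! ### Existence -/

theorem isDualPair_laplace (N : WeylModule.{u}) :
    IsDualPair 1 N N.laplace (LinearEquiv.refl ℂ N.carrier) where
  sign := Or.inl rfl
  map_d n := by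
    rw [Int.cast_one, one_smul]
    rfl
  map_x n := by
    rw [Int.cast_one, neg_one_smul]
    exact (neg_neg (N.x n)).symm

theorem isDualPair_invLaplace (N : WeylModule.{u}) :
    IsDualPair (-1) N N.invLaplace (LinearEquiv.refl ℂ N.carrier) where
  sign := Or.inr rfl
  map_d n := by
    rw [Int.cast_neg, Int.cast_one, neg_one_smul]
    exact (neg_neg (N.d n)).symm
  map_x n := by
    rw [Int.cast_neg, Int.cast_one, neg_neg, one_smul]
    rfl

/-- The regular part is an extension whose transform localizes to a bundle of the type considered,
without minimality being known. That bundle has non-integral exponents at infinity, so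
`isMinimalAt_of_dual`, applied from the transform back to the regular part, shows that the latter is
minimal. -/
theorem _root_.IsMeromorphicBundle.exists_isMinimalExtension {P Ξ : Finset ℂ} {M : WeylModule.{u}}
    (hM : IsMeromorphicBundle P Ξ M) :
    ∃ (N : WeylModule.{u}) (j : Hom N M), IsMinimalExtension P j := by
  let N := M.ofSub (M.regularPart P) (M.isSub_regularPart P)
  let j : Hom N M := M.ofSubHom (M.regularPart P) (M.isSub_regularPart P)
  have hj : IsExtension P j := isExtension_regularPart hM
  have hinj : Function.Injective j.toLin := Subtype.val_injective
  have hd := isDualPair_laplace N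
  have := hM.isTorsionFree
  have htf : Module.IsTorsionFree ℂ[X] N.laplace.poly :=
    isTorsionFree_of_injective (x_sub_injective_of_dual hd hM.hasNonintegralExponents hinj)
  have hb := isExtension_localizeHom N.laplace (Ξ.image fun ξ => ((1 : ℤ) : ℂ) * ξ)
  have hB := isMeromorphicBundle_of_dual hd hM hj hinj (fun n => n.2) hb
  have := hB.isTorsionFree
  exact ⟨N, j, hj, isMinimalAt_of_dual hd.symm hB.hasNonintegralExponents hb fun n n' h =>
    toCompletion_injective isRegular_discInfty (congrArg Subtype.val h)⟩

section Transport

variable {ε : ℤ} {N : Type u} {A B : WeylModule.{u}}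

/-- The image of a space under formal stationary phase. -/
noncomputable def transportRight (ε : ℤ) (a : N → A.carrier) (b : N → B.carrier) (p ξ α : ℂ)
    (F : Submodule ℂ (A.Completion (discAt p))) : Submodule ℂ (B.Completion discInfty) where
  carrier := {v | ∃ u ∈ F, StationaryPhase ε A B a b p ξ α u v}
  add_mem' := by
    rintro v v' ⟨u, hu, h⟩ ⟨u', hu', h'⟩
    exact ⟨u + u', F.add_mem hu hu', h.add h'⟩
  zero_mem' := ⟨0, F.zero_mem, stationaryPhase_zero⟩
  smul_mem' := by
    rintro r v ⟨u, hu, h⟩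
    exact ⟨r • u, F.smul_mem r hu, h.smul r⟩

/-- The inverse image of a space under formal stationary phase. -/
noncomputable def transportLeft (ε : ℤ) (a : N → A.carrier) (b : N → B.carrier) (p ξ α : ℂ)
    (F : Submodule ℂ (B.Completion discInfty)) : Submodule ℂ (A.Completion (discAt p)) where
  carrier := {u | ∃ v ∈ F, StationaryPhase ε A B a b p ξ α u v}
  add_mem' := by
    rintro u u' ⟨v, hv, h⟩ ⟨v', hv', h'⟩
    exact ⟨v + v', F.add_mem hv hv', h.add h'⟩
  zero_mem' := ⟨0, F.zero_mem, stationaryPhase_zero⟩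
  smul_mem' := by
    rintro r u ⟨v, hv, h⟩
    exact ⟨r • v, F.smul_mem r hv, h.smul r⟩

end Transport

open Classical in
/-- The transform, with the transported filtrations. -/
noncomputable def transformModule (ε : ℤ) {N N' B : WeylModule.{u}} (c : N.carrier ≃ₗ[ℂ] N'.carrier)
    (M : FilteredModule.{u}) (a : Hom N M.toModule) (b : Hom N' B) : FilteredModule.{u} where
  toModule := B
  fin q α β := if ∀ n : ℤ, α ≠ n then
      transportLeft (-ε) b.toLin (fun n => a.toLin (c.symm n)) q (ε * q) α (M.inf (ε * q) α β)
    else if ∃ n : ℤ, α = n ∧ β ≤ n then B.psi q α else ⊥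
  inf ζ α β := if ∀ n : ℤ, α ≠ n then
      transportRight ε a.toLin (fun n => b.toLin (c n)) (-ε * ζ) ζ α (M.fin (-ε * ζ) α β)
    else ⊥
  fin_le q α β := by
    split_ifs
    · rintro u ⟨v, -, h⟩
      exact h.1
    · exact le_rfl
    · exact bot_le
  inf_le ζ α β := by
    split_ifs
    · rintro v ⟨u, -, h⟩
      exact h.2.1
    · exact bot_le

section TransformModule

variable {ε : ℤ} {P Ξ : Finset ℂ} {N N' B : WeylModule.{u}} {c : N.carrier ≃ₗ[ℂ] N'.carrier}
  {M : FilteredModule.{u}} {a : Hom N M.toModule} {b : Hom N' B}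

theorem mem_transformModule_fin {α : ℂ} (hα : ∀ n : ℤ, α ≠ n) {q ζ : ℂ} (hζ : ζ = ε * q) (β : ℝ)
    (u : B.Completion (discAt q)) : u ∈ (transformModule ε c M a b).fin q α β ↔
      ∃ v ∈ M.inf ζ α β, StationaryPhase (-ε) B M.toModule b.toLin (fun n => a.toLin (c.symm n))
        q ζ α u v := by
  subst hζ
  have h : (transformModule ε c M a b).fin q α β = transportLeft (-ε) b.toLin
    (fun n => a.toLin (c.symm n)) q (ε * q) α (M.inf (ε * q) α β) := if_pos hα
  exact SetLike.ext_iff.1 h u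

theorem transformModule_fin_of_le {q : ℂ} {n : ℤ} {β : ℝ} (hβ : β ≤ n) :
    (transformModule ε c M a b).fin q n β = B.psi q n :=
  (if_neg fun h => h n rfl).trans (if_pos ⟨n, rfl, hβ⟩)

theorem transformModule_fin_of_lt {q : ℂ} {n : ℤ} {β : ℝ} (hβ : n < β) :
    (transformModule ε c M a b).fin q n β = ⊥ :=
  (if_neg fun h => h n rfl).trans (if_neg fun ⟨m, hm, hm'⟩ => by
    obtain rfl : n = m := by exact_mod_cast hm
    linarith)

theorem mem_transformModule_inf {α : ℂ} (hα : ∀ n : ℤ, α ≠ n) {p ζ : ℂ} (hp : p = -ε * ζ) (β : ℝ)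
    (v : B.Completion discInfty) : v ∈ (transformModule ε c M a b).inf ζ α β ↔
      ∃ u ∈ M.fin p α β, StationaryPhase ε M.toModule B a.toLin (fun n => b.toLin (c n))
        p ζ α u v := by
  subst hp
  have h : (transformModule ε c M a b).inf ζ α β = transportRight ε a.toLin
    (fun n => b.toLin (c n)) (-ε * ζ) ζ α (M.fin (-ε * ζ) α β) := if_pos hα
  exact SetLike.ext_iff.1 h v

theorem dualTransform_transformModule (hd : IsDualPair ε N N' c) (ha : IsMinimalExtension P a)
    (hb : IsExtension (Ξ.image fun ξ => (ε : ℂ) * ξ) b) :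
    DualTransform ε P Ξ (Ξ.image fun ξ => (ε : ℂ) * ξ) c M (transformModule ε c M a b) a b where
  dual := hd
  poles := rfl
  isMinimalExtension := ha
  isExtension := hb
  fin ξ _ := ⟨fun _ hα β u => mem_transformModule_fin hα (by linear_combination -ξ * hd.sq) β u,
    fun _ _ hβ => transformModule_fin_of_le hβ, fun _ _ hβ => transformModule_fin_of_lt hβ⟩
  inf p _ _ hα β v := mem_transformModule_inf hα (by linear_combination -p * hd.sq) β v

end TransformModule

/-! ### Homomorphisms of localizations -/

/-- The linear isomorphism between two localizations of `N` commutes with ∂ on `N`; by the Leibniz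
rule, after clearing denominators, it does so everywhere. -/
theorem IsExtension.exists_hom {P : Finset ℂ} {N M M' : WeylModule.{u}} {j : Hom N M}
    {j' : Hom N M'} (hj : IsExtension P j) (hj' : IsExtension P j') :
    ∃ e : Hom M M', ∀ n, e.toLin (j.toLin n) = j'.toLin n := by
  have h1 : IsLocalizedModule (Submonoid.powers (polePoly P)) j.polyMap := hj
  have h2 : IsLocalizedModule (Submonoid.powers (polePoly P)) j'.polyMap := hj'
  let E := IsLocalizedModule.linearEquiv (Submonoid.powers (polePoly P)) j.polyMap j'.polyMap
  have hE (n : N.carrier) : E (M.toPoly (j.toLin n)) = M'.toPoly (j'.toLin n) :=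
    IsLocalizedModule.linearEquiv_apply _ _ _ _
  let f : M.carrier →ₗ[ℂ] M'.carrier :=
    M'.toPoly.symm.toLinearMap ∘ₗ E.toLinearMap.restrictScalars ℂ ∘ₗ M.toPoly.toLinearMap
  have hf (m : M.carrier) : M'.toPoly (f m) = E (M.toPoly m) := M'.toPoly.apply_symm_apply _
  have hfj (n : N.carrier) : f (j.toLin n) = j'.toLin n :=
    M'.toPoly.injective (by rw [hf, hE])
  have hq (q : ℂ[X]) (m : M.carrier) : f (Polynomial.aeval M.x q m) = Polynomial.aeval M'.x q (f m) :=
    M'.toPoly.injective (by rw [hf, ← smul_toPoly, map_smul, ← hf, smul_toPoly])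
  refine ⟨⟨f, fun m => by simpa using hq Polynomial.X m, fun m => ?_⟩, hfj⟩
  obtain ⟨k, n, hn⟩ := IsExtension.exists_eq hj m
  refine ((Module.End.isUnit_iff _).1 (IsExtension.isUnit hj' k)).1 ?_
  have h3 := congrArg f (d_aeval (polePoly P ^ k) m)
  rw [hn, ← j.map_d, hfj, map_add, hq, hq, j'.map_d, ← hfj, ← hn, hq, d_aeval] at h3
  exact (add_left_cancel h3).symm

end WeylModule

namespace WeylModule

/-! ### The inverse transform -/

variable {ε : ℤ} {P Ξ P' Ξ' : Finset ℂ} {N N' N₂ N₂' : WeylModule.{u}}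
  {c : N.carrier ≃ₗ[ℂ] N'.carrier} {c₂ : N₂.carrier ≃ₗ[ℂ] N₂'.carrier}
  {M M' M'' : FilteredModule.{u}} {a : Hom N M.toModule} {b : Hom N' M'.toModule}
  {a₂ : Hom N₂ M'.toModule} {b₂ : Hom N₂' M''.toModule}

/-- A homomorphism in dual variables. -/
def Hom.dual (hd : IsDualPair ε N N' c) (hd₂ : IsDualPair (-ε) N₂ N₂' c₂) (w : Hom N' N₂) :
    Hom N N₂' where
  toLin := c₂.toLinearMap ∘ₗ w.toLin ∘ₗ c.toLinearMap
  map_x n := by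
    change c₂ (w.toLin (c (N.x n))) = N₂'.x (c₂ (w.toLin (c n)))
    rw [hd.map_x, map_smul, w.map_d, map_smul, hd₂.map_d, smul_smul]
    push_cast
    rw [neg_mul_neg, hd.sq, one_smul]
  map_d n := by
    change c₂ (w.toLin (c (N.d n))) = N₂'.d (c₂ (w.toLin (c n)))
    rw [hd.map_d, map_smul, w.map_x, map_smul, hd₂.map_x, smul_smul]
    push_cast
    rw [neg_neg, hd.sq, one_smul]

theorem IsExtension.comp_bijective {P : Finset ℂ} {N N' M : WeylModule.{u}} {j : Hom N' M}
    {j' : Hom N M} (hj : IsExtension P j) {W : Hom N N'} (hW : Function.Bijective W.toLin)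
    (h : ∀ n, j'.toLin n = j.toLin (W.toLin n)) (hinj : Function.Injective j.toLin) :
    IsExtension P j' := by
  refine isExtension_of (by simpa using IsExtension.isUnit hj 1) (fun m => ?_) fun n n' hn => ?_
  · obtain ⟨k, n, hn⟩ := IsExtension.exists_eq hj m
    obtain ⟨n, rfl⟩ := hW.2 n
    exact ⟨k, n, by rw [hn, h]⟩
  · rw [h, h] at hn
    exact hW.1 (hinj hn)

theorem DualTransform.mem_fin_integral (hM : M.IsParabolicBundle P Ξ) {p : ℂ} (hp : p ∈ P) (n : ℤ)
    (β : ℝ) (u : M.toModule.Completion (discAt p)) :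
    u ∈ M.fin p n β ↔ u ∈ M.toModule.psi p n ∧ (β ≤ n ∨ u = 0) := by
  obtain ⟨_, f, ν, hf, -⟩ := (hM.isMeromorphicBundle.logarithmic p hp).exists_isNormalBasis
  exact (hM.parabolic p hp).mem_integral (M.fin_le p)
    (fun α u => (hf.t_smul_mem_iff (isConnection_connAt _)).symm)
    (mulBy_bijective (t_ne_zero _)) (hM.admissible p hp).1 (hM.admissible p hp).2 n β u

/-- Both `N'` and `N₂` are minimal extensions of `M'`, hence isomorphic; in dual variables this
makes `M` and `M''` localizations of the same `N`. Their filtrations are compared through the one on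
`M'`, to which both are tied by the same stationary phase relation. -/
theorem DualTransform.exists_iso (T : DualTransform ε P Ξ P' c M M' a b)
    (hM : M.IsParabolicBundle P Ξ) (hΞ' : Ξ' = P.image fun p => -(ε : ℂ) * p)
    (S : DualTransform (-ε) P' Ξ' P c₂ M' M'' a₂ b₂) :
    ∃ (w : Hom N' N₂) (e : Hom M.toModule M''.toModule), Function.Bijective w.toLin ∧
      IsParabolicIso P Ξ e ∧ (∀ n, a₂.toLin (w.toLin n) = b.toLin n) ∧
        ∀ n, e.toLin (a.toLin n) = b₂.toLin (c₂ (w.toLin (c n))) := by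
  have hM' := T.isParabolicBundle hM
  rw [← hΞ'] at hM'
  have hM'' := S.isParabolicBundle hM'
  obtain ⟨w, hw, hw'⟩ := (T.isMinimalExtension_dual hM).exists_iso S.isMinimalExtension
  let W : Hom N N₂' := w.dual T.dual S.dual
  have hW : Function.Bijective W.toLin := c₂.bijective.comp (hw.comp c.bijective)
  have hext : ∃ j : Hom N M''.toModule, ∀ n, j.toLin n = b₂.toLin (W.toLin n) :=
    ⟨⟨b₂.toLin ∘ₗ W.toLin, fun n => by simp [W.map_x, b₂.map_x],
      fun n => by simp [W.map_d, b₂.map_d]⟩, fun _ => rfl⟩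
  obtain ⟨j, hj⟩ := hext
  have hjext : IsExtension P j := IsExtension.comp_bijective S.isExtension hW hj
    (S.isMinimalExtension_dual hM').injective
  obtain ⟨e, he⟩ := IsExtension.exists_hom T.isMinimalExtension.isExtension hjext
  obtain ⟨e', he'⟩ := IsExtension.exists_hom hjext T.isMinimalExtension.isExtension
  have hinv {M₁ M₂ : WeylModule.{u}} {j₁ : Hom N M₁} {j₂ : Hom N M₂} (h₁ : IsExtension P j₁)
      {f : Hom M₁ M₂} {g : Hom M₂ M₁} (hf : ∀ n, f.toLin (j₁.toLin n) = j₂.toLin n)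
      (hg : ∀ n, g.toLin (j₂.toLin n) = j₁.toLin n) (m : M₁.carrier) :
      g.toLin (f.toLin m) = m := by
    obtain ⟨k, n, hn⟩ := IsExtension.exists_eq h₁ m
    refine ((Module.End.isUnit_iff _).1 (IsExtension.isUnit h₁ k)).1 ?_
    rw [← g.map_aeval, ← f.map_aeval, hn, hf, hg]
  have hee' := hinv T.isMinimalExtension.isExtension he he'
  have he'e := hinv hjext he' he
  refine ⟨w, e, hw, ⟨⟨Function.LeftInverse.injective hee', Function.RightInverse.surjective he'e⟩,
    fun p hp α β => ?_, fun ξ hξ α β => ?_⟩, hw', fun n => (he n).trans (hj n)⟩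
  · by_cases hα : ∀ n : ℤ, α ≠ n
    · have hq : -(ε : ℂ) * p ∈ Ξ' := hΞ' ▸ Finset.mem_image_of_mem _ hp
      have hS := S.fin _ hq
      have hp' : ((-ε : ℤ) : ℂ) * (-ε * p) = p := by
        push_cast
        linear_combination p * T.dual.sq
      have hd₂ := S.dual.symm
      rw [neg_neg] at hS hd₂
      rw [hp'] at hS
      -- After the double change of sign, the relation belonging to `S` is the one belonging to `T`,
      -- carried along `e`.
      have hmap {u : M.toModule.Completion (discAt p)} {v} (h : StationaryPhase ε M.toModule
          M'.toModule a.toLin (fun n => b.toLin (c n)) p (-ε * p) α u v) :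
          StationaryPhase ε M''.toModule M'.toModule b₂.toLin (fun n => a₂.toLin (c₂.symm n)) p
            (-ε * p) α (e.completionMap (discAt p) u) v := by
        have := stationaryPhase_map e (Hom.id _) (fun n => c₂ (w.toLin (c n)))
          (a' := b₂.toLin) (b' := fun n => a₂.toLin (c₂.symm n))
          (fun n => ((he n).trans (hj n)).symm)
          (fun n => by rw [LinearEquiv.symm_apply_apply, hw']; rfl) h
        rwa [Hom.completionMap_id] at this
      obtain ⟨_, f, ν, hf, -⟩ := (hM''.isMeromorphicBundle.logarithmic p hp).exists_isNormalBasis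
      ext u
      rw [Submodule.mem_map, hS.nonintegral α hα]
      constructor
      · rintro ⟨u, hu, rfl⟩
        obtain ⟨_, f', ν', _, hf', -⟩ := hM'.isMeromorphicBundle.infinity.exists_isNormalBasis
        obtain ⟨v, hv⟩ := exists_stationaryPhase_right T.dual T.isMinimalExtension.isExtension
          T.isExtension hα rfl (hf'.twist (-(ε : ℂ) * p) (connInfty_eq _)) (M.fin_le _ _ _ hu)
        exact ⟨v, (T.inf p hp α hα β v).2 ⟨u, hu, hv⟩, hmap hv⟩
      · rintro ⟨v, hv, huv⟩
        obtain ⟨u', hu', hu'v⟩ := (T.inf p hp α hα β v).1 hv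
        exact ⟨u', hu', stationaryPhase_left_unique hd₂ S.isExtension
          S.isMinimalExtension.isExtension hα rfl hf (hmap hu'v) huv⟩
    -- On integral eigenspaces admissibility and the shift determine the filtration, so any
    -- isomorphism respects it.
    · push Not at hα
      obtain ⟨n, rfl⟩ := hα
      ext u
      rw [Submodule.mem_map, DualTransform.mem_fin_integral hM'' hp]
      constructor
      · rintro ⟨u, hu, rfl⟩
        obtain ⟨h1, h2⟩ := (DualTransform.mem_fin_integral hM hp n β u).1 hu
        exact ⟨e.map_psi h1, h2.imp_right fun h => by rw [h, map_zero]⟩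
      · rintro ⟨h1, h2⟩
        exact ⟨e'.completionMap _ u, (DualTransform.mem_fin_integral hM hp n β _).2
          ⟨e'.map_psi h1, h2.imp_right fun h => by rw [h, map_zero]⟩,
          Hom.completionMap_leftInverse he'e u⟩
  · by_cases hα : ∀ n : ℤ, α ≠ n
    · have hq : (ε : ℂ) * ξ ∈ P' := T.poles ▸ Finset.mem_image_of_mem _ hξ
      have hS := S.inf _ hq
      have hξ' : -((-ε : ℤ) : ℂ) * (ε * ξ) = ξ := by
        push_cast
        linear_combination ξ * T.dual.sq
      rw [hξ'] at hS
      have hT := T.fin ξ hξ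
      have hmap {u} {v : M.toModule.Completion discInfty} (h : StationaryPhase (-ε) M'.toModule
          M.toModule b.toLin (fun n => a.toLin (c.symm n)) (ε * ξ) ξ α u v) :
          StationaryPhase (-ε) M'.toModule M''.toModule a₂.toLin (fun n => b₂.toLin (c₂ n)) (ε * ξ)
            ξ α u (e.completionMap discInfty v) := by
        have := stationaryPhase_map (Hom.id _) e (fun n => w.toLin n)
          (a' := a₂.toLin) (b' := fun n => b₂.toLin (c₂ n)) (fun n => hw' n)
          (fun n => by
            have := (he (c.symm n)).trans (hj _)
            rw [this]
            change _ = b₂.toLin (c₂ (w.toLin (c (c.symm n))))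
            rw [LinearEquiv.apply_symm_apply]) h
        rwa [Hom.completionMap_id] at this
      obtain ⟨_, f, ν, _, hf, -⟩ := hM''.isMeromorphicBundle.infinity.exists_isNormalBasis
      ext v
      rw [Submodule.mem_map, hS α hα]
      constructor
      · rintro ⟨v, hv, rfl⟩
        obtain ⟨_, f', ν', hf', -⟩ := (hM'.isMeromorphicBundle.logarithmic _ hq).exists_isNormalBasis
        obtain ⟨u, hu⟩ := exists_stationaryPhase_left T.dual.symm T.isExtension
          T.isMinimalExtension.isExtension hα hξ'.symm hf' (M.inf_le _ _ _ hv)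
        exact ⟨u, (hT.nonintegral α hα β u).2 ⟨v, hv, hu⟩, hmap hu⟩
      · rintro ⟨u, hu, huv⟩
        obtain ⟨v', hv', huv'⟩ := (hT.nonintegral α hα β u).1 hu
        exact ⟨v', hv', stationaryPhase_right_unique S.dual S.isMinimalExtension.isExtension
          S.isExtension hα hξ'.symm (hf.twist ξ (connInfty_eq ξ)) (hmap huv') huv⟩
    -- Neither bundle has integral exponents at infinity, so both filtrations are zero.
    · push Not at hα
      obtain ⟨n, rfl⟩ := hα
      have h1 : M.inf ξ n β = ⊥ := by
        rw [← le_bot_iff, ← hM.isMeromorphicBundle.hasNonintegralExponents.psiInfty_eq_bot ξ n]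
        exact M.inf_le _ _ _
      have h2 : M''.inf ξ n β = ⊥ := by
        rw [← le_bot_iff, ← hM''.isMeromorphicBundle.hasNonintegralExponents.psiInfty_eq_bot ξ n]
        exact M''.inf_le _ _ _
      rw [h1, h2, Submodule.map_bot]

end WeylModule

namespace WeylModule

/-! ### The two transforms -/

theorem negPoints_eq_image (P : Finset ℂ) :
    negPoints P = P.image fun p => -((1 : ℤ) : ℂ) * p := by
  simp [negPoints, Finset.map_eq_image]

theorem image_one_mul (Ξ : Finset ℂ) : (Ξ.image fun ξ => ((1 : ℤ) : ℂ) * ξ) = Ξ := by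
  simp

theorem image_neg_neg_one_mul (Ξ : Finset ℂ) : (Ξ.image fun ξ => -((-1 : ℤ) : ℂ) * ξ) = Ξ := by
  simp

theorem image_negPoints (P : Finset ℂ) :
    ((negPoints P).image fun p => ((-1 : ℤ) : ℂ) * p) = P := by
  simp [negPoints_eq_image, Finset.image_image]

variable {P Ξ : Finset ℂ} {M M' : FilteredModule.{u}}

theorem mem_negPoints {P : Finset ℂ} {q : ℂ} : q ∈ negPoints P ↔ -q ∈ P := by
  simp [negPoints]

theorem dualTransform_of_minimalLaplace (T : MinimalLaplace P Ξ M M') :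
    DualTransform (N' := T.N.laplace) 1 P Ξ Ξ (LinearEquiv.refl ℂ T.N.carrier) M M' T.ext T.loc where
  dual := isDualPair_laplace T.N
  poles := (image_one_mul Ξ).symm
  isMinimalExtension := T.isMinimalExtension
  isExtension := T.isExtension
  fin ξ hξ := by
    rw [Int.cast_one, one_mul]
    exact T.fin ξ hξ
  inf p hp := by
    rw [Int.cast_one, neg_one_mul]
    exact T.inf p hp

theorem dualTransform_of_inverseMinimalLaplace (S : InverseMinimalLaplace P Ξ M' M) :
    DualTransform (N' := S.N.invLaplace) (-1) Ξ (negPoints P) P (LinearEquiv.refl ℂ S.N.carrier)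
      M' M S.ext S.loc where
  dual := isDualPair_invLaplace S.N
  poles := (image_negPoints P).symm
  isMinimalExtension := S.isMinimalExtension
  isExtension := S.isExtension
  fin q hq := by
    have := S.fin _ (mem_negPoints.1 hq)
    rw [neg_neg] at this
    rw [Int.cast_neg, Int.cast_one, neg_one_mul]
    exact this
  inf ξ hξ := by
    rw [Int.cast_neg, Int.cast_one, neg_neg, one_mul]
    exact S.inf ξ hξ

/-- The transform defined by the dual of a minimal extension. -/
theorem exists_dualTransform {ε : ℤ} {P' : Finset ℂ} {N N' : WeylModule.{u}}
    {c : N.carrier ≃ₗ[ℂ] N'.carrier} {a : Hom N M.toModule} (hM : M.IsParabolicBundle P Ξ)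
    (hd : IsDualPair ε N N' c) (ha : IsMinimalExtension P a)
    (hP' : P' = Ξ.image fun ξ => (ε : ℂ) * ξ) :
    ∃ (M' : FilteredModule.{u}) (b : Hom N' M'.toModule), DualTransform ε P Ξ P' c M M' a b := by
  subst hP'
  have := hM.isMeromorphicBundle.isTorsionFree
  have := isTorsionFree_of_injective
    (x_sub_injective_of_dual hd hM.isMeromorphicBundle.hasNonintegralExponents ha.injective)
  exact ⟨_, _, dualTransform_transformModule hd ha (isExtension_localizeHom N' _)⟩

theorem exists_minimalLaplace (hM : M.IsParabolicBundle P Ξ) :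
    ∃ M' : FilteredModule.{u}, Nonempty (MinimalLaplace P Ξ M M') := by
  obtain ⟨N, a, ha⟩ := hM.isMeromorphicBundle.exists_isMinimalExtension
  obtain ⟨M', b, h⟩ := exists_dualTransform hM (isDualPair_laplace N) ha (image_one_mul Ξ).symm
  refine ⟨M', ⟨⟨N, a, ha, b, h.isExtension, fun ξ hξ => ?_, fun p hp => ?_⟩⟩⟩
  · have := h.fin ξ hξ
    rwa [Int.cast_one, one_mul] at this
  · have := h.inf p hp
    rwa [Int.cast_one, neg_one_mul] at this

theorem exists_inverseMinimalLaplace (hM : M'.IsParabolicBundle Ξ (negPoints P)) :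
    ∃ M : FilteredModule.{u}, Nonempty (InverseMinimalLaplace P Ξ M' M) := by
  obtain ⟨N, a, ha⟩ := hM.isMeromorphicBundle.exists_isMinimalExtension
  obtain ⟨M, b, h⟩ := exists_dualTransform hM (isDualPair_invLaplace N) ha
    (image_negPoints P).symm
  refine ⟨M, ⟨⟨N, a, ha, b, h.isExtension, fun p hp => ?_, fun ξ hξ => ?_⟩⟩⟩
  · have := h.fin (-p) (mem_negPoints.2 (by rwa [neg_neg]))
    rw [Int.cast_neg, Int.cast_one, neg_one_mul, neg_neg p] at this
    exact this
  · have := h.inf ξ hξ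
    rwa [Int.cast_neg, Int.cast_one, neg_neg, one_mul] at this

theorem isMinimalAt_dual {ε : ℤ} {N N' : WeylModule.{u}} {c : N.carrier ≃ₗ[ℂ] N'.carrier}
    {A : WeylModule.{u}} {a : Hom N A} (hA : IsMeromorphicBundle P Ξ A) (hd : IsDualPair ε N N' c)
    (ha : IsMinimalExtension P a) (ζ : ℂ) : N'.IsMinimalAt ζ :=
  have := hA.isTorsionFree
  isMinimalAt_of_dual hd hA.hasNonintegralExponents ha.isExtension ha.injective ζ

end WeylModule

theorem proposition4p2 (P Ξ : Finset ℂ) :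
    (∀ M : FilteredModule.{u}, M.IsParabolicBundle P Ξ →
      (∀ (N : WeylModule.{u}) (j : WeylModule.Hom N M.toModule), IsMinimalExtension P j →
        ∀ ξ ∈ Ξ, N.laplace.IsMinimalAt ξ) ∧
      (∃ M' : FilteredModule.{u}, Nonempty (MinimalLaplace P Ξ M M')) ∧
      ∀ (M' : FilteredModule.{u}) (T : MinimalLaplace P Ξ M M'),
        M'.IsParabolicBundle Ξ (negPoints P) ∧
        IsMinimalExtension Ξ T.loc ∧
        ∀ (M'' : FilteredModule.{u}) (S : InverseMinimalLaplace P Ξ M' M''),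
          ∃ (w : WeylModule.Hom T.N.laplace S.N) (e : WeylModule.Hom M.toModule M''.toModule),
            Function.Bijective w.toLin ∧ IsParabolicIso P Ξ e ∧
            (∀ n : T.N.carrier, S.ext.toLin (w.toLin n) = T.loc.toLin n) ∧
            (∀ n : T.N.carrier, e.toLin (T.ext.toLin n) = S.loc.toLin (w.toLin n))) ∧
    (∀ M' : FilteredModule.{u}, M'.IsParabolicBundle Ξ (negPoints P) →
      (∀ (N : WeylModule.{u}) (j : WeylModule.Hom N M'.toModule), IsMinimalExtension Ξ j →
        ∀ p ∈ P, N.invLaplace.IsMinimalAt p) ∧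
      (∃ M : FilteredModule.{u}, Nonempty (InverseMinimalLaplace P Ξ M' M)) ∧
      ∀ (M : FilteredModule.{u}) (S : InverseMinimalLaplace P Ξ M' M),
        M.IsParabolicBundle P Ξ ∧
        IsMinimalExtension P S.loc ∧
        ∀ (M'' : FilteredModule.{u}) (T : MinimalLaplace P Ξ M M''),
          ∃ (w : WeylModule.Hom S.N.invLaplace T.N) (e : WeylModule.Hom M'.toModule M''.toModule),
            Function.Bijective w.toLin ∧ IsParabolicIso Ξ (negPoints P) e ∧
            (∀ n : S.N.carrier, T.ext.toLin (w.toLin n) = S.loc.toLin n) ∧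
            (∀ n : S.N.carrier, e.toLin (S.ext.toLin n) = T.loc.toLin (w.toLin n))) := by
  refine ⟨fun M hM => ⟨fun N j hj ξ _ => WeylModule.isMinimalAt_dual hM.isMeromorphicBundle
      (WeylModule.isDualPair_laplace N) hj ξ, WeylModule.exists_minimalLaplace hM,
      fun M' T => ?_⟩,
    fun M' hM' => ⟨fun N j hj p _ => WeylModule.isMinimalAt_dual hM'.isMeromorphicBundle
      (WeylModule.isDualPair_invLaplace N) hj p, WeylModule.exists_inverseMinimalLaplace hM',
      fun M S => ?_⟩⟩
  · have hT := WeylModule.dualTransform_of_minimalLaplace T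
    have h := hT.isParabolicBundle hM
    rw [← WeylModule.negPoints_eq_image] at h
    exact ⟨h, hT.isMinimalExtension_dual hM, fun M'' S => hT.exists_iso hM
      (WeylModule.negPoints_eq_image P) (WeylModule.dualTransform_of_inverseMinimalLaplace S)⟩
  · have hS := WeylModule.dualTransform_of_inverseMinimalLaplace S
    have h := hS.isParabolicBundle hM'
    rw [WeylModule.image_neg_neg_one_mul] at h
    exact ⟨h, hS.isMinimalExtension_dual hM', fun M'' T => hS.exists_iso hM'
      (WeylModule.image_neg_neg_one_mul Ξ).symm (WeylModule.dualTransform_of_minimalLaplace T)⟩
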